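/- **Setting.** Let $K\ge 2$ be fixed. Consider a sequence of problems indexed by $m\in\mathbb N$, with dimension $p=p(m)$ and total sample size $n=n(m)$. For each $m$ let $F$ (depending on $m$) be a probability distribution on $\mathbb R^p$, and let $X_1,X_2,\dots$ be i.i.d. from $F$. With $\|\cdot\|$ the Euclidean norm, put $$d(x,y)=\|x-y\|-\mathbb E\|x-X_1\|-\mathbb E\|X_1-y\|+\mathbb E\|X_1-X_2\| .$$ Assume that for each $m$ - (C1) $\mathbb E\|X_1\|^4<\infty$, and $\mathbb E\,d^2(X_1,X_2)>0$; and that, as $m\to\infty$, - (C2) $\dfrac{\mathbb E\, d^4(X_1,X_2)}{n\,(\mathbb E\, d^2(X_1,X_2))^2}\to 0$; - (C3) $\dfrac{\mathbb E\,[d(X_1,X_3)d(X_2,X_3)d(X_1,X_4)d(X_2,X_4)]}{(\mathbb E\, d^2(X_1,X_2))^2}\to 0$. **Statistics.** For data $X_1,\dots,X_n\in\mathbb R^p$ with labels $Y_1,\dots,Y_n\in\{1,\dots,K\}$, let $n_k=\#\{i:Y_i=k\}$, $\hat p_k=n_k/n$, $$\hat\Delta=\binom n2^{-1}\sum_{i<j}\|X_i-X_j\|,\qquad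 \hat\Delta_k=\binom{n_k}2^{-1}\sum_{i<j,\;Y_i=Y_j=k}\|X_i-X_j\|,$$ $$\mathrm{gCov}_n=\hat\Delta-\sum_{k=1}^K\hat p_k\hat\Delta_k,\qquad \mathrm{gCor}_n=\mathrm{gCov}_n/\hat\Delta,$$ $$\hat\sigma_0^2=\Big(\sum_{k=1}^K\hat p_k^2\binom{n_k}2^{-1}-\binom n2^{-1}\Big)V_n^2,\qquad V_n^2=\frac1{n(n-3)}\sum_{k\ne l}A_{k,l}^2,$$ $$A_{k,l}=\|X_k-X_l\|-\frac1{n-2}\sum_{i=1}^n\|X_i-X_l\|-\frac1{n-2}\sum_{j=1}^n\|X_k-X_j\|+\frac1{(n-1)(n-2)}\sum_{i,j=1}^n\|X_i-X_j\| .$$ **Claim.** Let $p\to\infty$. Then $$\frac{\hat\Delta}{\hat\sigma_0}\,\mathrm{gCor}_n\ \xrightarrow{\;d\;}\ \mathcal N(0,1)$$ under each of the following two sampling schemes, in which the numerical variable $X$ and the label $Y$ are independent. 1. *Random labels.* For each $m$ the data $(X_i,Y_i)$, $1\le i\le n$, are i.i.d. copies of a pair $(X,Y)$, where $X\sim F$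 and $Y$ are independent and $P(Y=k)=p_k>0$ with $p_1,\dots,p_K$ not depending on $m$; and $n\to\infty$ (which is equivalent to $\min_k n_k\to\infty$ in probability). 2. *Fixed class sizes.* For each $m$ the labels are deterministic and all observations $X_1,\dots,X_n$ are i.i.d. from $F$, so that every class has the distribution $F$; and $\min_k n_k\to\infty$ with $\liminf_{m\to\infty} n_k/n>0$ for every $k$. -/

import Mathlib

open MeasureTheory ProbabilityTheory Filter
open scoped Topology

namespace GiniCor

noncomputable section

/-- `ℝ^p` with the Euclidean norm. -/
abbrev Eucl (p : ℕ) : Type := EuclideanSpace ℝ (Fin p)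

/-! ### Population quantities of a distribution `F` on `ℝ^p` -/

/-- The double centered distance
`d(x, y) = ‖x - y‖ - E‖x - X‖ - E‖X - y‖ + E‖X - X'‖`, where `X, X'` are i.i.d. from `F`. -/
def doubleCenteredDist {p : ℕ} (F : Measure (Eucl p)) (x y : Eucl p) : ℝ :=
  ‖x - y‖ - (∫ z, ‖x - z‖ ∂F) - (∫ z, ‖z - y‖ ∂F) + ∫ z, ‖z.1 - z.2‖ ∂(F.prod F)

/-- `E d(X₁, X₂) ^ r` for `X₁, X₂` i.i.d. from `F`. -/
def centeredMoment {p : ℕ} (F : Measure (Eucl p)) (r : ℕ) : ℝ :=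
  ∫ z, doubleCenteredDist F z.1 z.2 ^ r ∂(F.prod F)

/-- `E [d(X₁, X₃) d(X₂, X₃) d(X₁, X₄) d(X₂, X₄)]` for `X₁, X₂, X₃, X₄` i.i.d. from `F`
(they are the coordinates `x 0, x 1, x 2, x 3`). -/
def cyclicMoment {p : ℕ} (F : Measure (Eucl p)) : ℝ :=
  ∫ x : Fin 4 → Eucl p,
    doubleCenteredDist F (x 0) (x 2) * doubleCenteredDist F (x 1) (x 2) *
      doubleCenteredDist F (x 0) (x 3) * doubleCenteredDist F (x 1) (x 3)
    ∂(Measure.pi fun _ => F)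

/-! ### Sample quantities of numerical data `x₁, …, x_n` in `ℝ^p` with labels in `{1, …, K}` -/

/-- The indices of the observations in the class `k`. -/
def classIndices {n K : ℕ} (y : Fin n → Fin K) (k : Fin K) : Finset (Fin n) :=
  Finset.univ.filter fun i => y i = k

/-- The class size `n_k`. -/
def classSize {n K : ℕ} (y : Fin n → Fin K) (k : Fin K) : ℕ :=
  (classIndices y k).card

/-- The U-statistic estimator of the Gini mean difference from the observations with index in `s`:
the mean of `‖x_i - x_j‖` over the pairs `i < j` in `s`. -/
def giniMeanDiff {n p : ℕ} (x : Fin n → Eucl p) (s : Finset (Fin n)) : ℝ :=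
  ((s.card.choose 2 : ℕ) : ℝ)⁻¹ *
    ∑ q ∈ (s ×ˢ s).filter (fun q => q.1 < q.2), ‖x q.1 - x q.2‖

/-- `Δ̂`, from the whole sample. -/
def deltaHat {n p : ℕ} (x : Fin n → Eucl p) : ℝ :=
  giniMeanDiff x Finset.univ

/-- `Δ̂_k`, from the class `k`. -/
def deltaHatClass {n p K : ℕ} (x : Fin n → Eucl p) (y : Fin n → Fin K) (k : Fin K) : ℝ :=
  giniMeanDiff x (classIndices y k)

/-- The class proportion `p̂_k = n_k / n`. -/
def pHat {n K : ℕ} (y : Fin n → Fin K) (k : Fin K) : ℝ :=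
  (classSize y k : ℝ) / (n : ℝ)

/-- The sample Gini covariance. -/
def gCovSample {n p K : ℕ} (x : Fin n → Eucl p) (y : Fin n → Fin K) : ℝ :=
  deltaHat x - ∑ k, pHat y k * deltaHatClass x y k

/-- The sample Gini correlation. -/
def gCorSample {n p K : ℕ} (x : Fin n → Eucl p) (y : Fin n → Fin K) : ℝ :=
  gCovSample x y / deltaHat x

/-- The centered sample distance `A_{k,l}`. -/
def sampleCenteredDist {n p : ℕ} (x : Fin n → Eucl p) (k l : Fin n) : ℝ :=
  ‖x k - x l‖ - 1 / ((n : ℝ) - 2) * ∑ i, ‖x i - x l‖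
    - 1 / ((n : ℝ) - 2) * ∑ j, ‖x k - x j‖
    + 1 / (((n : ℝ) - 1) * ((n : ℝ) - 2)) * ∑ i, ∑ j, ‖x i - x j‖

/-- The bias-corrected estimator `V_n²` of the squared distance variance. -/
def distVarHat {n p : ℕ} (x : Fin n → Eucl p) : ℝ :=
  1 / ((n : ℝ) * ((n : ℝ) - 3)) *
    ∑ q ∈ (Finset.univ : Finset (Fin n × Fin n)).filter (fun q => q.1 ≠ q.2),
      sampleCenteredDist x q.1 q.2 ^ 2

/-- `σ̂₀² = (∑ₖ p̂ₖ² C(nₖ, 2)⁻¹ - C(n, 2)⁻¹) V_n²`. -/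
def sigmaHatSq {n p K : ℕ} (x : Fin n → Eucl p) (y : Fin n → Fin K) : ℝ :=
  ((∑ k, pHat y k ^ 2 * (((classSize y k).choose 2 : ℕ) : ℝ)⁻¹) - ((n.choose 2 : ℕ) : ℝ)⁻¹) *
    distVarHat x

/-- `σ̂₀`. -/
def sigmaHat {n p K : ℕ} (x : Fin n → Eucl p) (y : Fin n → Fin K) : ℝ :=
  Real.sqrt (sigmaHatSq x y)

/-- The rescaled sample Gini correlation `(Δ̂ / σ̂₀) gCor_n`. -/
def rescaledGCor {n p K : ℕ} (x : Fin n → Eucl p) (y : Fin n → Fin K) : ℝ :=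
  deltaHat x / sigmaHat x y * gCorSample x y

end

end GiniCor

/-! Write the distance as d(x, y) plus functions of one variable. When all observations have law F,
the class-weighted averages of these additive parts agree with those of the whole sample, so for
fixed labels gCov is exactly a quadratic form ½ ∑ a_ij d(X_i, X_j) in a degenerate kernel
(`gCovSample_eq`). The factor Δ̂ cancels from the statistic. With the weights divided by
`√(varFactor y)` and the root of E d², call the form S; its squared weights are normalized by ∑
a_ij² E d² = 2.

Normality of S comes from a Stein argument on φ(t) = E exp(itS). Let L_i collect the terms of S
containing X_i; then ∑ L_i = 2S, and S - L_i does not involve X_i. Since L_i is centered given the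
other coordinates, expanding exp(itL_i) gives E L_i exp(itS) ≈ it E Γ_i exp(itS), with Γ_i the
conditional second moment of L_i. If ∑ Γ_i is close to its mean 2, then φ' ≈ -tφ, hence φ(t) ≈
exp(-t²/2).

Two errors remain. The fourth moments of the L_i are governed by E d⁴/(n (E d²)²), that is by (C2).
The fluctuation of ∑ Γ_i, a quadratic form in the Gram kernel of d, splits into a diagonal part,
again governed by (C2), and a degenerate off-diagonal part, governed by E gram², which is the cyclic
moment of (C3). Both use that the standardized weights are O(1/n), which holds because K ≥ 2 and the
class proportions are bounded below. The outcome is `norm_integral_exp_quadForm_sub_gaussian_le`.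

U-centering also removes the additive parts, so V_n² is the average of d(X_i, X_j)² up to lower
order terms, and V_n²/E d² tends to 1 in L¹ by (C2) (`integral_abs_distVarHat_div_sub_one_le`).

All bounds are uniform over labellings whose proportions are at least c. This settles fixed class
sizes; for random labels one conditions on the labels, and Chebyshev's inequality makes the excluded
labellings rare. -/

namespace GiniCor

/-! ### Resampling one coordinate of an i.i.d. sample. -/

section ProductMeasure

variable {ι E : Type*} [Fintype ι] [DecidableEq ι] [MeasurableSpace E]
  (F : Measure E) [IsProbabilityMeasure F]

/-- Resampling the coordinate `i` preserves the law of an i.i.d. sample. -/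
lemma measurePreserving_update (i : ι) :
    MeasurePreserving (fun q : (ι → E) × E => Function.update q.1 i q.2)
      ((Measure.pi fun _ : ι => F).prod F) (Measure.pi fun _ : ι => F) := by
  have hm : Measurable (fun q : (ι → E) × E => Function.update q.1 i q.2) := measurable_update'
  refine ⟨hm, ?_⟩
  refine (Measure.pi_eq fun s hs => ?_).symm
  rw [Measure.map_apply hm (MeasurableSet.univ_pi hs)]
  have : (fun q : (ι → E) × E => Function.update q.1 i q.2) ⁻¹' (Set.univ.pi s) =
      (Set.univ.pi (Function.update s i Set.univ)) ×ˢ (s i) := by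
    ext q
    simp only [Set.mem_preimage, Set.mem_pi, Set.mem_univ, true_implies, Set.mem_prod]
    constructor
    · intro h
      refine ⟨fun j => ?_, by simpa using h i⟩
      by_cases hj : j = i
      · subst hj; simp
      · simpa [Function.update_of_ne hj] using h j
    · rintro ⟨h1, h2⟩ j
      by_cases hj : j = i
      · subst hj; simpa using h2
      · simpa [Function.update_of_ne hj] using h1 j
  rw [this, Measure.prod_prod, Measure.pi_pi,
    ← Finset.mul_prod_erase Finset.univ _ (Finset.mem_univ i),
    ← Finset.mul_prod_erase Finset.univ (fun i => F (s i)) (Finset.mem_univ i)]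
  have : ∏ j ∈ Finset.univ.erase i, F (Function.update s i Set.univ j) =
      ∏ j ∈ Finset.univ.erase i, F (s j) :=
    Finset.prod_congr rfl fun j hj => by rw [Function.update_of_ne (Finset.ne_of_mem_erase hj)]
  rw [this]
  simp [mul_comm]

variable {F} in
lemma integrable_update {G : Type*} [NormedAddCommGroup G] {f : (ι → E) → G}
    (hf : Integrable f (Measure.pi fun _ : ι => F)) (i : ι) :
    Integrable (fun q : (ι → E) × E => f (Function.update q.1 i q.2))
      ((Measure.pi fun _ : ι => F).prod F) :=
  (measurePreserving_update F i).integrable_comp_of_integrable hf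

variable {F} in
/-- An expectation may be computed by resampling one coordinate first. -/
lemma integral_update {G : Type*} [NormedAddCommGroup G] [NormedSpace ℝ G] {f : (ι → E) → G}
    (hf : Integrable f (Measure.pi fun _ : ι => F)) (i : ι) :
    ∫ x, f x ∂(Measure.pi fun _ : ι => F) =
      ∫ x, ∫ z, f (Function.update x i z) ∂F ∂(Measure.pi fun _ : ι => F) := by
  have hmp := measurePreserving_update F i
  rw [← integral_prod _ (integrable_update hf i)]
  conv_lhs => rw [← hmp.map_eq]
  rw [integral_map hmp.measurable.aemeasurable]
  rw [hmp.map_eq]; exact hf.aestronglyMeasurable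

variable {F} in
/-- A product whose one factor does not depend on the coordinate `i`, while the other one is
centered in it, has mean zero. -/
lemma integral_mul_eq_zero_of_update {𝕜 : Type*} [RCLike 𝕜] {f g : (ι → E) → 𝕜} (i : ι)
    (hfg : Integrable (fun x => f x * g x) (Measure.pi fun _ : ι => F))
    (hf : ∀ x z, f (Function.update x i z) = f x)
    (hg : ∀ x, ∫ z, g (Function.update x i z) ∂F = 0) :
    ∫ x, f x * g x ∂(Measure.pi fun _ : ι => F) = 0 := by
  rw [integral_update hfg i]
  simp_rw [hf]
  simp_rw [integral_const_mul, hg]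
  simp

omit [DecidableEq ι] in
lemma measurePreserving_pair {i j : ι} (hij : i ≠ j) :
    MeasurePreserving (fun x : ι → E => (x i, x j)) (Measure.pi fun _ : ι => F) (F.prod F) := by
  refine ⟨by fun_prop, ?_⟩
  have h := (iIndepFun_pi (μ := fun _ : ι => F) (X := fun _ => id)
    (fun _ => aemeasurable_id)).indepFun hij
  have h2 := (indepFun_iff_map_prod_eq_prod_map_map (measurable_pi_apply i).aemeasurable
    (measurable_pi_apply j).aemeasurable).1 h
  refine h2.trans ?_
  congr 1
  · exact (measurePreserving_eval (fun _ : ι => F) i).map_eq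
  · exact (measurePreserving_eval (fun _ : ι => F) j).map_eq

end ProductMeasure

/-! ### Orthogonality and second moments of degenerate sums. -/

section SecondMoments

variable {ι E : Type*} [Fintype ι] [DecidableEq ι] [MeasurableSpace E]
  {F : Measure E} [IsProbabilityMeasure F]

omit [DecidableEq ι] in
lemma memLp_pair {k : E → E → ℝ} {r : ENNReal} (hk : MemLp (Function.uncurry k) r (F.prod F))
    {i j : ι} (hij : i ≠ j) :
    MemLp (fun x : ι → E => k (x i) (x j)) r (Measure.pi fun _ : ι => F) :=
  hk.comp_measurePreserving (measurePreserving_pair F hij)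

omit [DecidableEq ι] in
lemma integral_pair {k : E → E → ℝ}
    (hk : AEStronglyMeasurable (Function.uncurry k) (F.prod F)) {i j : ι} (hij : i ≠ j) :
    ∫ x : ι → E, k (x i) (x j) ∂(Measure.pi fun _ : ι => F) = ∫ z, k z.1 z.2 ∂(F.prod F) := by
  have h := measurePreserving_pair F hij
  rw [← h.map_eq, integral_map h.measurable.aemeasurable]
  rw [h.map_eq]; exact hk

omit [DecidableEq ι] in
lemma integral_eval {k : E → ℝ} (hk : AEStronglyMeasurable k F) (i : ι) :
    ∫ x : ι → E, k (x i) ∂(Measure.pi fun _ : ι => F) = ∫ z, k z ∂F := by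
  have h := measurePreserving_eval (fun _ : ι => F) i
  have h2 := h.map_eq
  conv_rhs => rw [← h2]
  rw [integral_map h.measurable.aemeasurable (by rw [h2]; exact hk)]

/-- Terms of a degenerate U-statistic at different pairs of indices are uncorrelated. -/
lemma integral_pair_mul_pair_eq_zero {k : E → E → ℝ} (hsymm : ∀ x y, k x y = k y x)
    (hk : MemLp (Function.uncurry k) 2 (F.prod F)) (hdeg : ∀ x, ∫ z, k x z ∂F = 0)
    {i j i' j' : ι} (hij : i ≠ j) (hij' : i' ≠ j') (h1 : ¬ (i' = i ∧ j' = j))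
    (h2 : ¬ (i' = j ∧ j' = i)) :
    ∫ x : ι → E, k (x i) (x j) * k (x i') (x j') ∂(Measure.pi fun _ : ι => F) = 0 := by
  -- Averaging over an index `a` absent from the second pair kills the product. Two distinct
  -- unordered pairs always leave such an index in the first one.
  have key : ∀ a b : ι, a ≠ b → a ≠ i' → a ≠ j' →
      ∫ x : ι → E, k (x a) (x b) * k (x i') (x j') ∂(Measure.pi fun _ : ι => F) = 0 := by
    intro a b hab hai haj
    have hint := (memLp_pair hk hij').integrable_mul (memLp_pair hk hab)
    rw [show (fun x : ι → E => k (x a) (x b) * k (x i') (x j')) =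
      fun x => k (x i') (x j') * k (x a) (x b) from funext fun x => mul_comm _ _]
    refine integral_mul_eq_zero_of_update (𝕜 := ℝ) a hint ?_ ?_
    · intro x z
      rw [Function.update_of_ne hai.symm, Function.update_of_ne haj.symm]
    · intro x
      simp_rw [Function.update_self, Function.update_of_ne hab.symm, hsymm _ (x b)]
      exact hdeg _
  by_cases hi : i ≠ i' ∧ i ≠ j'
  · exact key i j hij hi.1 hi.2
  · have : j ≠ i' ∧ j ≠ j' := by grind
    simp_rw [hsymm (_ : E) ((_ : ι → E) j)]
    have := key j i hij.symm this.1 this.2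
    exact this

/-- The second moment of a degenerate weighted U-statistic. -/
lemma integral_sq_sum_pair_le {k : E → E → ℝ} (hsymm : ∀ x y, k x y = k y x)
    (hk : MemLp (Function.uncurry k) 2 (F.prod F)) (hdeg : ∀ x, ∫ z, k x z ∂F = 0)
    (c : ι → ι → ℝ) (hc : ∀ i, c i i = 0) :
    ∫ x : ι → E, (∑ i, ∑ j, c i j * k (x i) (x j)) ^ 2 ∂(Measure.pi fun _ : ι => F) ≤
      2 * (∑ i, ∑ j, c i j ^ 2) * ∫ z, k z.1 z.2 ^ 2 ∂(F.prod F) := by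
  set τ := ∫ z, k z.1 z.2 ^ 2 ∂(F.prod F) with hτ
  have hτ0 : 0 ≤ τ := integral_nonneg fun _ => sq_nonneg _
  have hmem : ∀ q : ι × ι, MemLp (fun x : ι → E => c q.1 q.2 * k (x q.1) (x q.2)) 2
      (Measure.pi fun _ : ι => F) := by
    rintro ⟨i, j⟩
    by_cases hij : i = j
    · subst hij; simp [hc]
    · exact (memLp_pair hk hij).const_mul _
  -- Only `r = q` and `r = q.swap` contribute. As `c` need not be symmetric, the swapped product is
  -- bounded by the mean of the two squares; the two cases together give the factor 2.
  have hterm : ∀ q r : ι × ι, ∫ x : ι → E, (c q.1 q.2 * k (x q.1) (x q.2)) *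
      (c r.1 r.2 * k (x r.1) (x r.2)) ∂(Measure.pi fun _ : ι => F) ≤
      (if r = q then c q.1 q.2 ^ 2 * τ else 0) +
        (if r = q.swap then (c q.1 q.2 ^ 2 + c r.1 r.2 ^ 2) / 2 * τ else 0) := by
    rintro ⟨i, j⟩ ⟨i', j'⟩
    simp only [Prod.mk.injEq, Prod.swap_prod_mk]
    have e : ∀ x : ι → E, c i j * k (x i) (x j) * (c i' j' * k (x i') (x j')) =
        (c i j * c i' j') * (k (x i) (x j) * k (x i') (x j')) := fun x => by ring
    simp_rw [e, integral_const_mul]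
    have hpos1 : 0 ≤ (if i' = i ∧ j' = j then c i j ^ 2 * τ else 0) := by split_ifs <;> positivity
    have hpos2 : 0 ≤ (if i' = j ∧ j' = i then (c i j ^ 2 + c i' j' ^ 2) / 2 * τ else 0) := by
      split_ifs <;> positivity
    by_cases hij : i = j
    · subst hij; simp only [hc, zero_mul]; simpa [hc] using add_nonneg hpos1 hpos2
    by_cases hij' : i' = j'
    · subst hij'
      simp only [hc, mul_zero, zero_mul]
      simpa [hc] using add_nonneg hpos1 hpos2
    have hsq : ∫ x : ι → E, k (x i) (x j) * k (x i) (x j) ∂(Measure.pi fun _ : ι => F) = τ := by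
      simp_rw [← sq]
      have hk2 : AEStronglyMeasurable (Function.uncurry fun a b => k a b ^ 2) (F.prod F) :=
        hk.aestronglyMeasurable.pow 2
      exact integral_pair hk2 hij
    by_cases h1 : i' = i ∧ j' = j
    · obtain ⟨rfl, rfl⟩ := h1
      rw [hsq]
      simp only [and_self, if_true]
      rw [← sq]; linarith
    by_cases h2 : i' = j ∧ j' = i
    · obtain ⟨rfl, rfl⟩ := h2
      simp_rw [hsymm ((_ : ι → E) i') ((_ : ι → E) j')]
      rw [hsq]
      simp only [and_self, if_true]
      have : c j' i' * c i' j' ≤ (c j' i' ^ 2 + c i' j' ^ 2) / 2 := by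
        nlinarith [sq_nonneg (c j' i' - c i' j')]
      nlinarith [mul_le_mul_of_nonneg_right this hτ0]
    · rw [integral_pair_mul_pair_eq_zero hsymm hk hdeg hij hij' h1 h2]
      simp [h1, h2]
  simp_rw [← Fintype.sum_prod_type' (f := fun i j => c i j * k ((_ : ι → E) i) ((_ : ι → E) j)),
    ← Fintype.sum_prod_type' (f := fun i j => c i j ^ 2), sq (∑ _, _), Finset.sum_mul_sum]
  have hI : ∀ q r : ι × ι, Integrable (fun x : ι → E => c q.1 q.2 * k (x q.1) (x q.2) *
      (c r.1 r.2 * k (x r.1) (x r.2))) (Measure.pi fun _ : ι => F) :=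
    fun q r => (hmem q).integrable_mul (hmem r)
  rw [integral_finsetSum _ fun q _ => integrable_finsetSum _ fun r _ => hI q r]
  have hsw : ∑ q : ι × ι, c q.swap.1 q.swap.2 ^ 2 = ∑ q : ι × ι, c q.1 q.2 ^ 2 :=
    Fintype.sum_equiv (Equiv.prodComm ι ι) _ _ fun _ => rfl
  calc _ = ∑ q : ι × ι, ∑ r : ι × ι, ∫ x : ι → E, (c q.1 q.2 * k (x q.1) (x q.2)) *
      (c r.1 r.2 * k (x r.1) (x r.2)) ∂(Measure.pi fun _ : ι => F) :=
        Finset.sum_congr rfl fun q _ => integral_finsetSum _ fun r _ => hI q r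
    _ ≤ ∑ q : ι × ι, ∑ r : ι × ι, ((if r = q then c q.1 q.2 ^ 2 * τ else 0) +
        (if r = q.swap then (c q.1 q.2 ^ 2 + c r.1 r.2 ^ 2) / 2 * τ else 0)) :=
        Finset.sum_le_sum fun q _ => Finset.sum_le_sum fun r _ => hterm q r
    _ = ∑ q : ι × ι, (c q.1 q.2 ^ 2 * τ + (c q.1 q.2 ^ 2 + c q.swap.1 q.swap.2 ^ 2) / 2 * τ) := by
        refine Finset.sum_congr rfl fun q _ => ?_
        rw [Finset.sum_add_distrib, Finset.sum_ite_eq' Finset.univ q,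
          Finset.sum_ite_eq' Finset.univ q.swap]
        simp
    _ = _ := by
        rw [Finset.sum_add_distrib, ← Finset.sum_mul, ← Finset.sum_mul, ← Finset.sum_div,
          Finset.sum_add_distrib, hsw]
        ring

/-- The second moment of a weighted sum of centered i.i.d. terms. -/
lemma integral_sq_sum_eval_le {k : E → ℝ} (hk : MemLp k 2 F) (hdeg : ∫ z, k z ∂F = 0)
    (c : ι → ℝ) :
    ∫ x : ι → E, (∑ i, c i * k (x i)) ^ 2 ∂(Measure.pi fun _ : ι => F) =
      (∑ i, c i ^ 2) * ∫ z, k z ^ 2 ∂F := by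
  have hm : ∀ i : ι, MemLp (fun x : ι → E => c i * k (x i)) 2 (Measure.pi fun _ : ι => F) :=
    fun i => (hk.comp_measurePreserving (measurePreserving_eval (fun _ : ι => F) i)).const_mul _
  simp_rw [sq (∑ _, _), Finset.sum_mul_sum]
  have hI : ∀ i j : ι, Integrable (fun x : ι → E => c i * k (x i) * (c j * k (x j)))
      (Measure.pi fun _ : ι => F) := fun i j => (hm i).integrable_mul (hm j)
  rw [integral_finsetSum _ fun q _ => integrable_finsetSum _ fun r _ => hI q r, Finset.sum_mul]
  refine Finset.sum_congr rfl fun i _ => ?_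
  rw [integral_finsetSum _ fun r _ => hI i r, Finset.sum_eq_single i]
  · have e : ∀ x : ι → E, c i * k (x i) * (c i * k (x i)) = c i ^ 2 * k (x i) ^ 2 :=
      fun x => by ring
    simp_rw [e, integral_const_mul]
    rw [integral_eval (k := fun z => k z ^ 2) (hk.aestronglyMeasurable.pow 2)]
  · intro j _ hj
    refine integral_mul_eq_zero_of_update (𝕜 := ℝ) j (hI i j) ?_ ?_
    · intro x z; rw [Function.update_of_ne hj.symm]
    · intro x; simp_rw [Function.update_self, integral_const_mul, hdeg, mul_zero]
  · simp

end SecondMoments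

/-! ### Second and fourth moment inequalities. -/

section Moments

variable {Ω : Type*} [MeasurableSpace Ω] {μ : Measure Ω}

lemma memLp_four_iff {f : Ω → ℝ} (hf : AEStronglyMeasurable f μ) :
    MemLp f 4 μ ↔ Integrable (fun x => f x ^ 4) μ := by
  rw [← integrable_norm_rpow_iff hf (by norm_num) (by norm_num)]
  have : ∀ x : Ω, ‖f x‖ ^ (4 : ENNReal).toReal = f x ^ 4 := fun x => by
    rw [show (4 : ENNReal).toReal = ((4 : ℕ) : ℝ) by norm_num, Real.rpow_natCast,
      Real.norm_eq_abs, Even.pow_abs ⟨2, rfl⟩]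
  simp_rw [this]

lemma holderTriple_four_four_two : ENNReal.HolderTriple 4 4 2 := ⟨by
  rw [show (4 : ENNReal) = 2 * 2 by norm_num, ENNReal.mul_inv (by simp) (by simp), ← two_mul,
    ← mul_assoc, ENNReal.mul_inv_cancel (by simp) (by simp), one_mul]⟩

lemma memLp_two_mul {f g : Ω → ℝ} (hf : MemLp f 4 μ) (hg : MemLp g 4 μ) :
    MemLp (fun x => f x * g x) 2 μ :=
  hg.mul' hf (hpqr := holderTriple_four_four_two)

lemma integrable_pow_four {f : Ω → ℝ} (hf : MemLp f 4 μ) : Integrable (fun x => f x ^ 4) μ :=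
  (memLp_four_iff hf.aestronglyMeasurable).1 hf

lemma integrable_mul_four {f g h k : Ω → ℝ} (hf : MemLp f 4 μ) (hg : MemLp g 4 μ)
    (hh : MemLp h 4 μ) (hk : MemLp k 4 μ) : Integrable (fun x => f x * g x * (h x * k x)) μ :=
  (memLp_two_mul hf hg).integrable_mul (memLp_two_mul hh hk)

variable [IsProbabilityMeasure μ]

lemma memLp_two_of_four {f : Ω → ℝ} (hf : MemLp f 4 μ) : MemLp f 2 μ :=
  hf.mono_exponent (by norm_num)

lemma sq_integral_le_integral_sq {f : Ω → ℝ} (hf : MemLp f 2 μ) :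
    (∫ x, f x ∂μ) ^ 2 ≤ ∫ x, f x ^ 2 ∂μ := by
  have h := variance_nonneg f μ
  rw [variance_eq_sub hf] at h
  simpa using h

/-- Arithmetic-geometric mean in place of Cauchy–Schwarz: no square roots appear, and the free ε is
chosen only when the limit is taken. -/
lemma integral_abs_le_of_sq {f : Ω → ℝ} (hf : MemLp f 2 μ) {ε : ℝ} (hε : 0 < ε) :
    ∫ x, |f x| ∂μ ≤ (ε + ε⁻¹ * ∫ x, f x ^ 2 ∂μ) / 2 := by
  calc ∫ x, |f x| ∂μ ≤ ∫ x, (ε + ε⁻¹ * f x ^ 2) / 2 ∂μ := by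
        refine integral_mono (hf.integrable one_le_two).abs
          (((integrable_const _).add (hf.integrable_sq.const_mul _)).div_const _) fun x => ?_
        have : 0 ≤ ε⁻¹ * (ε - |f x|) ^ 2 := by positivity
        have e : ε⁻¹ * (ε - |f x|) ^ 2 = ε + ε⁻¹ * f x ^ 2 - 2 * |f x| := by
          rw [← sq_abs (f x)]; field_simp; ring
        simp only; linarith
    _ = _ := by
        rw [integral_div, integral_add (integrable_const _) (hf.integrable_sq.const_mul _),
          integral_const_mul]
        simp

end Moments

/-! ### Degenerate kernels and their Gram kernels. -/

section Kernel

variable {E : Type*} [MeasurableSpace E] {F : Measure E} [IsProbabilityMeasure F]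

/-- A symmetric kernel which is centered in each argument and has fourth moments. -/
structure IsDegenerateKernel (F : Measure E) (h : E → E → ℝ) : Prop where
  measurable : Measurable (Function.uncurry h)
  symm : ∀ x y, h x y = h y x
  -- A product bound valid everywhere is stronger than an L⁴ bound on the product space: it puts
  -- every section `h x` in L⁴, and it controls the diagonal of the Gram kernel.
  exists_bound : ∃ A : E → ℝ, MemLp A 4 F ∧ ∀ x y, |h x y| ≤ A x * A y
  integral_eq_zero : ∀ x, ∫ z, h x z ∂F = 0

/-- The kernel of the squared integral operator of `h`. -/
noncomputable def gram (F : Measure E) (h : E → E → ℝ) (x y : E) : ℝ := ∫ z, h x z * h y z ∂F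

omit [IsProbabilityMeasure F] in
lemma memLp_four_prod {A : E → ℝ} (hA : MemLp A 4 F) :
    MemLp (fun q : E × E => A q.1 * A q.2) 4 (F.prod F) := by
  have hm : AEStronglyMeasurable (fun q : E × E => A q.1 * A q.2) (F.prod F) :=
    hA.aestronglyMeasurable.comp_fst.mul hA.aestronglyMeasurable.comp_snd
  rw [memLp_four_iff hm]
  simp_rw [mul_pow]
  exact (integrable_pow_four hA).mul_prod (integrable_pow_four hA)

namespace IsDegenerateKernel

variable {h : E → E → ℝ} (hh : IsDegenerateKernel F h)
include hh

omit [IsProbabilityMeasure F] in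
lemma measurable_right (x : E) : Measurable (h x) := hh.measurable.comp measurable_prodMk_left

omit [IsProbabilityMeasure F] in
lemma memLp : MemLp (Function.uncurry h) 4 (F.prod F) := by
  obtain ⟨A, hA, hb⟩ := hh.exists_bound
  exact (memLp_four_prod hA).mono' hh.measurable.aestronglyMeasurable
    (ae_of_all _ fun q => hb q.1 q.2)

omit [IsProbabilityMeasure F] in
lemma memLp_right (x : E) : MemLp (h x) 4 F := by
  obtain ⟨A, hA, hb⟩ := hh.exists_bound
  exact (hA.const_mul (A x)).mono' (hh.measurable_right x).aestronglyMeasurable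
    (ae_of_all _ fun y => hb x y)

lemma integrable_mul_right (x y : E) : Integrable (fun z => h x z * h y z) F :=
  (memLp_two_of_four (hh.memLp_right x)).integrable_mul (memLp_two_of_four (hh.memLp_right y))

lemma measurable_gram : Measurable (Function.uncurry (gram F h)) := by
  have hm : Measurable fun q : (E × E) × E => h q.1.1 q.2 * h q.1.2 q.2 :=
    (hh.measurable.comp (measurable_fst.fst.prodMk measurable_snd)).mul
      (hh.measurable.comp (measurable_fst.snd.prodMk measurable_snd))
  exact hm.stronglyMeasurable.integral_prod_right'.measurable

omit hh [IsProbabilityMeasure F] in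
lemma gram_symm (x y : E) : gram F h x y = gram F h y x := by
  simp only [gram, mul_comm]

/-- The product bound passes to the Gram kernel, since integrating `A x * A z * (A y * A z)` over z
leaves a multiple of `A x * A y`. -/
lemma exists_gram_bound : ∃ A : E → ℝ, MemLp A 4 F ∧ ∀ x y, |gram F h x y| ≤ A x * A y := by
  obtain ⟨A, hA, hb⟩ := hh.exists_bound
  have hA2 := memLp_two_of_four hA
  refine ⟨fun x => √(∫ z, A z ^ 2 ∂F) * A x, hA.const_mul _, fun x y => ?_⟩
  calc |gram F h x y| ≤ ∫ z, |h x z * h y z| ∂F := abs_integral_le_integral_abs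
    _ ≤ ∫ z, A x * A y * A z ^ 2 ∂F := by
        refine integral_mono (hh.integrable_mul_right x y).abs (hA2.integrable_sq.const_mul _)
          fun z => ?_
        rw [abs_mul]
        calc |h x z| * |h y z| ≤ (A x * A z) * (A y * A z) :=
              mul_le_mul (hb x z) (hb y z) (abs_nonneg _) ((abs_nonneg _).trans (hb x z))
          _ = _ := by ring
    _ = (√(∫ z, A z ^ 2 ∂F)) ^ 2 * (A x * A y) := by
        rw [integral_const_mul, Real.sq_sqrt (integral_nonneg fun _ => sq_nonneg _), mul_comm]
    _ = _ := by ring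

lemma memLp_gram : MemLp (Function.uncurry (gram F h)) 2 (F.prod F) := by
  obtain ⟨A, hA, hb⟩ := hh.exists_gram_bound
  exact memLp_two_of_four ((memLp_four_prod hA).mono' hh.measurable_gram.aestronglyMeasurable
    (ae_of_all _ fun q => hb q.1 q.2))

lemma memLp_gram_diag : MemLp (fun x => gram F h x x) 2 F := by
  obtain ⟨A, hA, hb⟩ := hh.exists_gram_bound
  exact (memLp_two_mul hA hA).mono' (hh.measurable_gram.comp
    (measurable_id.prodMk measurable_id)).aestronglyMeasurable (ae_of_all _ fun q => hb q q)

/-- By Fubini the Gram kernel inherits degeneracy, so its off-diagonal sums obey the same second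
moment bound as those of `h`. -/
lemma integral_gram_eq_zero (x : E) : ∫ y, gram F h x y ∂F = 0 := by
  have hint : Integrable (Function.uncurry fun y z => h x z * h y z) (F.prod F) :=
    ((memLp_two_of_four (hh.memLp_right x)).comp_snd F).integrable_mul (memLp_two_of_four hh.memLp)
  unfold gram
  rw [integral_integral_swap hint]
  have e : ∀ z, ∫ y, h x z * h y z ∂F = 0 := fun z => by
    simp_rw [hh.symm _ z]
    rw [integral_const_mul, hh.integral_eq_zero, mul_zero]
  simp [e]

lemma integral_gram_diag : ∫ x, gram F h x x ∂F = ∫ q, h q.1 q.2 ^ 2 ∂(F.prod F) := by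
  rw [integral_prod (fun q => h q.1 q.2 ^ 2) (memLp_two_of_four hh.memLp).integrable_sq]
  simp_rw [gram, sq]

/-- Jensen's inequality in the inner variable, as `gram F h x x` is the mean of `h x z ^ 2` over z.
-/
lemma integral_gram_diag_sq_le :
    ∫ x, gram F h x x ^ 2 ∂F ≤ ∫ q, h q.1 q.2 ^ 4 ∂(F.prod F) := by
  have hi := integrable_pow_four hh.memLp
  rw [integral_prod (fun q => h q.1 q.2 ^ 4) hi]
  refine integral_mono hh.memLp_gram_diag.integrable_sq hi.integral_prod_left fun x => ?_
  have hm := memLp_two_mul (hh.memLp_right x) (hh.memLp_right x)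
  refine (sq_integral_le_integral_sq hm).trans (le_of_eq ?_)
  refine integral_congr_ae (ae_of_all _ fun z => ?_)
  simp only; ring

end IsDegenerateKernel

end Kernel

/-! ### The one-coordinate Stein estimate. -/

section LocalStein

lemma norm_exp_I_mul_sub_one_sub_le (u : ℝ) :
    ‖Complex.exp (Complex.I * u) - 1 - Complex.I * u‖ ≤ 2 * u ^ 2 := by
  have hn : ‖Complex.I * (u : ℂ)‖ = |u| := by simp
  rcases le_total |u| 1 with h | h
  · refine (Complex.norm_exp_sub_one_sub_id_le (by rw [hn]; exact h)).trans ?_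
    rw [hn, sq_abs]; nlinarith [sq_nonneg u]
  · have h1 : ‖Complex.exp (Complex.I * u) - 1‖ ≤ |u| := Real.norm_exp_I_mul_ofReal_sub_one_le
    calc _ ≤ ‖Complex.exp (Complex.I * u) - 1‖ + ‖Complex.I * (u : ℂ)‖ := norm_sub_le _ _
      _ ≤ 2 * |u| := by rw [hn]; linarith
      _ ≤ 2 * u ^ 2 := by rw [← sq_abs]; nlinarith

lemma norm_exp_I_mul_ofReal (u : ℝ) : ‖Complex.exp (Complex.I * u)‖ = 1 := by
  rw [mul_comm]; exact Complex.norm_exp_ofReal_mul_I u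

variable {Ω : Type*} [MeasurableSpace Ω] {μ : Measure Ω} [IsProbabilityMeasure μ]

omit [IsProbabilityMeasure μ] in
lemma aestronglyMeasurable_exp_I_mul {R : Ω → ℝ} (hR : AEStronglyMeasurable R μ) :
    AEStronglyMeasurable (fun x => Complex.exp (Complex.I * (R x : ℝ))) μ :=
  (Continuous.comp_aestronglyMeasurable (g := fun u : ℝ => Complex.exp (Complex.I * (u : ℂ)))
    (by fun_prop) hR)

omit [IsProbabilityMeasure μ] in
lemma integrable_exp_mul {R f : Ω → ℝ} (hR : AEStronglyMeasurable R μ) (hf : Integrable f μ) :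
    Integrable (fun x => Complex.exp (Complex.I * (R x : ℝ)) * (f x : ℂ)) μ :=
  hf.ofReal.bdd_mul (c := 1) (aestronglyMeasurable_exp_I_mul hR)
    (ae_of_all _ fun _ => (norm_exp_I_mul_ofReal _).le)

/-- Comparison of `E L e^{it(R + L)}` with `i t E Γ e^{it(R + L)}`, when `L` is centered given `R`
and `Γ` plays the role of the conditional second moment of `L` given `R`. -/
lemma norm_integral_exp_mul_sub_le {L Γ R : Ω → ℝ} (t : ℝ) (hL : MemLp L 4 μ) (hΓ : MemLp Γ 2 μ)
    (hR : AEStronglyMeasurable R μ) (hΓ0 : ∀ x, 0 ≤ Γ x)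
    (h1 : ∫ x, Complex.exp (Complex.I * (t * R x : ℝ)) * (L x : ℂ) ∂μ = 0)
    (h2 : ∫ x, Complex.exp (Complex.I * (t * R x : ℝ)) * ((L x ^ 2 : ℝ) : ℂ) ∂μ =
      ∫ x, Complex.exp (Complex.I * (t * R x : ℝ)) * (Γ x : ℂ) ∂μ)
    (h3 : ∫ x, Γ x ∂μ = ∫ x, L x ^ 2 ∂μ) (h4 : ∫ x, Γ x ^ 2 ∂μ ≤ ∫ x, L x ^ 4 ∂μ)
    {ε : ℝ} (hε : 0 < ε) :
    ‖(∫ x, Complex.exp (Complex.I * (t * (R x + L x) : ℝ)) * (L x : ℂ) ∂μ) -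
      Complex.I * t * ∫ x, Complex.exp (Complex.I * (t * (R x + L x) : ℝ)) * (Γ x : ℂ) ∂μ‖ ≤
      3 / 2 * t ^ 2 * (ε * (∫ x, L x ^ 2 ∂μ) + ε⁻¹ * ∫ x, L x ^ 4 ∂μ) := by
  have hL2 := memLp_two_of_four hL
  have iL := hL2.integrable one_le_two
  have iL2 := hL2.integrable_sq
  have iL4 := integrable_pow_four hL
  have iΓ := hΓ.integrable one_le_two
  have iΓ2 := hΓ.integrable_sq
  have hR1 : AEStronglyMeasurable (fun x => t * R x) μ := hR.const_mul t
  have hR2 : AEStronglyMeasurable (fun x => t * (R x + L x)) μ :=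
    (hR.add hL.aestronglyMeasurable).const_mul t
  have j1 := integrable_exp_mul hR1 iL
  have j2 := integrable_exp_mul hR1 iL2
  have j3 := integrable_exp_mul hR1 iΓ
  have j4 := integrable_exp_mul hR2 iL
  have j5 := integrable_exp_mul hR2 iΓ
  -- The subtracted terms integrate to zero by `h1` and `h2`. They are the first order expansion at
  -- `R`, so only the Taylor remainder in `L` is left.
  have e1 : (∫ x, Complex.exp (Complex.I * (t * (R x + L x) : ℝ)) * (L x : ℂ) ∂μ) -
      Complex.I * t * ∫ x, Complex.exp (Complex.I * (t * (R x + L x) : ℝ)) * (Γ x : ℂ) ∂μ =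
      ∫ x, (Complex.exp (Complex.I * (t * (R x + L x) : ℝ)) * (L x : ℂ) -
        Complex.I * t * (Complex.exp (Complex.I * (t * (R x + L x) : ℝ)) * (Γ x : ℂ)) -
        (Complex.exp (Complex.I * (t * R x : ℝ)) * (L x : ℂ) +
        Complex.I * t * (Complex.exp (Complex.I * (t * R x : ℝ)) * ((L x ^ 2 : ℝ) : ℂ) -
        Complex.exp (Complex.I * (t * R x : ℝ)) * (Γ x : ℂ)))) ∂μ := by
    have j6 : Integrable (fun x => Complex.I * t *
        (Complex.exp (Complex.I * (t * R x : ℝ)) * ((L x ^ 2 : ℝ) : ℂ) -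
          Complex.exp (Complex.I * (t * R x : ℝ)) * (Γ x : ℂ))) μ := (j2.sub j3).const_mul _
    have j7 := j5.const_mul (Complex.I * t)
    have j8 : Integrable (fun x => Complex.exp (Complex.I * (t * (R x + L x) : ℝ)) * (L x : ℂ) -
        Complex.I * t * (Complex.exp (Complex.I * (t * (R x + L x) : ℝ)) * (Γ x : ℂ))) μ :=
      j4.sub j7
    rw [integral_sub j8 (j1.fun_add j6), integral_sub j4 j7, integral_add j1 j6,
      integral_const_mul, integral_const_mul, integral_sub j2 j3, h1, h2]
    ring
  have iB : Integrable (fun x => t ^ 2 * ((ε * L x ^ 2 + ε⁻¹ * L x ^ 4) + (ε / 2 * Γ x +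
      ε⁻¹ / 4 * (Γ x ^ 2 + L x ^ 4)))) μ :=
    (((iL2.const_mul _).add (iL4.const_mul _)).add ((iΓ.const_mul _).add
      ((iΓ2.add iL4).const_mul _))).const_mul _
  rw [e1]
  refine (norm_integral_le_of_norm_le iB (ae_of_all _ fun x => ?_)).trans ?_
  · have e2 : Complex.exp (Complex.I * (t * (R x + L x) : ℝ)) =
        Complex.exp (Complex.I * (t * R x : ℝ)) * Complex.exp (Complex.I * (t * L x : ℝ)) := by
      rw [← Complex.exp_add]; push_cast; ring_nf
    have e3 : Complex.exp (Complex.I * (t * (R x + L x) : ℝ)) * (L x : ℂ) -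
        Complex.I * t * (Complex.exp (Complex.I * (t * (R x + L x) : ℝ)) * (Γ x : ℂ)) -
        (Complex.exp (Complex.I * (t * R x : ℝ)) * (L x : ℂ) +
        Complex.I * t * (Complex.exp (Complex.I * (t * R x : ℝ)) * ((L x ^ 2 : ℝ) : ℂ) -
        Complex.exp (Complex.I * (t * R x : ℝ)) * (Γ x : ℂ))) =
        Complex.exp (Complex.I * (t * R x : ℝ)) * (L x *
          (Complex.exp (Complex.I * (t * L x : ℝ)) - 1 - Complex.I * (t * L x : ℝ)) -
          Complex.I * t * Γ x * (Complex.exp (Complex.I * (t * L x : ℝ)) - 1)) := by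
      rw [e2]; push_cast; ring
    rw [e3, norm_mul, norm_exp_I_mul_ofReal, one_mul]
    have b1 := norm_exp_I_mul_sub_one_sub_le (t * L x)
    have b2 : ‖Complex.exp (Complex.I * (t * L x : ℝ)) - 1‖ ≤ |t * L x| :=
      Real.norm_exp_I_mul_ofReal_sub_one_le
    have hεi : 0 < ε⁻¹ := inv_pos.2 hε
    have hee : ε * ε⁻¹ = 1 := mul_inv_cancel₀ hε.ne'
    calc _ ≤ |L x| * (2 * (t * L x) ^ 2) + |t| * Γ x * |t * L x| := by
          refine (norm_sub_le _ _).trans (add_le_add ?_ ?_)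
          · rw [norm_mul, Complex.norm_real, Real.norm_eq_abs]
            exact mul_le_mul_of_nonneg_left b1 (abs_nonneg _)
          · rw [norm_mul, norm_mul, norm_mul, Complex.norm_real, Complex.norm_real,
              Complex.norm_I, one_mul, Real.norm_eq_abs, Real.norm_eq_abs, abs_of_nonneg (hΓ0 x)]
            exact mul_le_mul_of_nonneg_left b2 (mul_nonneg (abs_nonneg _) (hΓ0 x))
      _ = t ^ 2 * (2 * |L x| ^ 3 + Γ x * |L x|) := by
          rw [abs_mul, mul_pow, ← sq_abs (L x), ← sq_abs t]; ring
      _ ≤ _ := by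
          refine mul_le_mul_of_nonneg_left ?_ (sq_nonneg t)
          -- The cubic terms |L|³ and Γ|L| are traded for second and fourth order ones by completing
          -- squares, which is where ε and ε⁻¹ enter.
          have f1 : ε * L x ^ 2 + ε⁻¹ * L x ^ 4 - 2 * |L x| ^ 3 =
              ε⁻¹ * (L x ^ 2 * (ε - |L x|) ^ 2) := by
            have h4' : L x ^ 4 = |L x| ^ 4 := (Even.pow_abs ⟨2, rfl⟩ _).symm
            rw [h4', ← sq_abs (L x)]; field_simp; ring
          have f2 : ε / 2 * Γ x + ε⁻¹ / 4 * (Γ x ^ 2 + L x ^ 4) - Γ x * |L x| =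
              ε⁻¹ / 2 * (Γ x * (ε - |L x|) ^ 2) + ε⁻¹ / 4 * (Γ x - L x ^ 2) ^ 2 := by
            rw [← sq_abs (L x), ← Even.pow_abs (n := 4) ⟨2, rfl⟩ (L x)]; field_simp; ring
          have g1 : 0 ≤ ε⁻¹ * (L x ^ 2 * (ε - |L x|) ^ 2) := by positivity
          have g2 : 0 ≤ ε⁻¹ / 2 * (Γ x * (ε - |L x|) ^ 2) + ε⁻¹ / 4 * (Γ x - L x ^ 2) ^ 2 := by
            have := hΓ0 x; positivity
          linarith
  · have i1 := iL2.const_mul ε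
    have i2 := iL4.const_mul ε⁻¹
    have i3 := iΓ.const_mul (ε / 2)
    have i4 := (iΓ2.fun_add iL4).const_mul (ε⁻¹ / 4)
    rw [integral_const_mul, integral_add (i1.fun_add i2) (i3.fun_add i4), integral_add i1 i2,
      integral_add i3 i4]
    simp only [integral_const_mul]
    rw [integral_add iΓ2 iL4, h3]
    have hεi : 0 < ε⁻¹ := inv_pos.2 hε
    rw [show 3 / 2 * t ^ 2 * (ε * (∫ x, L x ^ 2 ∂μ) + ε⁻¹ * ∫ x, L x ^ 4 ∂μ) =
      t ^ 2 * (3 / 2 * (ε * (∫ x, L x ^ 2 ∂μ) + ε⁻¹ * ∫ x, L x ^ 4 ∂μ)) by ring]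
    refine mul_le_mul_of_nonneg_left ?_ (sq_nonneg t)
    nlinarith

end LocalStein

/-! ### From an approximate differential equation to a Gaussian characteristic function. -/

section CharFun

variable {Ω : Type*} [MeasurableSpace Ω] {μ : Measure Ω} [IsProbabilityMeasure μ]

lemma hasDerivAt_integral_exp {S : Ω → ℝ} (hS : Integrable S μ) (t : ℝ) :
    HasDerivAt (fun t : ℝ => ∫ x, Complex.exp (Complex.I * (t * S x : ℝ)) ∂μ)
      (Complex.I * ∫ x, Complex.exp (Complex.I * (t * S x : ℝ)) * (S x : ℂ) ∂μ) t := by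
  have hm : ∀ t : ℝ, AEStronglyMeasurable (fun x => t * S x) μ := fun t =>
    hS.aestronglyMeasurable.const_mul t
  have h := (hasDerivAt_integral_of_dominated_loc_of_deriv_le (μ := μ) (x₀ := t)
    (s := Set.univ) (bound := fun x => |S x|)
    (F := fun (t : ℝ) x => Complex.exp (Complex.I * (t * S x : ℝ)))
    (F' := fun (t : ℝ) x => Complex.I * (Complex.exp (Complex.I * (t * S x : ℝ)) * (S x : ℂ)))
    Filter.univ_mem (Eventually.of_forall fun t => aestronglyMeasurable_exp_I_mul (hm t))
    (by simpa using integrable_exp_mul (hm t) (integrable_const (1 : ℝ)))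
    ((integrable_exp_mul (hm t) hS).const_mul _).aestronglyMeasurable
    (ae_of_all _ fun x t _ => by
      rw [norm_mul, norm_mul, norm_exp_I_mul_ofReal]; simp)
    hS.abs (ae_of_all _ fun x t _ => ?_)).2
  · rwa [integral_const_mul] at h
  · have h1 : HasDerivAt (fun t : ℝ => Complex.I * ((t * S x : ℝ) : ℂ)) (Complex.I * (S x : ℂ)) t := by
      have := ((hasDerivAt_id t).mul_const (S x)).ofReal_comp.const_mul Complex.I
      simpa using this
    convert! h1.cexp using 1
    ring

/-- An approximate Gaussian differential equation for a characteristic function. -/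
lemma norm_integral_exp_sub_gaussian_le {S : Ω → ℝ} (hS : Integrable S μ) {C : ℝ} (t : ℝ)
    (hC : ∀ s : ℝ, |s| ≤ |t| →
      ‖(∫ x, Complex.exp (Complex.I * (s * S x : ℝ)) * (S x : ℂ) ∂μ) -
        Complex.I * s * ∫ x, Complex.exp (Complex.I * (s * S x : ℝ)) ∂μ‖ ≤ C) :
    ‖(∫ x, Complex.exp (Complex.I * (t * S x : ℝ)) ∂μ) - Complex.exp (-(t ^ 2 : ℝ) / 2)‖ ≤
      |t| * C := by
  set φ : ℝ → ℂ := fun t => ∫ x, Complex.exp (Complex.I * (t * S x : ℝ)) ∂μ with hφ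
  set D : ℝ → ℂ := fun s => (∫ x, Complex.exp (Complex.I * (s * S x : ℝ)) * (S x : ℂ) ∂μ) -
        Complex.I * s * φ s with hD
  -- Integrating factor exp(s²/2): the product is constant for an exact Gaussian, and in general its
  -- derivative is the defect `D` times that factor. The mean value inequality on the segment from 0
  -- to t then suffices.
  have hd : ∀ s : ℝ, HasDerivAt (fun s : ℝ => φ s * Complex.exp ((s ^ 2 : ℝ) / 2))
      (Complex.I * D s * Complex.exp ((s ^ 2 : ℝ) / 2)) s := by
    intro s
    have h1 := hasDerivAt_integral_exp hS s
    have h2 : HasDerivAt (fun s : ℝ => (((s ^ 2 : ℝ) : ℂ) / 2)) (s : ℂ) s := by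
      have := ((hasDerivAt_pow 2 s).ofReal_comp).div_const 2
      simpa using this
    convert! h1.mul h2.cexp using 1
    have hI : Complex.I * Complex.I = -1 := Complex.I_mul_I
    simp only [hD]
    linear_combination (-(s : ℂ) * φ s * Complex.exp ((s ^ 2 : ℝ) / 2)) * hI
  have hC0 : 0 ≤ C := (norm_nonneg _).trans (hC t le_rfl)
  have hmv := (convex_uIcc (0 : ℝ) t).norm_image_sub_le_of_norm_hasDerivWithin_le
    (f := fun s : ℝ => φ s * Complex.exp ((s ^ 2 : ℝ) / 2)) (C := C * Real.exp (t ^ 2 / 2))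
    (fun s _ => (hd s).hasDerivWithinAt) (fun s hs => ?_) Set.left_mem_uIcc Set.right_mem_uIcc
  · have h0 : φ 0 = 1 := by simp [hφ]
    rw [h0] at hmv
    have e : φ t - Complex.exp (-(t ^ 2 : ℝ) / 2) =
        (φ t * Complex.exp ((t ^ 2 : ℝ) / 2) - 1 * Complex.exp (((0 : ℝ) ^ 2 : ℝ) / 2)) *
          ((Real.exp (-t ^ 2 / 2) : ℝ) : ℂ) := by
      have : Complex.exp ((t ^ 2 : ℝ) / 2) * ((Real.exp (-t ^ 2 / 2) : ℝ) : ℂ) = 1 := by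
        rw [Complex.ofReal_exp, ← Complex.exp_add, ← Complex.exp_zero]; push_cast; ring_nf
      rw [sub_mul, mul_assoc, this]
      push_cast
      simp
    have hval : φ t = ∫ x, Complex.exp (Complex.I * (t * S x : ℝ)) ∂μ := rfl
    rw [← hval, e, norm_mul, Complex.norm_real, Real.norm_of_nonneg (Real.exp_pos _).le]
    calc _ ≤ (C * Real.exp (t ^ 2 / 2) * ‖t - 0‖) * Real.exp (-t ^ 2 / 2) :=
          mul_le_mul_of_nonneg_right hmv (Real.exp_pos _).le
      _ = |t| * C * (Real.exp (t ^ 2 / 2) * Real.exp (-t ^ 2 / 2)) := by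
          rw [sub_zero, Real.norm_eq_abs]; ring
      _ = |t| * C := by rw [← Real.exp_add]; ring_nf; simp
  · have hst : |s| ≤ |t| := by
      have := Set.abs_sub_left_of_mem_uIcc hs
      simpa using this
    rw [norm_mul, norm_mul, Complex.norm_I, one_mul]
    have e : Complex.exp ((s ^ 2 : ℝ) / 2) = ((Real.exp (s ^ 2 / 2) : ℝ) : ℂ) := by push_cast; rfl
    rw [e, Complex.norm_real, Real.norm_of_nonneg (Real.exp_pos _).le]
    refine mul_le_mul (hC s hst) (Real.exp_le_exp.2 ?_) (Real.exp_pos _).le hC0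
    have := sq_le_sq.2 hst
    linarith

end CharFun

/-! ### Weighted quadratic forms and their one-coordinate parts. -/

section QuadraticForm

variable {ι E : Type*} [Fintype ι] [DecidableEq ι] [MeasurableSpace E]
  {F : Measure E} [IsProbabilityMeasure F] {h : E → E → ℝ} {a : ι → ι → ℝ}

/-- The part of the quadratic form with coefficients `a` and kernel `h` that involves the
coordinate `i`. -/
def linearPart (a : ι → ι → ℝ) (h : E → E → ℝ) (i : ι) (x : ι → E) : ℝ :=
  ∑ j, a i j * h (x i) (x j)

/-- The degenerate U-statistic with weights `a` and kernel `h`. -/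
noncomputable def quadForm (a : ι → ι → ℝ) (h : E → E → ℝ) (x : ι → E) : ℝ :=
  (∑ i, linearPart a h i x) / 2

/-- The conditional second moment of `linearPart a h i` given the other coordinates. -/
noncomputable def gramPart (F : Measure E) (a : ι → ι → ℝ) (h : E → E → ℝ) (i : ι)
    (x : ι → E) : ℝ :=
  ∑ j, ∑ l, a i j * a i l * gram F h (x j) (x l)

/-- The vanishing diagonal weights matter: the product bound gives `h x x` only the integrability of
`A x ^ 2`, which need not be L⁴. -/
lemma memLp_term (hh : IsDegenerateKernel F h) (ha : ∀ i, a i i = 0) (i j : ι) :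
    MemLp (fun x : ι → E => a i j * h (x i) (x j)) 4 (Measure.pi fun _ : ι => F) := by
  by_cases hij : i = j
  · subst hij; simp [ha]
  · exact (memLp_pair hh.memLp hij).const_mul _

lemma memLp_linearPart (hh : IsDegenerateKernel F h) (ha : ∀ i, a i i = 0) (i : ι) :
    MemLp (linearPart a h i) 4 (Measure.pi fun _ : ι => F) :=
  memLp_finsetSum _ fun j _ => memLp_term hh ha i j

lemma memLp_quadForm (hh : IsDegenerateKernel F h) (ha : ∀ i, a i i = 0) :
    MemLp (quadForm a h) 4 (Measure.pi fun _ : ι => F) := by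
  have : quadForm a h = fun x : ι → E => 2⁻¹ * ∑ i, linearPart a h i x := by
    ext x; rw [quadForm]; ring
  rw [this]
  exact (memLp_finsetSum _ fun i _ => memLp_linearPart hh ha i).const_mul _

lemma integral_linearPart_sq_le (hh : IsDegenerateKernel F h) (ha : ∀ i, a i i = 0) (i : ι) :
    ∫ x : ι → E, linearPart a h i x ^ 2 ∂(Measure.pi fun _ : ι => F) ≤
      2 * (∑ j, a i j ^ 2) * ∫ z, h z.1 z.2 ^ 2 ∂(F.prod F) := by
  -- The weights of row i alone form a nonsymmetric matrix, to which the general bound still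
  -- applies.
  have := integral_sq_sum_pair_le hh.symm (memLp_two_of_four hh.memLp) hh.integral_eq_zero
    (fun r j => if r = i then a i j else 0) (fun r => by split_ifs with hr <;> simp [hr, ha])
  simpa [ite_mul, ite_pow, linearPart] using this

lemma integral_quadForm_sq_le (hh : IsDegenerateKernel F h) (ha : ∀ i, a i i = 0) :
    ∫ x : ι → E, quadForm a h x ^ 2 ∂(Measure.pi fun _ : ι => F) ≤
      (∑ i, ∑ j, a i j ^ 2) / 2 * ∫ z, h z.1 z.2 ^ 2 ∂(F.prod F) := by
  have := integral_sq_sum_pair_le hh.symm (memLp_two_of_four hh.memLp) hh.integral_eq_zero a ha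
  have e : ∀ x : ι → E, quadForm a h x ^ 2 = (∑ i, ∑ j, a i j * h (x i) (x j)) ^ 2 / 4 := by
    intro x; simp only [quadForm, linearPart]; ring
  simp_rw [e]
  rw [integral_div]
  linarith

lemma integral_term_pow_four_le (hh : IsDegenerateKernel F h) (ha : ∀ i, a i i = 0) {B : ℝ}
    (hB : ∀ i j, |a i j| ≤ B) (i j : ι) :
    ∫ x : ι → E, (a i j * h (x i) (x j)) ^ 4 ∂(Measure.pi fun _ : ι => F) ≤
      B ^ 4 * ∫ z, h z.1 z.2 ^ 4 ∂(F.prod F) := by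
  have hpos : 0 ≤ ∫ z, h z.1 z.2 ^ 4 ∂(F.prod F) := integral_nonneg fun _ => by positivity
  by_cases hij : i = j
  · subst hij; simp only [ha]; simp; positivity
  · have hm : AEStronglyMeasurable (Function.uncurry fun a b => h a b ^ 4) (F.prod F) :=
      (hh.measurable.pow_const 4).aestronglyMeasurable
    simp_rw [mul_pow]
    rw [integral_const_mul, integral_pair hm hij, ← Even.pow_abs ⟨2, rfl⟩]
    exact mul_le_mul_of_nonneg_right (pow_le_pow_left₀ (abs_nonneg _) (hB i j) 4) hpos

/-- A Rosenthal-type bound, quadratic rather than quartic in the number of terms. Given x_i the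
summands are independent and centered, so in the induction the cross term A³Z has mean zero. -/
lemma integral_sum_term_pow_four_le (hh : IsDegenerateKernel F h) (ha : ∀ i, a i i = 0) {B : ℝ}
    (hB : ∀ i j, |a i j| ≤ B) (i : ι) (s : Finset ι) :
    ∫ x : ι → E, (∑ j ∈ s, a i j * h (x i) (x j)) ^ 4 ∂(Measure.pi fun _ : ι => F) ≤
      16 * (s.card : ℝ) ^ 2 * (B ^ 4 * ∫ z, h z.1 z.2 ^ 4 ∂(F.prod F)) := by
  set e := B ^ 4 * ∫ z, h z.1 z.2 ^ 4 ∂(F.prod F) with he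
  have he0 : 0 ≤ e := mul_nonneg (by positivity) (integral_nonneg fun _ => by positivity)
  induction s using Finset.induction_on with
  | empty => simp
  | insert b s hb ih =>
    rw [Finset.card_insert_of_notMem hb]
    have hZe := integral_term_pow_four_le hh ha hB i b
    rw [← he] at hZe
    simp_rw [Finset.sum_insert hb]
    have hZ := memLp_term (F := F) hh ha i b
    have hA : MemLp (fun x : ι → E => ∑ j ∈ s, a i j * h (x i) (x j)) 4
      (Measure.pi fun _ : ι => F) := memLp_finsetSum _ fun j _ => memLp_term hh ha i j
    rcases s.eq_empty_or_nonempty with rfl | hs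
    · simp only [Finset.sum_empty, add_zero, Finset.card_empty, zero_add,
        Nat.cast_one]
      linarith
    have hk : (1 : ℝ) ≤ s.card := by exact_mod_cast hs.card_pos
    set A : (ι → E) → ℝ := fun x => ∑ j ∈ s, a i j * h (x i) (x j) with hAdef
    set Z : (ι → E) → ℝ := fun x => a i b * h (x i) (x b) with hZdef
    set k : ℝ := (s.card : ℝ) with hkdef
    have hA3Z : Integrable (fun x => A x ^ 3 * Z x) (Measure.pi fun _ : ι => F) := by
      have := integrable_mul_four hA hA hA hZ
      refine this.congr (ae_of_all _ fun x => ?_)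
      simp only; ring
    have hzero : ∫ x, A x ^ 3 * Z x ∂(Measure.pi fun _ : ι => F) = 0 := by
      by_cases hib : i = b
      · subst hib; simp [hZdef, ha]
      · refine integral_mul_eq_zero_of_update (𝕜 := ℝ) b hA3Z ?_ ?_
        · intro x z
          simp only [hAdef]
          congr 1
          refine Finset.sum_congr rfl fun j hj => ?_
          rw [Function.update_of_ne hib, Function.update_of_ne (ne_of_mem_of_not_mem hj hb)]
        · intro x
          simp only [hZdef, Function.update_self, Function.update_of_ne hib]
          rw [integral_const_mul, hh.integral_eq_zero, mul_zero]
    have iA := integrable_pow_four hA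
    have iZ := integrable_pow_four hZ
    have i1 := iA.const_mul (1 + 1 / k)
    have i2 := iZ.const_mul (16 * k + 3)
    have i3 := hA3Z.const_mul 4
    have hbound : ∫ x, (Z x + A x) ^ 4 ∂(Measure.pi fun _ : ι => F) ≤
        ∫ x, ((1 + 1 / k) * A x ^ 4 + (16 * k + 3) * Z x ^ 4 + 4 * (A x ^ 3 * Z x))
          ∂(Measure.pi fun _ : ι => F) := by
      refine integral_mono (integrable_pow_four (hZ.add hA)) ((i1.fun_add i2).fun_add i3)
        fun x => ?_
      -- The terms 6A²Z² and 4AZ³ are absorbed at the price of a factor 1 + 1/k on A⁴. Over the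
      -- induction this factor costs only linear growth, and 16k² + 16k + (16k + 3) ≤ 16(k + 1)²
      -- closes it.
      have e1 : (1 + 1 / k) * A x ^ 4 + (16 * k + 3) * Z x ^ 4 + 4 * (A x ^ 3 * Z x) -
          (Z x + A x) ^ 4 = 1 / k * (A x ^ 2 - 4 * k * Z x ^ 2) ^ 2 +
            2 * Z x ^ 2 * (A x - Z x) ^ 2 := by
        field_simp; ring
      have e2 : 0 ≤ 1 / k * (A x ^ 2 - 4 * k * Z x ^ 2) ^ 2 + 2 * Z x ^ 2 * (A x - Z x) ^ 2 := by
        positivity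
      simp only
      linarith
    refine hbound.trans ?_
    rw [integral_add (i1.fun_add i2) i3, integral_add i1 i2, integral_const_mul,
      integral_const_mul, integral_const_mul, hzero, mul_zero, add_zero]
    have h1 : (1 + 1 / k) * ∫ x, A x ^ 4 ∂(Measure.pi fun _ : ι => F) ≤
        (1 + 1 / k) * (16 * k ^ 2 * e) := mul_le_mul_of_nonneg_left ih (by positivity)
    have h2 : (16 * k + 3) * ∫ x, Z x ^ 4 ∂(Measure.pi fun _ : ι => F) ≤ (16 * k + 3) * e :=
      mul_le_mul_of_nonneg_left hZe (by positivity)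
    have h3 : (1 + 1 / k) * (16 * k ^ 2 * e) = 16 * k ^ 2 * e + 16 * k * e := by
      field_simp
    push_cast
    nlinarith

lemma integral_linearPart_pow_four_le (hh : IsDegenerateKernel F h) (ha : ∀ i, a i i = 0) {B : ℝ}
    (hB : ∀ i j, |a i j| ≤ B) (i : ι) :
    ∫ x : ι → E, linearPart a h i x ^ 4 ∂(Measure.pi fun _ : ι => F) ≤
      16 * (Fintype.card ι : ℝ) ^ 2 * (B ^ 4 * ∫ z, h z.1 z.2 ^ 4 ∂(F.prod F)) :=
  integral_sum_term_pow_four_le hh ha hB i Finset.univ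

omit [MeasurableSpace E] in
lemma linearPart_update (ha : ∀ i, a i i = 0) (i : ι) (x : ι → E) (z : E) :
    linearPart a h i (Function.update x i z) = ∑ j, a i j * h z (x j) := by
  refine Finset.sum_congr rfl fun j _ => ?_
  by_cases hij : j = i
  · subst hij; simp [ha]
  · rw [Function.update_self, Function.update_of_ne hij]

-- By symmetry each pair containing i occurs twice in the double sum, which the factor 1/2
-- compensates; the remainder is the form on the other indices. Hence it is unaffected by resampling
-- x_i.
omit [MeasurableSpace E] in
lemma quadForm_sub_linearPart (hsymm : ∀ x y, h x y = h y x) (ha : ∀ i, a i i = 0)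
    (hasymm : ∀ i j, a i j = a j i) (i : ι) (x : ι → E) :
    quadForm a h x - linearPart a h i x =
      (∑ j, ∑ l, if j = i ∨ l = i then 0 else a j l * h (x j) (x l)) / 2 := by
  have e : ∀ j l, a j l * h (x j) (x l) =
      (if j = i ∨ l = i then 0 else a j l * h (x j) (x l)) +
      ((if j = i then a i l * h (x i) (x l) else 0) +
        (if l = i then a i j * h (x i) (x j) else 0)) := by
    intro j l
    by_cases hj : j = i <;> by_cases hl : l = i
    · subst hj; subst hl; simp [ha]
    · simp [hj, hl]
    · simp [hj, hl, hasymm j i, hsymm (x j) (x i)]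
    · simp [hj, hl]
  have e2 : ∑ j, ∑ l, a j l * h (x j) (x l) =
      (∑ j, ∑ l, if j = i ∨ l = i then 0 else a j l * h (x j) (x l)) +
        2 * linearPart a h i x := by
    conv_lhs => enter [2, j, 2, l]; rw [e j l]
    simp_rw [Finset.sum_add_distrib]
    rw [Finset.sum_comm (f := fun j l => if j = i then a i l * h (x i) (x l) else 0)]
    simp only [Finset.sum_ite_eq', Finset.mem_univ, if_true, linearPart]
    ring
  rw [quadForm]
  simp only [linearPart] at e2 ⊢
  rw [e2]; ring

omit [MeasurableSpace E] in
lemma quadForm_sub_linearPart_update (hsymm : ∀ x y, h x y = h y x) (ha : ∀ i, a i i = 0)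
    (hasymm : ∀ i j, a i j = a j i) (i : ι) (x : ι → E) (z : E) :
    quadForm a h (Function.update x i z) - linearPart a h i (Function.update x i z) =
      quadForm a h x - linearPart a h i x := by
  rw [quadForm_sub_linearPart hsymm ha hasymm, quadForm_sub_linearPart hsymm ha hasymm]
  congr 1
  refine Finset.sum_congr rfl fun j _ => Finset.sum_congr rfl fun l _ => ?_
  split_ifs with hc
  · rfl
  · push Not at hc
    rw [Function.update_of_ne hc.1, Function.update_of_ne hc.2]

lemma integral_linearPart_update (hh : IsDegenerateKernel F h) (ha : ∀ i, a i i = 0) (i : ι)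
    (x : ι → E) : ∫ z, linearPart a h i (Function.update x i z) ∂F = 0 := by
  simp_rw [linearPart_update ha, hh.symm _ (x _)]
  rw [integral_finsetSum _ fun j _ =>
    ((memLp_two_of_four (hh.memLp_right _)).integrable one_le_two).const_mul _]
  simp [integral_const_mul, hh.integral_eq_zero]

lemma memLp_linearPart_update (hh : IsDegenerateKernel F h) (ha : ∀ i, a i i = 0) (i : ι)
    (x : ι → E) : MemLp (fun z => linearPart a h i (Function.update x i z)) 4 F := by
  simp_rw [linearPart_update ha, hh.symm _ (x _)]
  exact memLp_finsetSum _ fun j _ => (hh.memLp_right _).const_mul _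

/-- Expanding the square in the resampled variable turns each product of two kernels into a Gram
entry. The coordinate x_i does not enter the result because `a i i = 0`. -/
lemma integral_linearPart_update_sq (hh : IsDegenerateKernel F h) (ha : ∀ i, a i i = 0) (i : ι)
    (x : ι → E) : ∫ z, linearPart a h i (Function.update x i z) ^ 2 ∂F = gramPart F a h i x := by
  simp_rw [linearPart_update ha, sq, Finset.sum_mul_sum, gramPart, hh.symm _ (x _)]
  have e : ∀ j l z, a i j * h (x j) z * (a i l * h (x l) z) =
      a i j * a i l * (h (x j) z * h (x l) z) := fun j l z => by ring
  simp_rw [e]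
  have hint : ∀ j l, Integrable (fun z => a i j * a i l * (h (x j) z * h (x l) z)) F :=
    fun j l => (hh.integrable_mul_right _ _).const_mul _
  rw [integral_finsetSum _ fun j _ => integrable_finsetSum _ fun l _ => hint j l]
  refine Finset.sum_congr rfl fun j _ => ?_
  rw [integral_finsetSum _ fun l _ => hint j l]
  simp_rw [integral_const_mul, gram]

lemma gramPart_nonneg (hh : IsDegenerateKernel F h) (ha : ∀ i, a i i = 0) (i : ι) (x : ι → E) :
    0 ≤ gramPart F a h i x := by
  rw [← integral_linearPart_update_sq hh ha]
  exact integral_nonneg fun _ => sq_nonneg _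

lemma memLp_gram_eval (hh : IsDegenerateKernel F h) (j l : ι) :
    MemLp (fun x : ι → E => gram F h (x j) (x l)) 2 (Measure.pi fun _ : ι => F) := by
  by_cases hjl : j = l
  · subst hjl
    exact hh.memLp_gram_diag.comp_measurePreserving (measurePreserving_eval (fun _ : ι => F) j)
  · exact memLp_pair hh.memLp_gram hjl

lemma memLp_gramPart (hh : IsDegenerateKernel F h) (i : ι) :
    MemLp (gramPart F a h i) 2 (Measure.pi fun _ : ι => F) :=
  memLp_finsetSum _ fun j _ => memLp_finsetSum _ fun l _ => (memLp_gram_eval hh j l).const_mul _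

lemma integral_gramPart (hh : IsDegenerateKernel F h) (ha : ∀ i, a i i = 0) (i : ι) :
    ∫ x, gramPart F a h i x ∂(Measure.pi fun _ : ι => F) =
      ∫ x, linearPart a h i x ^ 2 ∂(Measure.pi fun _ : ι => F) := by
  rw [integral_update (memLp_two_of_four (memLp_linearPart hh ha i)).integrable_sq i]
  simp_rw [integral_linearPart_update_sq hh ha]

/-- Conditional Jensen: the square of the conditional second moment is at most the conditional
fourth moment. -/
lemma integral_gramPart_sq_le (hh : IsDegenerateKernel F h) (ha : ∀ i, a i i = 0) (i : ι) :
    ∫ x, gramPart F a h i x ^ 2 ∂(Measure.pi fun _ : ι => F) ≤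
      ∫ x, linearPart a h i x ^ 4 ∂(Measure.pi fun _ : ι => F) := by
  have h4 := integrable_pow_four (memLp_linearPart (a := a) hh ha i)
  rw [integral_update h4 i]
  refine integral_mono (memLp_gramPart hh i).integrable_sq
    (integrable_update h4 i).integral_prod_left fun x => ?_
  simp only
  rw [← integral_linearPart_update_sq hh ha]
  have hm := memLp_two_mul (memLp_linearPart_update hh ha i x) (memLp_linearPart_update hh ha i x)
  simp_rw [sq (linearPart a h i _)]
  refine (sq_integral_le_integral_sq hm).trans (le_of_eq ?_)
  refine integral_congr_ae (ae_of_all _ fun z => ?_)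
  simp only; ring

/-- The contribution of one coordinate to the Stein identity for `quadForm a h`. -/
lemma norm_integral_exp_linearPart_sub_le (hh : IsDegenerateKernel F h) (ha : ∀ i, a i i = 0)
    (hasymm : ∀ i j, a i j = a j i) (t : ℝ) (i : ι) {ε : ℝ} (hε : 0 < ε) :
    ‖(∫ x, Complex.exp (Complex.I * (t * quadForm a h x : ℝ)) * (linearPart a h i x : ℂ)
        ∂(Measure.pi fun _ : ι => F)) -
      Complex.I * t * ∫ x, Complex.exp (Complex.I * (t * quadForm a h x : ℝ)) *
        (gramPart F a h i x : ℂ) ∂(Measure.pi fun _ : ι => F)‖ ≤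
      3 / 2 * t ^ 2 * (ε * (∫ x, linearPart a h i x ^ 2 ∂(Measure.pi fun _ : ι => F)) +
        ε⁻¹ * ∫ x, linearPart a h i x ^ 4 ∂(Measure.pi fun _ : ι => F)) := by
  have hL := memLp_linearPart (a := a) hh ha i
  have hL2 := memLp_two_of_four hL
  have hR : AEStronglyMeasurable (fun x => quadForm a h x - linearPart a h i x)
    (Measure.pi fun _ : ι => F) := ((memLp_quadForm hh ha).sub hL).aestronglyMeasurable
  have hinv : ∀ (x : ι → E) (z : E), Complex.exp (Complex.I * (t * (quadForm a h
      (Function.update x i z) - linearPart a h i (Function.update x i z)) : ℝ)) =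
      Complex.exp (Complex.I * (t * (quadForm a h x - linearPart a h i x) : ℝ)) := by
    intro x z; rw [quadForm_sub_linearPart_update hh.symm ha hasymm]
  have key := norm_integral_exp_mul_sub_le (R := fun x => quadForm a h x - linearPart a h i x) t
    hL (memLp_gramPart (a := a) hh i) hR (gramPart_nonneg hh ha i) ?_ ?_
    (integral_gramPart hh ha i) (integral_gramPart_sq_le hh ha i) hε
  · simpa only [sub_add_cancel] using key
  -- The exponential of the leave-one-out form is constant in coordinate i. Integrating that
  -- coordinate first therefore replaces the linear part by its conditional mean 0 and, in the next
  -- case, its square by `gramPart`.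
  · refine integral_mul_eq_zero_of_update (𝕜 := ℂ) i
      (integrable_exp_mul (hR.const_mul t) (hL2.integrable one_le_two)) hinv fun x => ?_
    have := integral_linearPart_update hh ha i x
    rw [← Complex.ofReal_zero, ← this]
    exact integral_ofReal
  · rw [integral_update (integrable_exp_mul (hR.const_mul t) hL2.integrable_sq) i]
    refine integral_congr_ae (ae_of_all _ fun x => ?_)
    simp_rw [hinv]
    rw [integral_const_mul, ← integral_linearPart_update_sq hh ha]
    congr 1
    exact integral_ofReal

end QuadraticForm

/-! ### The quantitative central limit theorem for degenerate quadratic forms. -/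

section BerryEsseen

variable {ι E : Type*} [Fintype ι] [DecidableEq ι] [MeasurableSpace E]
  {F : Measure E} [IsProbabilityMeasure F] {h : E → E → ℝ} {a : ι → ι → ℝ}

omit [DecidableEq ι] in
lemma sq_sum_mul_le {B : ℝ} (hB : ∀ i j, |a i j| ≤ B) (j l : ι) :
    (∑ i, a i j * a i l) ^ 2 ≤ (Fintype.card ι : ℝ) ^ 2 * B ^ 4 := by
  have h1 : |∑ i, a i j * a i l| ≤ Fintype.card ι * B ^ 2 := by
    refine (Finset.abs_sum_le_sum_abs _ _).trans ?_
    rw [← nsmul_eq_mul, ← Finset.card_univ]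
    refine Finset.sum_le_card_nsmul _ _ _ fun i _ => ?_
    rw [abs_mul, sq]
    exact mul_le_mul (hB i j) (hB i l) (abs_nonneg _) ((abs_nonneg _).trans (hB i j))
  calc _ = |∑ i, a i j * a i l| ^ 2 := (sq_abs _).symm
    _ ≤ (Fintype.card ι * B ^ 2) ^ 2 := pow_le_pow_left₀ (abs_nonneg _) h1 2
    _ = _ := by ring

omit [DecidableEq ι] [IsProbabilityMeasure F] in
lemma sum_gramPart (x : ι → E) :
    ∑ i, gramPart F a h i x = ∑ j, ∑ l, (∑ i, a i j * a i l) * gram F h (x j) (x l) := by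
  simp_rw [gramPart, Finset.sum_mul]
  rw [Finset.sum_comm]
  refine Finset.sum_congr rfl fun j _ => Finset.sum_comm

/-- The conditional variances of the linear parts add up to an almost constant quantity. -/
lemma integral_sum_gramPart_sub_sq_le (hh : IsDegenerateKernel F h)
    {B : ℝ} (hB : ∀ i j, |a i j| ≤ B)
    (hnorm : (∑ i, ∑ j, a i j ^ 2) * ∫ z, h z.1 z.2 ^ 2 ∂(F.prod F) = 2) :
    ∫ x, (∑ i, gramPart F a h i x - 2) ^ 2 ∂(Measure.pi fun _ : ι => F) ≤
      2 * ((Fintype.card ι : ℝ) ^ 3 * B ^ 4 * (∫ z, h z.1 z.2 ^ 4 ∂(F.prod F)) +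
        2 * ((Fintype.card ι : ℝ) ^ 4 * B ^ 4 * ∫ z, gram F h z.1 z.2 ^ 2 ∂(F.prod F))) := by
  set τ := ∫ z, h z.1 z.2 ^ 2 ∂(F.prod F) with hτ
  set N : ℝ := (Fintype.card ι : ℝ) with hN
  set c : ι → ι → ℝ := fun j l => ∑ i, a i j * a i l with hc
  have hcB : ∀ j l, c j l ^ 2 ≤ N ^ 2 * B ^ 4 := sq_sum_mul_le hB
  -- The normalization places the mean of the sum of the `gramPart`s at 2, so that the diagonal part
  -- below is centered.
  have hdiag : (∑ j, c j j) * τ = 2 := by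
    rw [← hnorm]
    congr 1
    simp only [hc]
    rw [Finset.sum_comm]
    simp_rw [sq]
  -- `D` is a sum of independent centered terms, bounded through E h⁴. `O` is a degenerate
  -- U-statistic in the Gram kernel, bounded through E gram². Condition (C2) will control the first
  -- and (C3) the second.
  set D : (ι → E) → ℝ := fun x => ∑ j, c j j * (gram F h (x j) (x j) - τ) with hD
  set O : (ι → E) → ℝ := fun x => ∑ j, ∑ l, (if j = l then 0 else c j l) * gram F h (x j) (x l)
    with hO
  have hdec : ∀ x, ∑ i, gramPart F a h i x - 2 = D x + O x := by
    intro x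
    have e : ∀ j l, c j l * gram F h (x j) (x l) =
        (if j = l then c j j * gram F h (x j) (x j) else 0) +
          (if j = l then 0 else c j l) * gram F h (x j) (x l) := by
      intro j l
      by_cases hjl : j = l
      · subst hjl; simp
      · simp [hjl]
    rw [sum_gramPart]
    have : ∑ j, ∑ l, (∑ i, a i j * a i l) * gram F h (x j) (x l) =
      ∑ j, c j j * gram F h (x j) (x j) + O x := by
      conv_lhs => enter [2, j, 2, l]; rw [show (∑ i, a i j * a i l) = c j l from rfl, e j l]
      simp_rw [Finset.sum_add_distrib]
      simp [hO]
    rw [this, hD, ← hdiag]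
    simp only [mul_sub, Finset.sum_sub_distrib, Finset.sum_mul]
    ring
  have hkc : MemLp (fun z => gram F h z z - τ) 2 F := hh.memLp_gram_diag.sub (memLp_const τ)
  have hD2 : MemLp D 2 (Measure.pi fun _ : ι => F) := memLp_finsetSum _ fun j _ =>
    ((memLp_gram_eval hh j j).sub (memLp_const τ)).const_mul _
  have hO2 : MemLp O 2 (Measure.pi fun _ : ι => F) := memLp_finsetSum _ fun j _ =>
    memLp_finsetSum _ fun l _ => (memLp_gram_eval hh j l).const_mul _
  have hDle : ∫ x, D x ^ 2 ∂(Measure.pi fun _ : ι => F) ≤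
      N ^ 3 * B ^ 4 * (∫ z, h z.1 z.2 ^ 4 ∂(F.prod F)) := by
    have h0 : ∫ z, (gram F h z z - τ) ∂F = 0 := by
      rw [integral_sub (hh.memLp_gram_diag.integrable one_le_two) (integrable_const _),
        hh.integral_gram_diag]
      simp [hτ]
    rw [integral_sq_sum_eval_le hkc h0]
    have h1 : ∫ z, (gram F h z z - τ) ^ 2 ∂F ≤ ∫ z, h z.1 z.2 ^ 4 ∂(F.prod F) := by
      refine le_trans ?_ hh.integral_gram_diag_sq_le
      have i1 := hh.memLp_gram_diag.integrable_sq
      have i2 := (hh.memLp_gram_diag.integrable one_le_two).const_mul (2 * τ)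
      have e : ∀ z, (gram F h z z - τ) ^ 2 = gram F h z z ^ 2 - 2 * τ * gram F h z z + τ ^ 2 :=
        fun z => by ring
      have i3 : Integrable (fun z => gram F h z z ^ 2 - 2 * τ * gram F h z z) F := i1.sub i2
      simp_rw [e]
      rw [integral_add i3 (integrable_const _), integral_sub i1 i2, integral_const_mul,
        hh.integral_gram_diag, ← hτ]
      simp only [integral_const, probReal_univ, one_smul]
      nlinarith [sq_nonneg τ]
    have h2 : ∑ j, c j j ^ 2 ≤ N ^ 3 * B ^ 4 := by
      calc ∑ j, c j j ^ 2 ≤ ∑ _j : ι, N ^ 2 * B ^ 4 := Finset.sum_le_sum fun j _ => hcB j j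
        _ = _ := by simp [hN]; ring
    exact mul_le_mul h2 h1 (integral_nonneg fun _ => sq_nonneg _) (by positivity)
  have hOle : ∫ x, O x ^ 2 ∂(Measure.pi fun _ : ι => F) ≤
      2 * (N ^ 4 * B ^ 4 * ∫ z, gram F h z.1 z.2 ^ 2 ∂(F.prod F)) := by
    refine (integral_sq_sum_pair_le IsDegenerateKernel.gram_symm hh.memLp_gram hh.integral_gram_eq_zero
      (fun j l => if j = l then 0 else c j l) (by simp)).trans ?_
    rw [mul_assoc]
    refine mul_le_mul_of_nonneg_left (mul_le_mul_of_nonneg_right ?_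
      (integral_nonneg fun _ => sq_nonneg _)) two_pos.le
    calc _ ≤ ∑ _j : ι, ∑ _l : ι, N ^ 2 * B ^ 4 := by
          refine Finset.sum_le_sum fun j _ => Finset.sum_le_sum fun l _ => ?_
          split_ifs
          · simp; positivity
          · exact hcB j l
      _ = _ := by simp [hN]; ring
  simp_rw [hdec]
  calc _ ≤ ∫ x, (2 * D x ^ 2 + 2 * O x ^ 2) ∂(Measure.pi fun _ : ι => F) := by
        refine integral_mono (hD2.add hO2).integrable_sq
          ((hD2.integrable_sq.const_mul _).add (hO2.integrable_sq.const_mul _)) fun x => ?_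
        simp only
        nlinarith [sq_nonneg (D x - O x)]
    _ = 2 * (∫ x, D x ^ 2 ∂(Measure.pi fun _ : ι => F)) +
        2 * ∫ x, O x ^ 2 ∂(Measure.pi fun _ : ι => F) := by
        rw [integral_add (hD2.integrable_sq.const_mul _) (hO2.integrable_sq.const_mul _),
          integral_const_mul, integral_const_mul]
    _ ≤ _ := by linarith

/-- The linear parts add up to twice the form, so half the sum of the one-coordinate estimates is a
Stein identity. Replacing the sum of the `gramPart`s by 2 costs its L¹ distance to 2. -/
lemma norm_integral_exp_quadForm_mul_sub_le (hh : IsDegenerateKernel F h) (ha : ∀ i, a i i = 0)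
    (hasymm : ∀ i j, a i j = a j i) (t : ℝ) {ε : ℝ} (hε : 0 < ε) :
    ‖(∫ x, Complex.exp (Complex.I * (t * quadForm a h x : ℝ)) * (quadForm a h x : ℂ)
        ∂(Measure.pi fun _ : ι => F)) -
      Complex.I * t * ∫ x, Complex.exp (Complex.I * (t * quadForm a h x : ℝ))
        ∂(Measure.pi fun _ : ι => F)‖ ≤
      3 / 4 * t ^ 2 * (ε * (∑ i, ∫ x, linearPart a h i x ^ 2 ∂(Measure.pi fun _ : ι => F)) +
        ε⁻¹ * ∑ i, ∫ x, linearPart a h i x ^ 4 ∂(Measure.pi fun _ : ι => F)) +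
      |t| / 2 * ∫ x, |∑ i, gramPart F a h i x - 2| ∂(Measure.pi fun _ : ι => F) := by
  have hS : AEStronglyMeasurable (fun x => t * quadForm a h x) (Measure.pi fun _ : ι => F) :=
    (memLp_quadForm hh ha).aestronglyMeasurable.const_mul t
  have hL : ∀ i, Integrable (linearPart a h i) (Measure.pi fun _ : ι => F) := fun i =>
    (memLp_two_of_four (memLp_linearPart hh ha i)).integrable one_le_two
  have hΓ : ∀ i, Integrable (gramPart F a h i) (Measure.pi fun _ : ι => F) := fun i =>
    (memLp_gramPart hh i).integrable one_le_two
  have hH : Integrable (fun x => ∑ i, gramPart F a h i x - 2) (Measure.pi fun _ : ι => F) :=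
    (integrable_finsetSum _ fun i _ => hΓ i).sub (integrable_const _)
  have e1 : ∫ x, Complex.exp (Complex.I * (t * quadForm a h x : ℝ)) * (quadForm a h x : ℂ)
      ∂(Measure.pi fun _ : ι => F) = 2⁻¹ * ∑ i, ∫ x, Complex.exp (Complex.I *
        (t * quadForm a h x : ℝ)) * (linearPart a h i x : ℂ) ∂(Measure.pi fun _ : ι => F) := by
    rw [← integral_finsetSum _ fun i _ => integrable_exp_mul hS (hL i), ← integral_const_mul]
    refine integral_congr_ae (ae_of_all _ fun x => ?_)
    simp only
    rw [← Finset.mul_sum, ← Complex.ofReal_sum]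
    conv_lhs => enter [2]; rw [quadForm]
    push_cast; ring
  have e2 : ∫ x, Complex.exp (Complex.I * (t * quadForm a h x : ℝ))
      ∂(Measure.pi fun _ : ι => F) = 2⁻¹ * ((∑ i, ∫ x, Complex.exp (Complex.I *
        (t * quadForm a h x : ℝ)) * (gramPart F a h i x : ℂ) ∂(Measure.pi fun _ : ι => F)) -
        ∫ x, Complex.exp (Complex.I * (t * quadForm a h x : ℝ)) *
          ((∑ i, gramPart F a h i x - 2 : ℝ) : ℂ) ∂(Measure.pi fun _ : ι => F)) := by
    rw [← integral_finsetSum _ fun i _ => integrable_exp_mul hS (hΓ i),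
      ← integral_sub (integrable_finsetSum _ fun i _ => integrable_exp_mul hS (hΓ i))
        (integrable_exp_mul hS hH), ← integral_const_mul]
    refine integral_congr_ae (ae_of_all _ fun x => ?_)
    simp only
    rw [← Finset.mul_sum]
    push_cast; ring
  set X : ι → ℂ := fun i => ∫ x, Complex.exp (Complex.I * (t * quadForm a h x : ℝ)) *
    (linearPart a h i x : ℂ) ∂(Measure.pi fun _ : ι => F)
  set Y : ι → ℂ := fun i => ∫ x, Complex.exp (Complex.I * (t * quadForm a h x : ℝ)) *
    (gramPart F a h i x : ℂ) ∂(Measure.pi fun _ : ι => F)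
  set Z : ℂ := ∫ x, Complex.exp (Complex.I * (t * quadForm a h x : ℝ)) *
    ((∑ i, gramPart F a h i x - 2 : ℝ) : ℂ) ∂(Measure.pi fun _ : ι => F)
  have hXY : ∀ i, ‖X i - Complex.I * t * Y i‖ ≤ 3 / 2 * t ^ 2 *
      (ε * (∫ x, linearPart a h i x ^ 2 ∂(Measure.pi fun _ : ι => F)) +
        ε⁻¹ * ∫ x, linearPart a h i x ^ 4 ∂(Measure.pi fun _ : ι => F)) := fun i =>
    norm_integral_exp_linearPart_sub_le hh ha hasymm t i hε
  have hZ : ‖Z‖ ≤ ∫ x, |∑ i, gramPart F a h i x - 2| ∂(Measure.pi fun _ : ι => F) := by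
    refine norm_integral_le_of_norm_le hH.abs (ae_of_all _ fun x => ?_)
    rw [norm_mul, norm_exp_I_mul_ofReal, one_mul, Complex.norm_real, Real.norm_eq_abs]
  rw [e1, e2]
  have e3 : 2⁻¹ * ∑ i, X i - Complex.I * t * (2⁻¹ * (∑ i, Y i - Z)) =
      2⁻¹ * ∑ i, (X i - Complex.I * t * Y i) + Complex.I * t * (2⁻¹ * Z) := by
    rw [Finset.sum_sub_distrib, ← Finset.mul_sum]; ring
  rw [e3]
  refine (norm_add_le _ _).trans (add_le_add ?_ ?_)
  · rw [norm_mul]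
    calc _ ≤ 2⁻¹ * ∑ i, 3 / 2 * t ^ 2 *
        (ε * (∫ x, linearPart a h i x ^ 2 ∂(Measure.pi fun _ : ι => F)) +
          ε⁻¹ * ∫ x, linearPart a h i x ^ 4 ∂(Measure.pi fun _ : ι => F)) := by
          rw [norm_inv, Complex.norm_ofNat]
          exact mul_le_mul_of_nonneg_left ((norm_sum_le _ _).trans
            (Finset.sum_le_sum fun i _ => hXY i)) (by norm_num)
      _ = _ := by
          rw [← Finset.mul_sum, Finset.sum_add_distrib, Finset.mul_sum, Finset.mul_sum]; ring
  · rw [norm_mul, norm_mul, norm_mul, norm_inv, Complex.norm_ofNat, Complex.norm_I, one_mul,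
      Complex.norm_real, Real.norm_eq_abs]
    have := mul_le_mul_of_nonneg_left hZ (abs_nonneg t)
    linarith

/-- A quantitative central limit theorem for degenerate weighted U-statistics of order two. -/
theorem norm_integral_exp_quadForm_sub_gaussian_le (hh : IsDegenerateKernel F h)
    (ha : ∀ i, a i i = 0) (hasymm : ∀ i j, a i j = a j i) {B : ℝ} (hB : ∀ i j, |a i j| ≤ B)
    (hnorm : (∑ i, ∑ j, a i j ^ 2) * ∫ z, h z.1 z.2 ^ 2 ∂(F.prod F) = 2) (t : ℝ)
    {ε : ℝ} (hε : 0 < ε) :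
    ‖(∫ x, Complex.exp (Complex.I * (t * quadForm a h x : ℝ)) ∂(Measure.pi fun _ : ι => F)) -
      Complex.exp (-(t ^ 2 : ℝ) / 2)‖ ≤
      |t| * (3 / 4 * t ^ 2 * (4 * ε + ε⁻¹ * (16 * ((Fintype.card ι : ℝ) ^ 3 * B ^ 4 *
          ∫ z, h z.1 z.2 ^ 4 ∂(F.prod F)))) +
        |t| / 4 * (ε + ε⁻¹ * (2 * ((Fintype.card ι : ℝ) ^ 3 * B ^ 4 *
          (∫ z, h z.1 z.2 ^ 4 ∂(F.prod F)) + 2 * ((Fintype.card ι : ℝ) ^ 4 * B ^ 4 *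
            ∫ z, gram F h z.1 z.2 ^ 2 ∂(F.prod F)))))) := by
  refine norm_integral_exp_sub_gaussian_le
    ((memLp_two_of_four (memLp_quadForm hh ha)).integrable one_le_two) t fun s hs => ?_
  refine (norm_integral_exp_quadForm_mul_sub_le hh ha hasymm s hε).trans ?_
  have hq : 0 ≤ ∫ z, h z.1 z.2 ^ 4 ∂(F.prod F) := integral_nonneg fun _ => by positivity
  have hεi := inv_pos.2 hε
  -- The bound 4 is the factor 2 of `integral_linearPart_sq_le` times the normalization 2.
  have b2 : ∑ i, ∫ x, linearPart a h i x ^ 2 ∂(Measure.pi fun _ : ι => F) ≤ 4 := by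
    refine (Finset.sum_le_sum fun i _ => integral_linearPart_sq_le hh ha i).trans ?_
    rw [← Finset.sum_mul, ← Finset.mul_sum]
    linarith
  have b4 : ∑ i, ∫ x, linearPart a h i x ^ 4 ∂(Measure.pi fun _ : ι => F) ≤
      16 * ((Fintype.card ι : ℝ) ^ 3 * B ^ 4 * ∫ z, h z.1 z.2 ^ 4 ∂(F.prod F)) := by
    refine (Finset.sum_le_sum fun i _ => integral_linearPart_pow_four_le hh ha hB i).trans ?_
    simp only [Finset.sum_const, Finset.card_univ, nsmul_eq_mul]
    apply le_of_eq; ring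
  have hH : MemLp (fun x => ∑ i, gramPart F a h i x - 2) 2 (Measure.pi fun _ : ι => F) :=
    (memLp_finsetSum _ fun i _ => memLp_gramPart hh i).sub (memLp_const _)
  have bH := (integral_abs_le_of_sq hH hε)
  have bH2 := mul_le_mul_of_nonneg_left (integral_sum_gramPart_sub_sq_le hh hB hnorm) hεi.le
  have hs2 : s ^ 2 ≤ t ^ 2 := sq_le_sq.2 hs
  have n4 : 0 ≤ ∑ i, ∫ x, linearPart a h i x ^ 4 ∂(Measure.pi fun _ : ι => F) :=
    Finset.sum_nonneg fun i _ => integral_nonneg fun _ => by positivity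
  have n2 : 0 ≤ ∑ i, ∫ x, linearPart a h i x ^ 2 ∂(Measure.pi fun _ : ι => F) :=
    Finset.sum_nonneg fun i _ => integral_nonneg fun _ => by positivity
  refine add_le_add (mul_le_mul (by linarith) ?_ (by positivity) (by positivity)) ?_
  · have := mul_le_mul_of_nonneg_left b2 hε.le
    have := mul_le_mul_of_nonneg_left b4 hεi.le
    linarith
  · calc _ ≤ |t| / 2 * ∫ x, |∑ i, gramPart F a h i x - 2| ∂(Measure.pi fun _ : ι => F) :=
          mul_le_mul_of_nonneg_right (by linarith) (integral_nonneg fun _ => abs_nonneg _)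
      _ ≤ |t| / 2 * ((ε + ε⁻¹ * (2 * ((Fintype.card ι : ℝ) ^ 3 * B ^ 4 *
          (∫ z, h z.1 z.2 ^ 4 ∂(F.prod F)) + 2 * ((Fintype.card ι : ℝ) ^ 4 * B ^ 4 *
            ∫ z, gram F h z.1 z.2 ^ 2 ∂(F.prod F))))) / 2) := by
          refine mul_le_mul_of_nonneg_left (bH.trans ?_) (by positivity)
          linarith
      _ = _ := by ring

end BerryEsseen

/-! ### The double centered distance as a degenerate kernel. -/

section CenteredDist

variable {p : ℕ} {F : Measure (Eucl p)} [IsProbabilityMeasure F]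

omit [IsProbabilityMeasure F] in
lemma memLp_norm (hF : Integrable (fun x => ‖x‖ ^ 4) F) : MemLp (fun x => ‖x‖) 4 F :=
  (memLp_four_iff (by fun_prop)).2 hF

lemma integrable_dist_left (hF : Integrable (fun x => ‖x‖ ^ 4) F) (x : Eucl p) :
    Integrable (fun z => ‖x - z‖) F := by
  have h1 := (memLp_two_of_four (memLp_norm hF)).integrable one_le_two
  exact ((integrable_const ‖x‖).add h1).mono' (by fun_prop)
    (ae_of_all _ fun z => by simpa using norm_sub_le x z)

lemma integrable_dist_prod (hF : Integrable (fun x => ‖x‖ ^ 4) F) :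
    Integrable (fun z : Eucl p × Eucl p => ‖z.1 - z.2‖) (F.prod F) := by
  have h1 := (memLp_two_of_four (memLp_norm hF)).integrable one_le_two
  exact ((h1.comp_fst F).add (h1.comp_snd F)).mono' (by fun_prop)
    (ae_of_all _ fun z => by simpa using norm_sub_le z.1 z.2)

omit [IsProbabilityMeasure F] in
lemma doubleCenteredDist_eq (x y : Eucl p) :
    doubleCenteredDist F x y = ‖x - y‖ - (∫ z, ‖x - z‖ ∂F) - (∫ z, ‖y - z‖ ∂F) +
      ∫ z, ‖z.1 - z.2‖ ∂(F.prod F) := by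
  simp_rw [doubleCenteredDist, norm_sub_rev _ y]

lemma measurable_doubleCenteredDist : Measurable (Function.uncurry (doubleCenteredDist F)) := by
  have h1 : Measurable fun x : Eucl p => ∫ z, ‖x - z‖ ∂F := by
    have hm : StronglyMeasurable fun q : Eucl p × Eucl p => ‖q.1 - q.2‖ :=
      Continuous.stronglyMeasurable (by fun_prop)
    exact hm.integral_prod_right'.measurable
  have e : Function.uncurry (doubleCenteredDist F) = fun q : Eucl p × Eucl p =>
      ‖q.1 - q.2‖ - (∫ z, ‖q.1 - z‖ ∂F) - (∫ z, ‖q.2 - z‖ ∂F) +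
        ∫ z, ‖z.1 - z.2‖ ∂(F.prod F) := by
    ext q; exact doubleCenteredDist_eq q.1 q.2
  rw [e]
  have h2 : Measurable fun q : Eucl p × Eucl p => ∫ z, ‖q.1 - z‖ ∂F := h1.comp measurable_fst
  have h3 : Measurable fun q : Eucl p × Eucl p => ∫ z, ‖q.2 - z‖ ∂F := h1.comp measurable_snd
  have h4 : Measurable fun q : Eucl p × Eucl p => ‖q.1 - q.2‖ := by fun_prop
  exact ((h4.sub h2).sub h3).add_const _

lemma integral_dist_left_le (hF : Integrable (fun x => ‖x‖ ^ 4) F) (x : Eucl p) :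
    ∫ z, ‖x - z‖ ∂F ≤ ‖x‖ + ∫ z, ‖z‖ ∂F := by
  have h1 := (memLp_two_of_four (memLp_norm hF)).integrable one_le_two
  calc _ ≤ ∫ z, (‖x‖ + ‖z‖) ∂F := integral_mono (integrable_dist_left hF x)
        ((integrable_const _).add h1) fun z => norm_sub_le x z
    _ = _ := by rw [integral_add (integrable_const _) h1]; simp

lemma integral_dist_prod_le (hF : Integrable (fun x => ‖x‖ ^ 4) F) :
    ∫ z, ‖z.1 - z.2‖ ∂(F.prod F) ≤ 2 * ∫ z, ‖z‖ ∂F := by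
  have h1 := (memLp_two_of_four (memLp_norm hF)).integrable one_le_two
  rw [integral_prod _ (integrable_dist_prod hF)]
  calc _ ≤ ∫ x, (‖x‖ + ∫ z, ‖z‖ ∂F) ∂F :=
        integral_mono (integrable_dist_prod hF).integral_prod_left
          (h1.add (integrable_const _)) (integral_dist_left_le hF)
    _ = _ := by rw [integral_add h1 (integrable_const _)]; simp; ring

/-- The natural bound is additive in ‖x‖ and ‖y‖. The added 1 in each factor lets a product dominate
such a sum, as `exists_bound` requires. -/
lemma abs_doubleCenteredDist_le (hF : Integrable (fun x => ‖x‖ ^ 4) F) (x y : Eucl p) :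
    |doubleCenteredDist F x y| ≤
      ((1 + 2 * ∫ z, ‖z‖ ∂F) + 2 * ‖x‖) * ((1 + 2 * ∫ z, ‖z‖ ∂F) + 2 * ‖y‖) := by
  rw [doubleCenteredDist_eq]
  have hM0 : 0 ≤ ∫ z, ‖z‖ ∂F := integral_nonneg fun _ => norm_nonneg _
  have b0 : ∀ x : Eucl p, 0 ≤ ∫ z, ‖x - z‖ ∂F := fun x => integral_nonneg fun _ => norm_nonneg _
  have b2 := integral_dist_prod_le hF
  have b3 : 0 ≤ ∫ z, ‖z.1 - z.2‖ ∂(F.prod F) := integral_nonneg fun _ => norm_nonneg _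
  have c1 := norm_sub_le x y
  have c2 := norm_nonneg (x - y)
  have c3 := norm_nonneg x
  have c4 := norm_nonneg y
  have c5 := integral_dist_left_le hF x
  have c6 := integral_dist_left_le hF y
  have c7 := b0 x
  have c8 := b0 y
  generalize (∫ z, ‖z‖ ∂F) = M at *
  generalize (∫ z, ‖x - z‖ ∂F) = u at *
  generalize (∫ z, ‖y - z‖ ∂F) = v at *
  generalize (∫ z, ‖z.1 - z.2‖ ∂(F.prod F)) = w at *
  have h5 : 0 ≤ (2 * M + 2 * ‖x‖) * (2 * M + 2 * ‖y‖) := by positivity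
  have h6 : ((1 + 2 * M) + 2 * ‖x‖) * ((1 + 2 * M) + 2 * ‖y‖) =
    1 + 4 * M + 2 * ‖x‖ + 2 * ‖y‖ + (2 * M + 2 * ‖x‖) * (2 * M + 2 * ‖y‖) := by ring
  rw [h6, abs_le]
  constructor <;> linarith

lemma integral_doubleCenteredDist (hF : Integrable (fun x => ‖x‖ ^ 4) F) (x : Eucl p) :
    ∫ y, doubleCenteredDist F x y ∂F = 0 := by
  have i1 := integrable_dist_left hF x
  have i2 : Integrable (fun y => ∫ z, ‖y - z‖ ∂F) F := (integrable_dist_prod hF).integral_prod_left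
  have i3 : Integrable (fun y => ‖x - y‖ - ∫ z, ‖x - z‖ ∂F) F := i1.sub (integrable_const _)
  have i4 : Integrable (fun y => ‖x - y‖ - (∫ z, ‖x - z‖ ∂F) - ∫ z, ‖y - z‖ ∂F) F := i3.sub i2
  simp_rw [doubleCenteredDist_eq]
  rw [integral_add i4 (integrable_const _), integral_sub i3 i2,
    integral_sub i1 (integrable_const _), integral_prod _ (integrable_dist_prod hF)]
  simp

lemma isDegenerateKernel_doubleCenteredDist (hF : Integrable (fun x => ‖x‖ ^ 4) F) :
    IsDegenerateKernel F (doubleCenteredDist F) where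
  measurable := measurable_doubleCenteredDist
  symm x y := by
    rw [doubleCenteredDist_eq, doubleCenteredDist_eq, norm_sub_rev x y]; ring
  exists_bound := by
    have hm : ∀ c : ℝ, MemLp (fun x : Eucl p => c + 2 * ‖x‖) 4 F := fun c =>
      (memLp_const c).add ((memLp_norm hF).const_mul 2)
    exact ⟨fun x => (1 + 2 * ∫ z, ‖z‖ ∂F) + 2 * ‖x‖, hm _, abs_doubleCenteredDist_le hF⟩
  integral_eq_zero := integral_doubleCenteredDist hF

/-- The cyclic moment is the second moment of the Gram kernel. -/
lemma integral_gram_sq (hF : Integrable (fun x => ‖x‖ ^ 4) F) :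
    ∫ z, gram F (doubleCenteredDist F) z.1 z.2 ^ 2 ∂(F.prod F) = cyclicMoment F := by
  have hh := isDegenerateKernel_doubleCenteredDist hF
  set h := doubleCenteredDist F with hdef
  have hp : ∀ i j : Fin 4, i ≠ j → MemLp (fun x : Fin 4 → Eucl p => h (x i) (x j)) 4
    (Measure.pi fun _ => F) := fun i j hij => memLp_pair hh.memLp hij
  have i1 : Integrable (fun x : Fin 4 → Eucl p => h (x 0) (x 2) * h (x 1) (x 2) *
      h (x 0) (x 3) * h (x 1) (x 3)) (Measure.pi fun _ => F) := by
    refine (integrable_mul_four (hp 0 2 (by decide)) (hp 1 2 (by decide)) (hp 0 3 (by decide))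
      (hp 1 3 (by decide))).congr (ae_of_all _ fun x => ?_)
    simp only; ring
  have i2 : Integrable (fun x : Fin 4 → Eucl p => gram F h (x 0) (x 1) *
      (h (x 0) (x 3) * h (x 1) (x 3))) (Measure.pi fun _ => F) :=
    (memLp_gram_eval hh 0 1).integrable_mul (memLp_two_mul (hp 0 3 (by decide))
      (hp 1 3 (by decide)))
  have hm : AEStronglyMeasurable (Function.uncurry fun a b => gram F h a b ^ 2) (F.prod F) :=
    (hh.measurable_gram.pow_const 2).aestronglyMeasurable
  -- In the four-cycle, `x 2` and `x 3` are each joined to both `x 0` and `x 1`; integrating either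
  -- one out produces one factor `gram (x 0) (x 1)`.
  rw [cyclicMoment, ← hdef, integral_update i1 2]
  have e1 : ∀ x : Fin 4 → Eucl p, ∫ z, h (Function.update x 2 z 0) (Function.update x 2 z 2) *
      h (Function.update x 2 z 1) (Function.update x 2 z 2) *
      h (Function.update x 2 z 0) (Function.update x 2 z 3) *
      h (Function.update x 2 z 1) (Function.update x 2 z 3) ∂F =
      gram F h (x 0) (x 1) * (h (x 0) (x 3) * h (x 1) (x 3)) := by
    intro x
    simp only [Function.update_self, ne_eq, Fin.reduceEq, not_false_eq_true,
      Function.update_of_ne]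
    simp_rw [mul_assoc]
    simp_rw [← mul_assoc (h (x 0) _) (h (x 1) _)]
    rw [integral_mul_const, gram]
  simp_rw [e1]
  rw [integral_update i2 3]
  have e2 : ∀ x : Fin 4 → Eucl p, ∫ z, gram F h (Function.update x 3 z 0) (Function.update x 3 z 1) *
      (h (Function.update x 3 z 0) (Function.update x 3 z 3) *
      h (Function.update x 3 z 1) (Function.update x 3 z 3)) ∂F = gram F h (x 0) (x 1) ^ 2 := by
    intro x
    simp only [Function.update_self, ne_eq, Fin.reduceEq, not_false_eq_true,
      Function.update_of_ne]
    rw [integral_const_mul, sq]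
    rfl
  simp_rw [e2]
  exact (integral_pair (ι := Fin 4) (i := 0) (j := 1) hm (by decide)).symm

end CenteredDist

/-! ### Second moments of centered, not necessarily degenerate, U-statistics. -/

section UStatistic

variable {ι E : Type*} [Fintype ι] [DecidableEq ι] [MeasurableSpace E]
  {F : Measure E} [IsProbabilityMeasure F]

/-- Centered kernels evaluated at disjoint pairs of coordinates are uncorrelated. -/
lemma integral_pair_mul_pair_eq_zero_of_disjoint {k : E → E → ℝ} (hsymm : ∀ x y, k x y = k y x)
    (hk : MemLp (Function.uncurry k) 2 (F.prod F)) (h0 : ∫ z, k z.1 z.2 ∂(F.prod F) = 0)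
    {i j i' j' : ι} (hij : i ≠ j) (hij' : i' ≠ j') (h1 : i ≠ i') (h2 : i ≠ j') (h3 : j ≠ i')
    (h4 : j ≠ j') :
    ∫ x : ι → E, k (x i') (x j') * k (x i) (x j) ∂(Measure.pi fun _ : ι => F) = 0 := by
  have hint : Integrable (fun x : ι → E => k (x i') (x j') * k (x i) (x j))
    (Measure.pi fun _ : ι => F) := (memLp_pair hk hij').integrable_mul (memLp_pair hk hij)
  -- Only the overall mean of `k` vanishes, so one resampling is not enough: averaging over x_i
  -- leaves a function of x_j, whose mean vanishes in the second resampling.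
  have e : ∀ x : ι → E, ∫ z, k (Function.update x i z i') (Function.update x i z j') *
      k (Function.update x i z i) (Function.update x i z j) ∂F =
      k (x i') (x j') * ∫ z, k (x j) z ∂F := by
    intro x
    simp_rw [Function.update_self, Function.update_of_ne h1.symm, Function.update_of_ne h2.symm,
      Function.update_of_ne hij.symm, hsymm _ (x j)]
    rw [integral_const_mul]
  have hint2 := (integrable_update hint i).integral_prod_left
  simp_rw [e] at hint2
  rw [integral_update hint i]
  simp_rw [e]
  refine integral_mul_eq_zero_of_update (𝕜 := ℝ) j hint2 ?_ ?_
  · intro x z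
    rw [Function.update_of_ne h3.symm, Function.update_of_ne h4.symm]
  · intro x
    simp_rw [Function.update_self]
    rw [← h0, integral_prod (fun z => k z.1 z.2) (hk.integrable one_le_two)]

/-- The second moment of a centered U-statistic. -/
lemma integral_sq_sum_pair_le_of_centered {k : E → E → ℝ} (hsymm : ∀ x y, k x y = k y x)
    (hk : MemLp (Function.uncurry k) 2 (F.prod F)) (h0 : ∫ z, k z.1 z.2 ∂(F.prod F) = 0) :
    ∫ x : ι → E, (∑ i, ∑ j, if i = j then 0 else k (x i) (x j)) ^ 2
        ∂(Measure.pi fun _ : ι => F) ≤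
      4 * (Fintype.card ι : ℝ) ^ 3 * ∫ z, k z.1 z.2 ^ 2 ∂(F.prod F) := by
  set τ := ∫ z, k z.1 z.2 ^ 2 ∂(F.prod F) with hτ
  have hτ0 : 0 ≤ τ := integral_nonneg fun _ => sq_nonneg _
  set f : ι × ι → (ι → E) → ℝ := fun q x => if q.1 = q.2 then 0 else k (x q.1) (x q.2) with hf
  have hmem : ∀ q : ι × ι, MemLp (f q) 2 (Measure.pi fun _ : ι => F) := by
    rintro ⟨i, j⟩
    by_cases hij : i = j
    · simp [hf, hij]
    · simpa [hf, hij] using memLp_pair hk hij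
  have hI : ∀ q r : ι × ι, Integrable (fun x => f q x * f r x) (Measure.pi fun _ : ι => F) :=
    fun q r => (hmem q).integrable_mul (hmem r)
  have hsq : ∀ q, ∫ x, f q x ^ 2 ∂(Measure.pi fun _ : ι => F) ≤ τ := by
    rintro ⟨i, j⟩
    by_cases hij : i = j
    · simp [hf, hij, hτ0]
    · have hk2 : AEStronglyMeasurable (Function.uncurry fun a b => k a b ^ 2) (F.prod F) :=
        hk.aestronglyMeasurable.pow 2
      have := integral_pair hk2 hij
      simp [hf, hij, this, hτ]
  -- Disjoint pairs contribute nothing and overlapping ones at most τ. Each of the four possible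
  -- coincidences of indices allows n³ choices, whence 4n³τ.
  have hterm : ∀ q r : ι × ι, ∫ x, f q x * f r x ∂(Measure.pi fun _ : ι => F) ≤
      ((if r.1 = q.1 then τ else 0) + (if r.1 = q.2 then τ else 0)) +
        ((if r.2 = q.1 then τ else 0) + (if r.2 = q.2 then τ else 0)) := by
    intro q r
    have hle : ∫ x, f q x * f r x ∂(Measure.pi fun _ : ι => F) ≤ τ := by
      calc _ ≤ ∫ x, (f q x ^ 2 + f r x ^ 2) / 2 ∂(Measure.pi fun _ : ι => F) := by
            refine integral_mono (hI q r)
              (((hmem q).integrable_sq.add (hmem r).integrable_sq).div_const 2) fun x => ?_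
            simp only
            nlinarith [sq_nonneg (f q x - f r x)]
        _ ≤ τ := by
            rw [integral_div, integral_add (hmem q).integrable_sq (hmem r).integrable_sq]
            linarith [hsq q, hsq r]
    have hn : ∀ P : Prop, ∀ [Decidable P], 0 ≤ if P then τ else 0 := fun P _ => by
      split_ifs <;> simp [hτ0]
    have n1 := hn (r.1 = q.1)
    have n2 := hn (r.1 = q.2)
    have n3 := hn (r.2 = q.1)
    have n4 := hn (r.2 = q.2)
    by_cases c1 : r.1 = q.1
    · rw [if_pos c1]; linarith
    by_cases c2 : r.1 = q.2
    · rw [if_pos c2]; linarith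
    by_cases c3 : r.2 = q.1
    · rw [if_pos c3]; linarith
    by_cases c4 : r.2 = q.2
    · rw [if_pos c4]; linarith
    simp only [c1, c2, c3, c4, if_false, add_zero]
    by_cases d1 : q.1 = q.2
    · simp [hf, d1]
    by_cases d2 : r.1 = r.2
    · simp [hf, d2]
    simp only [hf, d1, d2, if_false]
    exact (integral_pair_mul_pair_eq_zero_of_disjoint hsymm hk h0 d2 d1 c1 c2 c3 c4).le
  have e : ∀ x : ι → E, (∑ i, ∑ j, if i = j then 0 else k (x i) (x j)) ^ 2 =
      ∑ q, ∑ r, f q x * f r x := by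
    intro x
    rw [← Finset.sum_mul_sum, ← sq, Fintype.sum_prod_type]
  simp_rw [e]
  rw [integral_finsetSum _ fun q _ => integrable_finsetSum _ fun r _ => hI q r]
  calc _ = ∑ q, ∑ r, ∫ x, f q x * f r x ∂(Measure.pi fun _ : ι => F) :=
        Finset.sum_congr rfl fun q _ => integral_finsetSum _ fun r _ => hI q r
    _ ≤ ∑ q : ι × ι, ∑ r : ι × ι, (((if r.1 = q.1 then τ else 0) +
        (if r.1 = q.2 then τ else 0)) + ((if r.2 = q.1 then τ else 0) +
          (if r.2 = q.2 then τ else 0))) :=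
        Finset.sum_le_sum fun q _ => Finset.sum_le_sum fun r _ => hterm q r
    _ = _ := by
        have s1 : ∀ a : ι, ∑ r : ι × ι, (if r.1 = a then τ else 0) = Fintype.card ι * τ := by
          intro a; rw [Fintype.sum_prod_type_right]; simp
        have s2 : ∀ a : ι, ∑ r : ι × ι, (if r.2 = a then τ else 0) = Fintype.card ι * τ := by
          intro a; rw [Fintype.sum_prod_type]; simp
        simp_rw [Finset.sum_add_distrib, s1, s2]
        simp [Fintype.card_prod]
        ring

end UStatistic

/-! ### Algebra of U-centered matrices. -/

section UCentering

variable {ι : Type*} [Fintype ι] [DecidableEq ι]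

/-- The additive effects are absent on the diagonal. This makes the row coefficients N - 2 and N - 1
rather than N, and explains the denominators of U-centering. -/
lemma sum_uCentered {N : ℝ} (hN : N = Fintype.card ι) (D b : ι → ι → ℝ) (α : ι → ℝ) (γ : ℝ)
    (hD : ∀ k l, D k l = b k l + if k = l then 0 else α k + α l - γ) (k : ι) :
    ∑ l, D k l = ∑ l, b k l + (∑ l, α l) + (N - 2) * α k - (N - 1) * γ := by
  have e : ∀ l, D k l = b k l + (α k + α l - γ) - if k = l then 2 * α k - γ else 0 := by
    intro l
    rw [hD]
    split_ifs with h
    · subst h; ring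
    · ring
  simp_rw [e]
  rw [Finset.sum_sub_distrib, Finset.sum_add_distrib, Finset.sum_sub_distrib,
    Finset.sum_add_distrib]
  simp [← hN]
  ring

/-- The U-centering removes additive effects from a matrix of distances. -/
lemma uCentered_eq {N : ℝ} (hN : N = Fintype.card ι) (h1 : N - 1 ≠ 0) (h2 : N - 2 ≠ 0)
    (D b : ι → ι → ℝ) (hb : ∀ i j, b i j = b j i) (α : ι → ℝ) (γ : ℝ)
    (hD : ∀ k l, D k l = b k l + if k = l then 0 else α k + α l - γ) {k l : ι} (hkl : k ≠ l) :
    D k l - 1 / (N - 2) * ∑ i, D i l - 1 / (N - 2) * ∑ j, D k j +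
        1 / ((N - 1) * (N - 2)) * ∑ i, ∑ j, D i j =
      b k l - 1 / (N - 2) * (∑ j, b k j + ∑ j, b l j) +
        1 / ((N - 1) * (N - 2)) * ∑ i, ∑ j, b i j := by
  have hDs : ∀ i j, D i j = D j i := by
    intro i j
    rw [hD, hD, hb i j]
    by_cases h : i = j
    · simp [h]
    · rw [if_neg h, if_neg (Ne.symm h)]; ring
  rw [show ∑ i, D i l = ∑ j, D l j from Finset.sum_congr rfl fun i _ => hDs i l]
  simp_rw [sum_uCentered hN D b α γ hD]
  rw [Finset.sum_sub_distrib, Finset.sum_add_distrib, Finset.sum_add_distrib, ← Finset.mul_sum,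
    hD, if_neg hkl]
  simp only [Finset.sum_const, Finset.card_univ, nsmul_eq_mul, ← hN]
  field_simp
  ring

/-- Separates the main sum of squares from two corrections, in row sums and in the total, which are
of lower order for a degenerate kernel. -/
lemma sum_sq_uCentered {N : ℝ} (hN : N = Fintype.card ι) (h1 : N - 1 ≠ 0) (h2 : N - 2 ≠ 0)
    (b : ι → ι → ℝ) (hb : ∀ i j, b i j = b j i) (hb0 : ∀ i, b i i = 0) :
    ∑ q ∈ (Finset.univ : Finset (ι × ι)).filter (fun q => q.1 ≠ q.2),
      (b q.1 q.2 - 1 / (N - 2) * (∑ j, b q.1 j + ∑ j, b q.2 j) +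
        1 / ((N - 1) * (N - 2)) * ∑ i, ∑ j, b i j) ^ 2 =
      ∑ k, ∑ l, b k l ^ 2 - 2 / (N - 2) * ∑ k, (∑ j, b k j) ^ 2 +
        1 / ((N - 1) * (N - 2)) * (∑ i, ∑ j, b i j) ^ 2 := by
  set u := 1 / (N - 2) with hu
  set v := 1 / ((N - 1) * (N - 2)) with hv
  set r : ι → ℝ := fun k => ∑ j, b k j with hr
  set R := ∑ i, ∑ j, b i j with hR
  have hRr : R = ∑ i, r i := rfl
  set Q := ∑ k, (r k) ^ 2 with hQ
  rw [Finset.sum_filter, Fintype.sum_prod_type]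
  have e : ∀ k l, (if k ≠ l then (b k l - u * (r k + r l) + v * R) ^ 2 else 0) =
      (b k l ^ 2 + u ^ 2 * (r k ^ 2 + r l ^ 2) + (2 * u ^ 2) * (r k * r l) + v ^ 2 * R ^ 2
        - (2 * u) * (r k * b k l) - (2 * u) * (r l * b l k) + (2 * v * R) * b k l
        - (2 * u * v * R) * (r k + r l)) -
        if k = l then (2 * u * r k - v * R) ^ 2 else 0 := by
    intro k l
    by_cases h : k = l
    · subst h; simp [hb0]; ring
    · rw [if_pos h, if_neg h, hb l k]; ring
  have e' : ∀ k l, (if k ≠ l then (b k l - u * (∑ j, b k j + ∑ j, b l j) + v * R) ^ 2 else 0) = _ :=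
    e
  simp_rw [e', Finset.sum_sub_distrib, Finset.sum_add_distrib, Finset.sum_sub_distrib,
    Finset.sum_add_distrib]
  have s1 : ∑ k, r k * ∑ l, b k l = Q := by simp [hQ, hr, sq]
  have s2 : ∑ k, ∑ l, r l * b l k = Q := by rw [Finset.sum_comm, ← s1]; simp_rw [Finset.mul_sum]
  have s3 : ∑ k, r k * R = R ^ 2 := by rw [← Finset.sum_mul, ← hRr, sq]
  have s4 : ∑ k, (2 * u * r k - v * R) ^ 2 =
      4 * u ^ 2 * Q - 4 * u * v * R * R + N * (v ^ 2 * R ^ 2) := by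
    have : ∀ k, (2 * u * r k - v * R) ^ 2 =
        4 * u ^ 2 * r k ^ 2 - 4 * u * v * R * r k + v ^ 2 * R ^ 2 := fun k => by ring
    simp_rw [this, Finset.sum_add_distrib, Finset.sum_sub_distrib, ← Finset.mul_sum]
    simp [hN, hQ, ← hRr]
    ring
  simp_rw [Finset.sum_ite_eq, ← Finset.mul_sum]
  simp only [Finset.mem_univ, if_true, Finset.sum_add_distrib, Finset.sum_const, Finset.card_univ,
    nsmul_eq_mul, s1, s2, s3, s4, ← hN, ← Finset.mul_sum, ← hRr, ← hQ, ← hR]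
  rw [hu, hv]
  field_simp
  ring

end UCentering

/-! ### Ratio consistency of the distance variance estimator. -/

section RatioConsistency

variable {n p : ℕ} {F : Measure (Eucl p)}

/-- The off-diagonal weights that are all one. -/
def offDiagWeight (n : ℕ) (i j : Fin n) : ℝ := if i = j then 0 else 1

/-- Puts the distances in the form "kernel plus additive effects off the diagonal" on which
U-centering acts. -/
lemma norm_sub_eq_doubleCenteredDist (x : Fin n → Eucl p) (k l : Fin n) :
    ‖x k - x l‖ = offDiagWeight n k l * doubleCenteredDist F (x k) (x l) +
      if k = l then 0 else (∫ z, ‖x k - z‖ ∂F) + (∫ z, ‖x l - z‖ ∂F) -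
        ∫ z, ‖z.1 - z.2‖ ∂(F.prod F) := by
  by_cases h : k = l
  · subst h; simp [offDiagWeight]
  · simp only [offDiagWeight, h, if_false, doubleCenteredDist_eq]; ring

lemma offDiagWeight_self (i : Fin n) : offDiagWeight n i i = 0 := if_pos rfl

lemma offDiagWeight_comm (i j : Fin n) : offDiagWeight n i j = offDiagWeight n j i := by
  simp only [offDiagWeight, eq_comm]

/-- U-centering cannot distinguish distances from double centered distances, so the estimator
becomes an expression in the degenerate kernel alone. The bounds for linear parts and quadratic
forms then show that the last two terms are negligible. -/
lemma distVarHat_eq (hn : 4 ≤ n) (x : Fin n → Eucl p)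
    (hsymm : ∀ a b, doubleCenteredDist F a b = doubleCenteredDist F b a) :
    distVarHat x = 1 / ((n : ℝ) * ((n : ℝ) - 3)) *
      (∑ k, ∑ l, (offDiagWeight n k l * doubleCenteredDist F (x k) (x l)) ^ 2
        - 2 / ((n : ℝ) - 2) * ∑ k, linearPart (offDiagWeight n) (doubleCenteredDist F) k x ^ 2
        + 1 / (((n : ℝ) - 1) * ((n : ℝ) - 2)) *
          (2 * quadForm (offDiagWeight n) (doubleCenteredDist F) x) ^ 2) := by
  have hn' : (4 : ℝ) ≤ n := by exact_mod_cast hn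
  have hN : (n : ℝ) = Fintype.card (Fin n) := by simp
  have h1 : (n : ℝ) - 1 ≠ 0 := by linarith
  have h2 : (n : ℝ) - 2 ≠ 0 := by linarith
  have hb : ∀ i j : Fin n, offDiagWeight n i j * doubleCenteredDist F (x i) (x j) =
      offDiagWeight n j i * doubleCenteredDist F (x j) (x i) := fun i j => by
    rw [offDiagWeight_comm, hsymm]
  have hb0 : ∀ i : Fin n, offDiagWeight n i i * doubleCenteredDist F (x i) (x i) = 0 := fun i => by
    rw [offDiagWeight_self, zero_mul]
  have key := sum_sq_uCentered hN h1 h2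
    (fun i j => offDiagWeight n i j * doubleCenteredDist F (x i) (x j)) hb hb0
  rw [distVarHat]
  congr 1
  have e : (2 * quadForm (offDiagWeight n) (doubleCenteredDist F) x) =
      ∑ i, ∑ j, offDiagWeight n i j * doubleCenteredDist F (x i) (x j) := by
    simp only [quadForm, linearPart]; ring
  rw [e]
  simp only [linearPart]
  rw [← key]
  refine Finset.sum_congr rfl fun q hq => ?_
  have hq' : q.1 ≠ q.2 := by simpa using hq
  congr 1
  exact uCentered_eq hN h1 h2 (fun i j => ‖x i - x j‖)
    (fun i j => offDiagWeight n i j * doubleCenteredDist F (x i) (x j)) hb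
    (fun i => ∫ z, ‖x i - z‖ ∂F) (∫ z, ‖z.1 - z.2‖ ∂(F.prod F))
    (norm_sub_eq_doubleCenteredDist x) hq'

lemma four_mul_div_le {N : ℝ} (hN : 6 ≤ N) : 4 * N / ((N - 2) * (N - 3)) ≤ 16 / N := by
  have h : 0 ≤ (N - 6) * (3 * N - 2) := mul_nonneg (by linarith) (by linarith)
  rw [div_le_div_iff₀ (mul_pos (by linarith) (by linarith)) (by linarith)]
  linarith

lemma two_mul_div_le {N : ℝ} (hN : 6 ≤ N) :
    2 * N / ((N - 1) * ((N - 2) * (N - 3))) ≤ 16 / N := by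
  have hX : 0 < (N - 2) * (N - 3) := mul_pos (by linarith) (by linarith)
  refine le_trans ?_ (four_mul_div_le hN)
  refine div_le_div₀ (by linarith) (by linarith) hX ?_
  exact le_mul_of_one_le_left hX.le (by linarith)

lemma sum_offDiagWeight_sq_le : ∑ i, ∑ j, offDiagWeight n i j ^ 2 ≤ (n : ℝ) ^ 2 := by
  calc _ ≤ ∑ _i : Fin n, ∑ _j : Fin n, (1 : ℝ) :=
        Finset.sum_le_sum fun i _ => Finset.sum_le_sum fun j _ => by
          unfold offDiagWeight; split_ifs <;> simp
    _ = _ := by simp [sq]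

variable [IsProbabilityMeasure F]

omit [IsProbabilityMeasure F] in
lemma centeredMoment_four_nonneg : 0 ≤ centeredMoment F 4 :=
  integral_nonneg fun _ => by positivity

set_option maxHeartbeats 800000 in
/-- The estimator `distVarHat` is ratio consistent. -/
lemma integral_abs_distVarHat_div_sub_one_le (hF : Integrable (fun x => ‖x‖ ^ 4) F)
    (hpos : 0 < centeredMoment F 2) (hn : 6 ≤ n) {ε : ℝ} (hε : 0 < ε) :
    Integrable (fun x : Fin n → Eucl p => distVarHat x / centeredMoment F 2 - 1)
        (Measure.pi fun _ => F) ∧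
      ∫ x : Fin n → Eucl p, |distVarHat x / centeredMoment F 2 - 1| ∂(Measure.pi fun _ => F) ≤
        (ε + ε⁻¹ * (16 * (centeredMoment F 4 / (n * centeredMoment F 2 ^ 2)))) / 2 + 36 / n := by
  have hh := isDegenerateKernel_doubleCenteredDist hF
  set τ := centeredMoment F 2 with hτ
  set q4 := centeredMoment F 4 with hq4
  have hq40 : 0 ≤ q4 := centeredMoment_four_nonneg
  set h := doubleCenteredDist F with hdef
  have hn' : (6 : ℝ) ≤ n := by exact_mod_cast hn
  have hd0 : ∀ i, offDiagWeight n i i = 0 := offDiagWeight_self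
  have hτ2 : ∫ z, h z.1 z.2 ^ 2 ∂(F.prod F) = τ := rfl
  have hτ4 : ∫ z, h z.1 z.2 ^ 4 ∂(F.prod F) = q4 := rfl
  have i2 : Integrable (fun z : Eucl p × Eucl p => h z.1 z.2 ^ 2) (F.prod F) :=
    (memLp_two_of_four hh.memLp).integrable_sq
  have i4 : Integrable (fun z : Eucl p × Eucl p => h z.1 z.2 ^ 4) (F.prod F) :=
    integrable_pow_four hh.memLp
  -- the centered U-statistic of the squares
  set k : Eucl p → Eucl p → ℝ := fun a b => h a b ^ 2 - τ with hk
  have hm : MemLp (fun z : Eucl p × Eucl p => h z.1 z.2 ^ 2) 2 (F.prod F) := by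
    simp_rw [sq]; exact memLp_two_mul hh.memLp hh.memLp
  have hkm : MemLp (Function.uncurry k) 2 (F.prod F) := hm.sub (memLp_const τ)
  have hk0 : ∫ z, k z.1 z.2 ∂(F.prod F) = 0 := by
    simp only [hk]
    rw [integral_sub i2 (integrable_const _), hτ2]
    simp
  have hksq : ∫ z, k z.1 z.2 ^ 2 ∂(F.prod F) ≤ q4 := by
    have e : ∀ z : Eucl p × Eucl p, k z.1 z.2 ^ 2 =
        h z.1 z.2 ^ 4 - 2 * τ * h z.1 z.2 ^ 2 + τ ^ 2 := fun z => by simp only [hk]; ring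
    simp_rw [e]
    have i5 := i2.const_mul (2 * τ)
    have i6 : Integrable (fun z : Eucl p × Eucl p => h z.1 z.2 ^ 4 - 2 * τ * h z.1 z.2 ^ 2)
      (F.prod F) := i4.sub i5
    rw [integral_add i6 (integrable_const _), integral_sub i4 i5, integral_const_mul, hτ2, hτ4]
    simp only [integral_const, probReal_univ, one_smul]
    nlinarith
  set G : (Fin n → Eucl p) → ℝ := fun x => ∑ i, ∑ j, if i = j then 0 else k (x i) (x j) with hG
  have hGm : MemLp G 2 (Measure.pi fun _ => F) := by
    refine memLp_finsetSum _ fun i _ => memLp_finsetSum _ fun j _ => ?_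
    by_cases hij : i = j
    · simp [hij]
    · simpa [hij] using memLp_pair hkm hij
  have hGsq : ∫ x, G x ^ 2 ∂(Measure.pi fun _ => F) ≤ 4 * (n : ℝ) ^ 3 * q4 := by
    refine (integral_sq_sum_pair_le_of_centered (fun a b => by simp only [hk, hh.symm a b]) hkm
      hk0).trans ?_
    rw [Fintype.card_fin]
    exact mul_le_mul_of_nonneg_left hksq (by positivity)
  set D : ℝ := n * (n - 3) * τ with hD
  have hDpos : 0 < D := by
    have : (0 : ℝ) < n - 3 := by linarith
    have : (0 : ℝ) < n := by linarith
    positivity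
  set Q : (Fin n → Eucl p) → ℝ := fun x => ∑ k, linearPart (offDiagWeight n) h k x ^ 2 with hQ
  set S : (Fin n → Eucl p) → ℝ := quadForm (offDiagWeight n) h with hS
  have hSm : MemLp S 2 (Measure.pi fun _ => F) := memLp_two_of_four (memLp_quadForm hh hd0)
  have iQ : Integrable Q (Measure.pi fun _ => F) := integrable_finsetSum _ fun k _ =>
    (memLp_two_of_four (memLp_linearPart hh hd0 k)).integrable_sq
  have hQle : ∫ x, Q x ∂(Measure.pi fun _ => F) ≤ 2 * (n : ℝ) ^ 2 * τ := by
    rw [integral_finsetSum _ fun k _ =>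
      (memLp_two_of_four (memLp_linearPart hh hd0 k)).integrable_sq]
    refine (Finset.sum_le_sum fun i _ => integral_linearPart_sq_le hh hd0 i).trans ?_
    rw [← Finset.sum_mul, ← Finset.mul_sum, hτ2]
    exact mul_le_mul_of_nonneg_right (mul_le_mul_of_nonneg_left sum_offDiagWeight_sq_le
      two_pos.le) hpos.le
  have hSle : ∫ x, S x ^ 2 ∂(Measure.pi fun _ => F) ≤ (n : ℝ) ^ 2 / 2 * τ := by
    refine (integral_quadForm_sq_le hh hd0).trans ?_
    rw [hτ2]
    exact mul_le_mul_of_nonneg_right (div_le_div_of_nonneg_right sum_offDiagWeight_sq_le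
      two_pos.le) hpos.le
  have n1 : (0 : ℝ) < n - 1 := by linarith
  have n2 : (0 : ℝ) < n - 2 := by linarith
  have n3 : (0 : ℝ) < n - 3 := by linarith
  have n0 : (0 : ℝ) < n := by linarith
  set c1 : ℝ := 2 / ((n - 2) * D) with hc1
  set c2 : ℝ := 4 / ((n - 1) * (n - 2) * D) with hc2
  have hc10 : 0 ≤ c1 := by positivity
  have hc20 : 0 ≤ c2 := by positivity
  -- The off-diagonal mean contributes n(n - 1)τ, and n(n - 1)/(n(n - 3)) - 1 = 2/(n - 3) is the
  -- bias left by the normalization.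
  have hdecomp : ∀ x : Fin n → Eucl p, distVarHat x / τ - 1 =
      G x / D + 2 / (n - 3) - c1 * Q x + c2 * S x ^ 2 := by
    intro x
    have hsum : ∑ k, ∑ l, (offDiagWeight n k l * h (x k) (x l)) ^ 2 =
        G x + n * (n - 1) * τ := by
      have e : ∀ i j : Fin n, (offDiagWeight n i j * h (x i) (x j)) ^ 2 =
          (if i = j then 0 else k (x i) (x j)) + τ - if i = j then τ else 0 := by
        intro i j
        by_cases hij : i = j
        · simp [offDiagWeight, hij]
        · simp [offDiagWeight, hij, hk]
      simp_rw [e, Finset.sum_sub_distrib, Finset.sum_add_distrib]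
      simp only [Finset.sum_const, Finset.card_univ, Fintype.card_fin, nsmul_eq_mul,
        Finset.sum_ite_eq, Finset.mem_univ, if_true]
      simp only [hG]
      ring
    rw [distVarHat_eq (by omega) x hh.symm, hsum]
    simp only [hc1, hc2, hD, hQ, hS]
    field_simp
    ring
  have iG : Integrable (fun x => G x / D) (Measure.pi fun _ => F) :=
    (hGm.integrable one_le_two).div_const D
  have i5 := iQ.const_mul c1
  have i6 := hSm.integrable_sq.const_mul c2
  have i7 : Integrable (fun x => G x / D + 2 / ((n : ℝ) - 3)) (Measure.pi fun _ => F) :=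
    iG.add (integrable_const _)
  have i8 : Integrable (fun x => G x / D + 2 / ((n : ℝ) - 3) - c1 * Q x)
    (Measure.pi fun _ => F) := i7.sub i5
  have i9 : Integrable (fun x => G x / D + 2 / ((n : ℝ) - 3) - c1 * Q x + c2 * S x ^ 2)
    (Measure.pi fun _ => F) := i8.add i6
  simp_rw [hdecomp]
  refine ⟨i9, ?_⟩
  have iGa := iG.abs
  have j1 : Integrable (fun x => |G x / D| + 2 / ((n : ℝ) - 3)) (Measure.pi fun _ => F) :=
    iGa.add (integrable_const _)
  have j2 : Integrable (fun x => |G x / D| + 2 / ((n : ℝ) - 3) + c1 * Q x)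
    (Measure.pi fun _ => F) := j1.add i5
  have j3 : Integrable (fun x => |G x / D| + 2 / ((n : ℝ) - 3) + c1 * Q x + c2 * S x ^ 2)
    (Measure.pi fun _ => F) := j2.add i6
  have step1 : ∫ x, |G x / D + 2 / ((n : ℝ) - 3) - c1 * Q x + c2 * S x ^ 2|
      ∂(Measure.pi fun _ => F) ≤
      (∫ x, |G x / D| ∂(Measure.pi fun _ => F)) + 2 / ((n : ℝ) - 3) +
        c1 * (∫ x, Q x ∂(Measure.pi fun _ => F)) +
        c2 * ∫ x, S x ^ 2 ∂(Measure.pi fun _ => F) := by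
    calc _ ≤ ∫ x, (|G x / D| + 2 / ((n : ℝ) - 3) + c1 * Q x + c2 * S x ^ 2)
          ∂(Measure.pi fun _ => F) := by
          refine integral_mono i9.abs j3 fun x => ?_
          have hQ0 : 0 ≤ c1 * Q x :=
            mul_nonneg hc10 (Finset.sum_nonneg fun _ _ => sq_nonneg _)
          have hS0 : 0 ≤ c2 * S x ^ 2 := by positivity
          have h30 : 0 ≤ 2 / ((n : ℝ) - 3) := by positivity
          have g1 := le_abs_self (G x / D)
          have g2 := neg_abs_le (G x / D)
          simp only
          rw [abs_le]
          constructor <;> linarith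
      _ = _ := by
          rw [integral_add j2 i6, integral_add j1 i5, integral_add iGa (integrable_const _),
            integral_const_mul, integral_const_mul]
          simp
  have step2 : ∫ x, |G x / D| ∂(Measure.pi fun _ => F) ≤
      (ε + ε⁻¹ * (16 * (q4 / (n * τ ^ 2)))) / 2 := by
    have hm' : MemLp (fun x => G x / D) 2 (Measure.pi fun _ => F) := by
      simp_rw [div_eq_mul_inv]; exact hGm.mul_const _
    refine (integral_abs_le_of_sq hm' hε).trans ?_
    have : ∫ x, (G x / D) ^ 2 ∂(Measure.pi fun _ => F) ≤ 16 * (q4 / (n * τ ^ 2)) := by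
      simp_rw [div_pow]
      rw [integral_div, div_le_iff₀ (by positivity)]
      refine hGsq.trans ?_
      have e : 16 * (q4 / (n * τ ^ 2)) * D ^ 2 = 16 * q4 * (n * (n - 3) ^ 2) := by
        simp only [hD]; field_simp
      rw [e]
      have h2 : (n : ℝ) ^ 2 ≤ (2 * (n - 3)) ^ 2 := pow_le_pow_left₀ n0.le (by linarith) 2
      linarith [mul_le_mul_of_nonneg_left h2 (mul_nonneg hq40 n0.le)]
    have hεi := inv_pos.2 hε
    have := mul_le_mul_of_nonneg_left this hεi.le
    linarith
  have step3 : 2 / ((n : ℝ) - 3) ≤ 4 / n := by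
    rw [div_le_div_iff₀ n3 n0]; linarith
  have step4 : c1 * (∫ x, Q x ∂(Measure.pi fun _ => F)) ≤ 16 / n := by
    refine (mul_le_mul_of_nonneg_left hQle hc10).trans ?_
    have e : c1 * (2 * (n : ℝ) ^ 2 * τ) = 4 * n / ((n - 2) * (n - 3)) := by
      simp only [hc1, hD]; field_simp; ring
    rw [e]
    exact four_mul_div_le hn'
  have step5 : c2 * (∫ x, S x ^ 2 ∂(Measure.pi fun _ => F)) ≤ 16 / n := by
    refine (mul_le_mul_of_nonneg_left hSle hc20).trans ?_
    have e : c2 * ((n : ℝ) ^ 2 / 2 * τ) = 2 * n / ((n - 1) * ((n - 2) * (n - 3))) := by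
      simp only [hc2, hD]; field_simp; ring
    rw [e]
    exact two_mul_div_le hn'
  calc _ ≤ _ := step1
    _ ≤ (ε + ε⁻¹ * (16 * (q4 / (n * τ ^ 2)))) / 2 + 4 / n + 16 / n + 16 / n :=
        add_le_add (add_le_add (add_le_add step2 step3) step4) step5
    _ = _ := by ring

end RatioConsistency

/-! ### The Gini covariance as a degenerate quadratic form and the size of its weights. -/

section ClassWeights

variable {n p K : ℕ} {F : Measure (Eucl p)}

/-- The weights of the Gini covariance as a U-statistic in the centered distances. -/
noncomputable def classWeight (y : Fin n → Fin K) (i j : Fin n) : ℝ :=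
  if i = j then 0 else
    2 * (1 / ((n : ℝ) * (n - 1)) -
      if y i = y j then 1 / ((n : ℝ) * ((classSize y (y i) : ℝ) - 1)) else 0)

/-- The variance factor of the Gini covariance. -/
noncomputable def varFactor (y : Fin n → Fin K) : ℝ :=
  (∑ k, pHat y k ^ 2 * (((classSize y k).choose 2 : ℕ) : ℝ)⁻¹) - ((n.choose 2 : ℕ) : ℝ)⁻¹

lemma classWeight_self (y : Fin n → Fin K) (i : Fin n) : classWeight y i i = 0 := if_pos rfl

lemma classWeight_comm (y : Fin n → Fin K) (i j : Fin n) :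
    classWeight y i j = classWeight y j i := by
  unfold classWeight
  by_cases h : i = j
  · simp [h]
  · rw [if_neg h, if_neg (Ne.symm h)]
    by_cases hy : y i = y j
    · rw [if_pos hy, if_pos hy.symm, hy]
    · rw [if_neg hy, if_neg (Ne.symm hy)]

lemma sum_classIndices (y : Fin n → Fin K) (f : Fin n → ℝ) :
    ∑ k, ∑ i ∈ classIndices y k, f i = ∑ i, f i :=
  Finset.sum_fiberwise Finset.univ y f

lemma sum_classSize (y : Fin n → Fin K) : ∑ k, (classSize y k : ℝ) = n := by
  have := sum_classIndices y fun _ => 1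
  simpa [classSize] using this

lemma sum_sum_classIndices (y : Fin n → Fin K) (f : Fin n → Fin n → ℝ) (c : Fin K → ℝ) :
    ∑ k, c k * ∑ i ∈ classIndices y k, ∑ j ∈ classIndices y k, f i j =
      ∑ i, ∑ j, if y i = y j then c (y i) * f i j else 0 := by
  rw [← sum_classIndices y fun i => ∑ j, if y i = y j then c (y i) * f i j else 0]
  refine Finset.sum_congr rfl fun k _ => ?_
  rw [Finset.mul_sum]
  refine Finset.sum_congr rfl fun i hi => ?_
  have hk : y i = k := by simpa [classIndices] using hi
  rw [Finset.mul_sum, classIndices, Finset.sum_filter]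
  refine Finset.sum_congr rfl fun j _ => ?_
  simp only [hk, eq_comm (a := k)]

lemma two_mul_sum_lt {f : Fin n → Fin n → ℝ} (hf : ∀ i j, f i j = f j i) (hf0 : ∀ i, f i i = 0)
    (s : Finset (Fin n)) :
    2 * ∑ q ∈ (s ×ˢ s).filter (fun q => q.1 < q.2), f q.1 q.2 = ∑ i ∈ s, ∑ j ∈ s, f i j := by
  have e : ∀ i j, f i j = (if i < j then f i j else 0) + if j < i then f j i else 0 := by
    intro i j
    rcases lt_trichotomy i j with h | h | h
    · simp [h, h.not_gt]
    · subst h; simp [hf0]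
    · simp [h, h.not_gt, hf i j]
  rw [Finset.sum_filter, Finset.sum_product, Finset.sum_congr rfl fun i _ =>
    Finset.sum_congr rfl fun j _ => e i j]
  simp_rw [Finset.sum_add_distrib]
  rw [Finset.sum_comm (f := fun i j => if j < i then f j i else 0)]
  ring

lemma choose_two_eq (c : ℕ) : ((c.choose 2 : ℕ) : ℝ) = c * (c - 1) / 2 := Nat.cast_choose_two ℝ c

/-- The Hoeffding decomposition over an arbitrary index set: a degenerate part, a linear part and a
constant. -/
lemma giniMeanDiff_eq (x : Fin n → Eucl p) (s : Finset (Fin n)) (hs : 2 ≤ s.card) :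
    giniMeanDiff x s = 1 / ((s.card : ℝ) * (s.card - 1)) *
        (∑ i ∈ s, ∑ j ∈ s, offDiagWeight n i j * doubleCenteredDist F (x i) (x j)) +
      2 / s.card * (∑ i ∈ s, ∫ z, ‖x i - z‖ ∂F) - ∫ z, ‖z.1 - z.2‖ ∂(F.prod F) := by
  have hc : (2 : ℝ) ≤ s.card := by exact_mod_cast hs
  have hc0 : (s.card : ℝ) ≠ 0 := by linarith
  have hc1 : (s.card : ℝ) - 1 ≠ 0 := by linarith
  set α : Fin n → ℝ := fun i => ∫ z, ‖x i - z‖ ∂F with hα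
  set γ := ∫ z, ‖z.1 - z.2‖ ∂(F.prod F) with hγ
  have h2 := two_mul_sum_lt (f := fun i j => ‖x i - x j‖) (fun i j => norm_sub_rev _ _)
    (fun i => by simp) s
  have e : ∀ i j, ‖x i - x j‖ = offDiagWeight n i j * doubleCenteredDist F (x i) (x j) +
      (α i + α j - γ) - if i = j then 2 * α i - γ else 0 := by
    intro i j
    rw [norm_sub_eq_doubleCenteredDist (F := F)]
    by_cases h : i = j
    · subst h; simp only [if_true]; ring
    · simp [h, hα, hγ]
  have h3 : ∑ i ∈ s, ∑ j ∈ s, ‖x i - x j‖ =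
      (∑ i ∈ s, ∑ j ∈ s, offDiagWeight n i j * doubleCenteredDist F (x i) (x j)) +
        2 * (s.card - 1) * (∑ i ∈ s, α i) - s.card * (s.card - 1) * γ := by
    rw [Finset.sum_congr rfl fun i _ => Finset.sum_congr rfl fun j _ => e i j]
    simp_rw [Finset.sum_sub_distrib, Finset.sum_add_distrib, Finset.sum_sub_distrib,
      Finset.sum_add_distrib, Finset.sum_ite_eq]
    have h4 : ∑ i ∈ s, (if i ∈ s then 2 * α i - γ else 0) = ∑ i ∈ s, (2 * α i - γ) :=
      Finset.sum_congr rfl fun i hi => if_pos hi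
    rw [h4, Finset.sum_sub_distrib, ← Finset.mul_sum]
    simp only [Finset.sum_const, nsmul_eq_mul, ← Finset.mul_sum]
    ring
  have h5 : ∑ q ∈ (s ×ˢ s).filter (fun q => q.1 < q.2), ‖x q.1 - x q.2‖ =
      (∑ i ∈ s, ∑ j ∈ s, ‖x i - x j‖) / 2 := by linarith
  rw [giniMeanDiff, h5, h3, choose_two_eq]
  field_simp

/-- The Gini covariance is a degenerate U-statistic in the centered distances. -/
lemma gCovSample_eq (x : Fin n → Eucl p) (y : Fin n → Fin K) (hn : 2 ≤ n)
    (hy : ∀ k, 2 ≤ classSize y k) :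
    gCovSample x y = quadForm (classWeight y) (doubleCenteredDist F) x := by
  have hn' : (2 : ℝ) ≤ n := by exact_mod_cast hn
  have hy' : ∀ k, (2 : ℝ) ≤ classSize y k := fun k => by exact_mod_cast hy k
  set α : Fin n → ℝ := fun i => ∫ z, ‖x i - z‖ ∂F with hα
  set γ := ∫ z, ‖z.1 - z.2‖ ∂(F.prod F) with hγ
  set b : Fin n → Fin n → ℝ := fun i j =>
    offDiagWeight n i j * doubleCenteredDist F (x i) (x j) with hb
  have h1 : deltaHat x = 1 / ((n : ℝ) * (n - 1)) * (∑ i, ∑ j, b i j) + 2 / n * (∑ i, α i) - γ := by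
    have := giniMeanDiff_eq (F := F) x Finset.univ (by simpa using hn)
    rw [Finset.card_univ, Fintype.card_fin] at this
    exact this
  -- Multiplication by n_k/n gives the linear part the same coefficient 2/n in every class. Summed
  -- over classes, linear parts and constants match those of `deltaHat` and cancel.
  have h2 : ∀ k, pHat y k * deltaHatClass x y k =
      1 / ((n : ℝ) * (classSize y k - 1)) *
        (∑ i ∈ classIndices y k, ∑ j ∈ classIndices y k, b i j) +
      2 / n * (∑ i ∈ classIndices y k, α i) - classSize y k * (γ / n) := by
    intro k
    rw [deltaHatClass, giniMeanDiff_eq (F := F) x (classIndices y k) (hy k), pHat]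
    change _ / _ * (1 / ((classSize y k : ℝ) * (classSize y k - 1)) * _ +
      2 / (classSize y k : ℝ) * _ - _) = _
    have c1 : (classSize y k : ℝ) ≠ 0 := by linarith [hy' k]
    have c2 : (classSize y k : ℝ) - 1 ≠ 0 := by linarith [hy' k]
    have c3 : (n : ℝ) ≠ 0 := by linarith
    field_simp
    rfl
  rw [gCovSample, h1]
  simp_rw [h2]
  rw [Finset.sum_sub_distrib, Finset.sum_add_distrib, ← Finset.mul_sum, ← Finset.sum_mul,
    sum_classIndices, sum_classSize, sum_sum_classIndices y b fun k =>
      1 / ((n : ℝ) * (classSize y k - 1))]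
  have h3 : ∀ i j, classWeight y i j * doubleCenteredDist F (x i) (x j) =
      2 * (1 / ((n : ℝ) * (n - 1)) * b i j -
        if y i = y j then 1 / ((n : ℝ) * (classSize y (y i) - 1)) * b i j else 0) := by
    intro i j
    by_cases hij : i = j
    · simp [hij, classWeight, hb, offDiagWeight]
    · by_cases hyij : y i = y j
      · simp [hij, hyij, classWeight, hb, offDiagWeight]; ring
      · simp [hij, hyij, classWeight, hb, offDiagWeight]; ring
  simp only [quadForm, linearPart]
  simp_rw [h3, ← Finset.mul_sum, Finset.sum_sub_distrib, ← Finset.mul_sum]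
  have c3 : (n : ℝ) ≠ 0 := by linarith
  field_simp
  ring

lemma varFactor_eq (y : Fin n → Fin K) (hn : 2 ≤ n) (hy : ∀ k, 2 ≤ classSize y k) :
    varFactor y = 2 * ((∑ k, (classSize y k : ℝ) / ((n : ℝ) ^ 2 * (classSize y k - 1))) -
      1 / ((n : ℝ) * (n - 1))) := by
  have hn' : (2 : ℝ) ≤ n := by exact_mod_cast hn
  have hy' : ∀ k, (2 : ℝ) ≤ classSize y k := fun k => by exact_mod_cast hy k
  have c3 : (n : ℝ) ≠ 0 := by linarith
  have c4 : (n : ℝ) - 1 ≠ 0 := by linarith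
  rw [varFactor, mul_sub, Finset.mul_sum]
  congr 1
  · refine Finset.sum_congr rfl fun k _ => ?_
    have c1 : (classSize y k : ℝ) ≠ 0 := by linarith [hy' k]
    have c2 : (classSize y k : ℝ) - 1 ≠ 0 := by linarith [hy' k]
    rw [pHat, choose_two_eq]
    field_simp
  · rw [choose_two_eq]; field_simp

/-- Identifies the deterministic factor in σ̂₀² with half the sum of squared weights; this is the
normalization needed for a limiting variance of one. -/
lemma sum_classWeight_sq (y : Fin n → Fin K) (hn : 2 ≤ n) (hy : ∀ k, 2 ≤ classSize y k) :
    ∑ i, ∑ j, classWeight y i j ^ 2 = 2 * varFactor y := by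
  have hn' : (2 : ℝ) ≤ n := by exact_mod_cast hn
  have hy' : ∀ k, (2 : ℝ) ≤ classSize y k := fun k => by exact_mod_cast hy k
  have c3 : (n : ℝ) ≠ 0 := by linarith
  have c4 : (n : ℝ) - 1 ≠ 0 := by linarith
  set g : ℝ := 1 / ((n : ℝ) * (n - 1)) with hg
  set c : Fin K → ℝ := fun k => 1 / ((n : ℝ) * (classSize y k - 1)) with hc
  have e : ∀ i j, classWeight y i j ^ 2 = 4 * (g ^ 2 * offDiagWeight n i j +
      if y i = y j then (c (y i) ^ 2 - 2 * g * c (y i)) * offDiagWeight n i j else 0) := by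
    intro i j
    by_cases hij : i = j
    · simp [hij, classWeight, offDiagWeight]
    · by_cases hyij : y i = y j
      · simp only [classWeight, hij, offDiagWeight, if_false, hyij, if_true, hg, hc]; ring
      · simp only [classWeight, hij, offDiagWeight, if_false, hyij, hg, hc]; ring
  have hoff : ∀ s : Finset (Fin n), ∑ i ∈ s, ∑ j ∈ s, offDiagWeight n i j =
      (s.card : ℝ) * (s.card - 1) := by
    intro s
    have : ∀ i j, offDiagWeight n i j = 1 - if i = j then 1 else 0 := by
      intro i j; unfold offDiagWeight; split_ifs <;> simp
    simp_rw [this, Finset.sum_sub_distrib, Finset.sum_ite_eq]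
    have h4 : ∑ i ∈ s, (if i ∈ s then (1 : ℝ) else 0) = ∑ i ∈ s, 1 :=
      Finset.sum_congr rfl fun i hi => if_pos hi
    rw [h4]
    simp
    ring
  simp_rw [e, ← Finset.mul_sum, Finset.sum_add_distrib, ← Finset.mul_sum]
  rw [← sum_sum_classIndices y (offDiagWeight n) fun k => c k ^ 2 - 2 * g * c k]
  simp_rw [hoff]
  have h5 : ∀ k, (c k ^ 2 - 2 * g * c k) * (((classIndices y k).card : ℝ) *
      ((classIndices y k).card - 1)) =
      (classSize y k : ℝ) / ((n : ℝ) ^ 2 * (classSize y k - 1)) - (classSize y k : ℝ) *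
        (2 * g / n) := by
    intro k
    change _ * ((classSize y k : ℝ) * (classSize y k - 1)) = _
    have c2 : (classSize y k : ℝ) - 1 ≠ 0 := by linarith [hy' k]
    simp only [hc]
    field_simp
  simp_rw [h5]
  rw [Finset.sum_sub_distrib, ← Finset.sum_mul, sum_classSize, varFactor_eq y hn hy]
  simp only [Finset.card_univ, Fintype.card_fin, hg]
  field_simp
  ring

/-- Each class contributes at least 1/n² to the first sum, since n_k/(n_k - 1) ≥ 1. Two classes
already outweigh 1/(n(n - 1)); with a single class the factor would be zero. -/
lemma le_varFactor (hK : 2 ≤ K) (y : Fin n → Fin K) (hn : 3 ≤ n) (hy : ∀ k, 2 ≤ classSize y k) :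
    1 / (n : ℝ) ^ 2 ≤ varFactor y := by
  have hn' : (3 : ℝ) ≤ n := by exact_mod_cast hn
  have hK' : (2 : ℝ) ≤ K := by exact_mod_cast hK
  have hy' : ∀ k, (2 : ℝ) ≤ classSize y k := fun k => by exact_mod_cast hy k
  have c0 : (0 : ℝ) < n := by linarith
  have c1 : (0 : ℝ) < n - 1 := by linarith
  rw [varFactor_eq y (by omega) hy]
  have h1 : 2 / (n : ℝ) ^ 2 ≤ ∑ k, (classSize y k : ℝ) / ((n : ℝ) ^ 2 * (classSize y k - 1)) := by
    calc 2 / (n : ℝ) ^ 2 ≤ K * (1 / (n : ℝ) ^ 2) := by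
          rw [mul_one_div]; exact div_le_div_of_nonneg_right hK' (by positivity)
      _ = ∑ _k : Fin K, 1 / (n : ℝ) ^ 2 := by simp
      _ ≤ _ := by
          refine Finset.sum_le_sum fun k _ => ?_
          have d1 : (0 : ℝ) < classSize y k - 1 := by linarith [hy' k]
          rw [div_le_div_iff₀ (by positivity) (by positivity)]
          have : (0 : ℝ) ≤ (n : ℝ) ^ 2 := by positivity
          nlinarith
  -- The constant 3/2 bounds n/(n - 1) once n ≥ 3.
  have h2 : 1 / ((n : ℝ) * (n - 1)) ≤ 3 / 2 / (n : ℝ) ^ 2 := by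
    rw [div_le_div_iff₀ (by positivity) (by positivity)]
    nlinarith
  have h3 : 2 * (2 / (n : ℝ) ^ 2 - 3 / 2 / (n : ℝ) ^ 2) = 1 / (n : ℝ) ^ 2 := by ring
  linarith

/-- With proportions bounded below, n_k - 1 ≥ n_k/2 is of order n, so every weight is O(n⁻²).
Against a standard deviation of order at least 1/n, no single weight dominates. -/
lemma abs_classWeight_le (y : Fin n → Fin K) (hn : 2 ≤ n) (hy : ∀ k, 2 ≤ classSize y k) {c : ℝ}
    (hc : 0 < c) (hcy : ∀ k, c ≤ pHat y k) (i j : Fin n) :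
    |classWeight y i j| ≤ 4 / (c * (n : ℝ) ^ 2) := by
  have hn' : (2 : ℝ) ≤ n := by exact_mod_cast hn
  have hy' : ∀ k, (2 : ℝ) ≤ classSize y k := fun k => by exact_mod_cast hy k
  have c0 : (0 : ℝ) < n := by linarith
  have c1 : (0 : ℝ) < n - 1 := by linarith
  have hpos : 0 ≤ 4 / (c * (n : ℝ) ^ 2) := by positivity
  have hle : ∀ k, (classSize y k : ℝ) ≤ n := fun k => by
    rw [← sum_classSize y]
    exact Finset.single_le_sum (f := fun k => (classSize y k : ℝ)) (fun _ _ => by positivity)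
      (Finset.mem_univ k)
  have hc1 : c ≤ 1 := (hcy (y i)).trans (by rw [pHat, div_le_one c0]; exact hle _)
  have h1 : 2 * (1 / ((n : ℝ) * (n - 1))) ≤ 4 / (c * (n : ℝ) ^ 2) := by
    rw [mul_one_div, div_le_div_iff₀ (by positivity) (by positivity)]
    have h6 : c * (n : ℝ) ^ 2 ≤ 1 * (n : ℝ) ^ 2 := mul_le_mul_of_nonneg_right hc1 (by positivity)
    nlinarith
  have h1' : 0 ≤ 2 * (1 / ((n : ℝ) * (n - 1))) := by positivity
  have d1 : (0 : ℝ) < classSize y (y i) - 1 := by linarith [hy' (y i)]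
  have h2 : 2 * (1 / ((n : ℝ) * (classSize y (y i) - 1))) ≤ 4 / (c * (n : ℝ) ^ 2) := by
    rw [mul_one_div, div_le_div_iff₀ (by positivity) (by positivity)]
    have h7 : c * n ≤ classSize y (y i) := by
      have := hcy (y i)
      rwa [pHat, le_div_iff₀ c0] at this
    have h8 : 2 * (c * n) ≤ 4 * ((classSize y (y i) : ℝ) - 1) := by linarith [hy' (y i)]
    nlinarith [mul_le_mul_of_nonneg_right h8 c0.le]
  have h2' : 0 ≤ 2 * (1 / ((n : ℝ) * (classSize y (y i) - 1))) := by positivity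
  unfold classWeight
  split_ifs with hij hyij
  · simpa using hpos
  · rw [mul_sub, abs_le]; constructor <;> linarith
  · rw [sub_zero, abs_of_nonneg h1']; exact h1

/-- If Δ̂ = 0 all observations coincide and every Δ̂_k vanishes too. Cancelling Δ̂ from the
statistic is then harmless under the convention that division by zero gives 0. -/
lemma gCovSample_eq_zero_of_deltaHat (x : Fin n → Eucl p) (y : Fin n → Fin K) (hn : 2 ≤ n)
    (h : deltaHat x = 0) : gCovSample x y = 0 := by
  have hn' : (2 : ℝ) ≤ n := by exact_mod_cast hn
  have h0 : ∀ i j : Fin n, i < j → ‖x i - x j‖ = 0 := by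
    rw [deltaHat, giniMeanDiff, mul_eq_zero] at h
    rcases h with h | h
    · exfalso
      rw [Finset.card_univ, Fintype.card_fin, choose_two_eq, inv_eq_zero] at h
      nlinarith
    · rw [Finset.sum_eq_zero_iff_of_nonneg fun _ _ => norm_nonneg _] at h
      intro i j hij
      exact h (i, j) (by simp [hij])
  have h1 : ∀ s : Finset (Fin n), giniMeanDiff x s = 0 := by
    intro s
    rw [giniMeanDiff, Finset.sum_eq_zero, mul_zero]
    intro q hq
    exact h0 _ _ (Finset.mem_filter.1 hq).2
  simp [gCovSample, deltaHat, deltaHatClass, h1]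

/-- The rescaled Gini correlation is the studentized Gini covariance. -/
lemma rescaledGCor_eq (x : Fin n → Eucl p) (y : Fin n → Fin K) (hn : 2 ≤ n) :
    rescaledGCor x y = gCovSample x y / sigmaHat x y := by
  rw [rescaledGCor, gCorSample]
  by_cases h : deltaHat x = 0
  · rw [gCovSample_eq_zero_of_deltaHat x y hn h]; simp
  · field_simp

lemma sigmaHat_eq (hK : 2 ≤ K) (x : Fin n → Eucl p) (y : Fin n → Fin K) (hn : 3 ≤ n)
    (hy : ∀ k, 2 ≤ classSize y k) :
    sigmaHat x y = √(varFactor y) * √(distVarHat x) := by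
  have : 0 ≤ varFactor y := le_trans (by positivity) (le_varFactor hK y hn hy)
  rw [sigmaHat, ← Real.sqrt_mul this]
  rfl

end ClassWeights

/-! ### Measurability of the statistics. -/

section Measurability

variable {n p K : ℕ}

lemma measurable_giniMeanDiff (s : Finset (Fin n)) :
    Measurable fun x : Fin n → Eucl p => giniMeanDiff x s := by
  unfold giniMeanDiff; fun_prop

lemma measurable_distVarHat : Measurable fun x : Fin n → Eucl p => distVarHat x := by
  unfold distVarHat sampleCenteredDist; fun_prop

lemma measurable_rescaledGCor (y : Fin n → Fin K) :
    Measurable fun x : Fin n → Eucl p => rescaledGCor x y := by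
  have h1 : Measurable fun x : Fin n → Eucl p => deltaHat x := measurable_giniMeanDiff _
  have h2 : Measurable fun x : Fin n → Eucl p => sigmaHat x y := by
    unfold sigmaHat sigmaHatSq
    exact (measurable_distVarHat.const_mul _).sqrt
  have h3 : Measurable fun x : Fin n → Eucl p => gCovSample x y :=
    h1.sub (Finset.measurable_sum _ fun k _ => (measurable_giniMeanDiff _).const_mul _)
  exact (h1.div h2).mul (h3.div h1)

end Measurability

/-! ### Studentization and the explicit bound for a fixed labelling. -/

section CharFunBound

variable {n p K : ℕ} {F : Measure (Eucl p)} [IsProbabilityMeasure F]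

lemma abs_one_div_sqrt_sub_one_le {v : ℝ} (hv : |v - 1| ≤ 1 / 2) : |1 / √v - 1| ≤ 2 * |v - 1| := by
  rw [abs_le] at hv
  have hv0 : (1 : ℝ) / 2 ≤ v := by linarith
  have h1 : (1 : ℝ) / 2 ≤ √v := Real.le_sqrt_of_sq_le (by norm_num; linarith)
  have h2 : √v ^ 2 = v := Real.sq_sqrt (by linarith)
  have h3 : 0 < √v := by linarith
  have e : 1 / √v - 1 = (1 - v) / (√v * (1 + √v)) := by
    rw [eq_div_iff (by positivity)]
    field_simp
    linear_combination -h2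
  rw [e, abs_div, abs_sub_comm, abs_of_pos (by positivity : 0 < √v * (1 + √v)),
    div_le_iff₀ (by positivity)]
  have h4 : (1 : ℝ) / 2 ≤ √v * (1 + √v) := by nlinarith
  nlinarith [abs_nonneg (v - 1)]

/-- Studentization by a ratio consistent estimator changes a characteristic function little. -/
lemma norm_exp_sub_exp_le {S v : ℝ} (t : ℝ) {η : ℝ} (hη : 0 < η) (hη2 : η ≤ 1 / 2) :
    ‖Complex.exp (Complex.I * (t * (S * (1 / √v)) : ℝ)) - Complex.exp (Complex.I * (t * S : ℝ))‖ ≤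
      2 * |t| * η * |S| + 2 / η * |v - 1| := by
  have n1 : 0 ≤ 2 * |t| * η * |S| := by positivity
  have n2 : 0 ≤ 2 / η * |v - 1| := by positivity
  -- Near 1 the exponential is Lipschitz. Away from 1 the trivial bound 2 is at most (2/η)|v - 1|,
  -- as in Markov's inequality, so nothing is asked of √v, which may be 0.
  by_cases hv : |v - 1| ≤ η
  · have e : Complex.exp (Complex.I * (t * (S * (1 / √v)) : ℝ)) -
        Complex.exp (Complex.I * (t * S : ℝ)) = Complex.exp (Complex.I * (t * S : ℝ)) *
        (Complex.exp (Complex.I * (t * S * (1 / √v - 1) : ℝ)) - 1) := by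
      rw [mul_sub, ← Complex.exp_add, mul_one]; push_cast; ring_nf
    rw [e, norm_mul, norm_exp_I_mul_ofReal, one_mul]
    refine (Real.norm_exp_I_mul_ofReal_sub_one_le).trans ?_
    rw [Real.norm_eq_abs, abs_mul, abs_mul]
    have h1 := (abs_one_div_sqrt_sub_one_le (hv.trans hη2)).trans
      (mul_le_mul_of_nonneg_left hv two_pos.le)
    have := mul_le_mul_of_nonneg_left h1 (mul_nonneg (abs_nonneg t) (abs_nonneg S))
    linarith
  · push Not at hv
    have h2 : 2 ≤ 2 / η * |v - 1| := by
      rw [div_mul_eq_mul_div, le_div_iff₀ hη]; linarith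
    refine (norm_sub_le _ _).trans ?_
    rw [norm_exp_I_mul_ofReal, norm_exp_I_mul_ofReal]
    linarith

/-- The standardized weights of the Gini covariance. -/
noncomputable def standardWeight (F : Measure (Eucl p)) (y : Fin n → Fin K) (i j : Fin n) : ℝ :=
  classWeight y i j / (√(varFactor y) * √(centeredMoment F 2))

omit [IsProbabilityMeasure F] in
lemma rescaledGCor_eq_mul (hK : 2 ≤ K) (hpos : 0 < centeredMoment F 2) (hn : 3 ≤ n)
    (y : Fin n → Fin K) (hy : ∀ k, 2 ≤ classSize y k) (x : Fin n → Eucl p) :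
    rescaledGCor x y = quadForm (standardWeight F y) (doubleCenteredDist F) x *
      (1 / √(distVarHat x / centeredMoment F 2)) := by
  have hs : quadForm (standardWeight F y) (doubleCenteredDist F) x =
      quadForm (classWeight y) (doubleCenteredDist F) x /
        (√(varFactor y) * √(centeredMoment F 2)) := by
    simp only [quadForm, linearPart, standardWeight, div_mul_eq_mul_div, Finset.sum_div]
    refine Finset.sum_congr rfl fun i _ => Finset.sum_congr rfl fun j _ => ?_
    ring
  have hτ : √(centeredMoment F 2) ≠ 0 := (Real.sqrt_pos.2 hpos).ne'
  rw [rescaledGCor_eq x y (by omega), sigmaHat_eq hK x y hn hy, hs,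
    gCovSample_eq (F := F) x y (by omega) hy, Real.sqrt_div' _ hpos.le, one_div_div,
    div_mul_div_comm]
  rw [mul_assoc, mul_comm (√(centeredMoment F 2)) (√(distVarHat x)), ← mul_assoc,
    mul_div_mul_right _ _ hτ]

set_option maxHeartbeats 800000 in
/-- A quantitative central limit theorem for the rescaled Gini correlation under equal class
distributions. -/
lemma norm_integral_exp_rescaledGCor_sub_le (hK : 2 ≤ K)
    (hF : Integrable (fun x => ‖x‖ ^ 4) F) (hpos : 0 < centeredMoment F 2) (hn : 6 ≤ n)
    (y : Fin n → Fin K) (hy : ∀ k, 2 ≤ classSize y k) {c : ℝ} (hc : 0 < c)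
    (hcy : ∀ k, c ≤ pHat y k) (t : ℝ) {ε η : ℝ} (hε : 0 < ε) (hη : 0 < η) (hη2 : η ≤ 1 / 2) :
    ‖(∫ x, Complex.exp (Complex.I * (t * rescaledGCor x y : ℝ)) ∂(Measure.pi fun _ : Fin n => F)) -
      Complex.exp (-(t ^ 2 : ℝ) / 2)‖ ≤
      |t| * (3 / 4 * t ^ 2 * (4 * ε + ε⁻¹ * (16 * (256 / c ^ 4 *
          (centeredMoment F 4 / (n * centeredMoment F 2 ^ 2))))) +
        |t| / 4 * (ε + ε⁻¹ * (2 * (256 / c ^ 4 *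
          (centeredMoment F 4 / (n * centeredMoment F 2 ^ 2)) +
          2 * (256 / c ^ 4 * (cyclicMoment F / centeredMoment F 2 ^ 2)))))) +
      (2 * |t| * η + 2 / η * ((ε + ε⁻¹ *
        (16 * (centeredMoment F 4 / (n * centeredMoment F 2 ^ 2)))) / 2 + 36 / n)) := by
  have hh := isDegenerateKernel_doubleCenteredDist hF
  have hn' : (6 : ℝ) ≤ n := by exact_mod_cast hn
  have n0 : (0 : ℝ) < n := by linarith
  have hvf := le_varFactor hK y (by omega) hy
  have hvf0 : 0 < varFactor y := lt_of_lt_of_le (by positivity) hvf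
  set a := standardWeight F y with ha
  have ha0 : ∀ i, a i i = 0 := fun i => by simp [ha, standardWeight, classWeight_self]
  have hasymm : ∀ i j, a i j = a j i := fun i j => by
    simp only [ha, standardWeight, classWeight_comm y i j]
  have hsτ : 0 < √(centeredMoment F 2) := Real.sqrt_pos.2 hpos
  have hsτ2 : √(centeredMoment F 2) ^ 2 = centeredMoment F 2 := Real.sq_sqrt hpos.le
  have hsv : 0 < √(varFactor y) := Real.sqrt_pos.2 hvf0
  have hsv2 : √(varFactor y) ^ 2 = varFactor y := Real.sq_sqrt hvf0.le
  -- The weight bound 4/(c n²) divided by the lower bound 1/n for `√(varFactor y)` and by the root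
  -- of E d². Thus B is of order 1/n relative to that root, and 4⁴ is the 256 below.
  set B : ℝ := 4 / (c * n * √(centeredMoment F 2)) with hBdef
  have hB : ∀ i j, |a i j| ≤ B := by
    intro i j
    have h1 := abs_classWeight_le y (by omega) hy hc hcy i j
    have h2 : 1 / (n : ℝ) ≤ √(varFactor y) := by
      refine Real.le_sqrt_of_sq_le ?_
      rw [div_pow, one_pow]; exact hvf
    rw [ha, standardWeight, abs_div, abs_of_pos (mul_pos hsv hsτ), div_le_iff₀ (mul_pos hsv hsτ)]
    refine h1.trans ?_
    have e : 4 / (c * (n : ℝ) ^ 2) = B * (1 / n * √(centeredMoment F 2)) := by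
      rw [hBdef]; field_simp
    rw [e]
    exact mul_le_mul_of_nonneg_left (mul_le_mul_of_nonneg_right h2 hsτ.le) (by positivity)
  have hsum : (∑ i, ∑ j, a i j ^ 2) * centeredMoment F 2 = 2 := by
    have e : ∀ i j, a i j ^ 2 = classWeight y i j ^ 2 / (varFactor y * centeredMoment F 2) := by
      intro i j
      rw [ha, standardWeight, div_pow, mul_pow, hsv2, hsτ2]
    simp_rw [e, ← Finset.sum_div]
    rw [sum_classWeight_sq y (by omega) hy]
    field_simp
  have hclt := norm_integral_exp_quadForm_sub_gaussian_le hh ha0 hasymm hB hsum t hε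
  rw [integral_gram_sq hF, Fintype.card_fin] at hclt
  have hB4 : B ^ 4 = 256 / (c ^ 4 * n ^ 4 * centeredMoment F 2 ^ 2) := by
    rw [hBdef, div_pow, mul_pow, mul_pow, show √(centeredMoment F 2) ^ 4 =
      (√(centeredMoment F 2) ^ 2) ^ 2 by ring, hsτ2]
    norm_num
  -- With B of order 1/n, the factors n³B⁴ and n⁴B⁴ reproduce exactly the ratios of (C2) and (C3).
  have f1 : (n : ℝ) ^ 3 * B ^ 4 * ∫ z, doubleCenteredDist F z.1 z.2 ^ 4 ∂(F.prod F) =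
      256 / c ^ 4 * (centeredMoment F 4 / (n * centeredMoment F 2 ^ 2)) := by
    rw [hB4]
    change _ * centeredMoment F 4 = _
    field_simp
  have f2 : (n : ℝ) ^ 4 * B ^ 4 * cyclicMoment F =
      256 / c ^ 4 * (cyclicMoment F / centeredMoment F 2 ^ 2) := by
    rw [hB4]; field_simp
  rw [f1, f2] at hclt
  obtain ⟨hVi, hVle⟩ := integral_abs_distVarHat_div_sub_one_le hF hpos hn hε
  set S : (Fin n → Eucl p) → ℝ := quadForm a (doubleCenteredDist F) with hS
  have hSm : MemLp S 2 (Measure.pi fun _ : Fin n => F) := memLp_two_of_four (memLp_quadForm hh ha0)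
  have hSabs : ∫ x, |S x| ∂(Measure.pi fun _ : Fin n => F) ≤ 1 := by
    refine (integral_abs_le_of_sq hSm one_pos).trans ?_
    have := integral_quadForm_sq_le (F := F) hh ha0
    have e2 : (∑ i, ∑ j, a i j ^ 2) / 2 * ∫ z, doubleCenteredDist F z.1 z.2 ^ 2 ∂(F.prod F) = 1 := by
      change (∑ i, ∑ j, a i j ^ 2) / 2 * centeredMoment F 2 = 1
      linarith
    rw [e2] at this
    rw [inv_one, one_mul]
    linarith
  have hT : ∀ x, rescaledGCor x y = S x * (1 / √(distVarHat x / centeredMoment F 2)) :=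
    rescaledGCor_eq_mul hK hpos (by omega) y hy
  have hexp : ∀ {R : (Fin n → Eucl p) → ℝ},
      AEStronglyMeasurable R (Measure.pi fun _ : Fin n => F) →
      Integrable (fun x => Complex.exp (Complex.I * (t * R x : ℝ)))
        (Measure.pi fun _ : Fin n => F) := fun hR => by
    simpa using integrable_exp_mul (hR.const_mul t) (integrable_const (1 : ℝ))
  have iT := hexp (measurable_rescaledGCor (p := p) y).aestronglyMeasurable
  have iS := hexp hSm.aestronglyMeasurable
  have iSa : Integrable (fun x => 2 * |t| * η * |S x|) (Measure.pi fun _ : Fin n => F) :=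
    (hSm.integrable one_le_two).abs.const_mul _
  have iVa := hVi.abs.const_mul (2 / η)
  have hdiff : ‖(∫ x, Complex.exp (Complex.I * (t * rescaledGCor x y : ℝ))
      ∂(Measure.pi fun _ : Fin n => F)) -
      ∫ x, Complex.exp (Complex.I * (t * S x : ℝ)) ∂(Measure.pi fun _ : Fin n => F)‖ ≤
      2 * |t| * η + 2 / η * ((ε + ε⁻¹ *
        (16 * (centeredMoment F 4 / (n * centeredMoment F 2 ^ 2)))) / 2 + 36 / n) := by
    rw [← integral_sub iT iS]
    refine (norm_integral_le_of_norm_le (iSa.add iVa) (ae_of_all _ fun x => ?_)).trans ?_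
    · rw [hT]
      exact norm_exp_sub_exp_le t hη hη2
    · simp only [Pi.add_apply]
      rw [integral_add iSa iVa, integral_const_mul, integral_const_mul]
      refine add_le_add ?_ (mul_le_mul_of_nonneg_left hVle (by positivity))
      calc _ ≤ 2 * |t| * η * 1 := mul_le_mul_of_nonneg_left hSabs (by positivity)
        _ = _ := mul_one _
  calc _ ≤ _ := norm_sub_le_norm_sub_add_norm_sub _
        (∫ x, Complex.exp (Complex.I * (t * S x : ℝ)) ∂(Measure.pi fun _ : Fin n => F)) _
    _ ≤ _ := add_le_add hdiff hclt
    _ = _ := add_comm _ _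

end CharFunBound

/-! ### Passage to the limit, uniformly in the labels. -/

section Limit

/-- Uniform convergence of the characteristic functions of the rescaled Gini correlation over all
labellings whose class proportions are bounded below. -/
theorem eventually_norm_integral_exp_rescaledGCor_sub_lt {K : ℕ} (hK : 2 ≤ K) {p n : ℕ → ℕ}
    (F : ∀ m, Measure (Eucl (p m))) [∀ m, IsProbabilityMeasure (F m)]
    (hC1 : ∀ m, Integrable (fun x => ‖x‖ ^ 4) (F m))
    (hpos : ∀ m, 0 < centeredMoment (F m) 2)
    (hC2 : Tendsto (fun m => centeredMoment (F m) 4 /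
      ((n m : ℝ) * centeredMoment (F m) 2 ^ 2)) atTop (𝓝 0))
    (hC3 : Tendsto (fun m => cyclicMoment (F m) / centeredMoment (F m) 2 ^ 2) atTop (𝓝 0))
    (hn : Tendsto n atTop atTop) {c : ℝ} (hc : 0 < c) (t : ℝ) {δ : ℝ} (hδ : 0 < δ) :
    ∀ᶠ m in atTop, ∀ y : Fin (n m) → Fin K, (∀ k, c ≤ pHat y k) →
      ‖(∫ x, Complex.exp (Complex.I * (t * rescaledGCor x y : ℝ))
        ∂(Measure.pi fun _ : Fin (n m) => F m)) - Complex.exp (-(t ^ 2 : ℝ) / 2)‖ < δ := by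
  -- This is the bound left after m → ∞ with ε = η². Studentization costs (2/η)(ε/2), so ε must be
  -- small compared with η; the choice η² makes this term η. A small η is fixed before m varies.
  have hlim : Tendsto (fun η : ℝ => |t| * (3 / 4 * t ^ 2 * (4 * η ^ 2) + |t| / 4 * η ^ 2) +
      (2 * |t| * η + η)) (𝓝[>] 0) (𝓝 0) := by
    have h : Continuous fun η : ℝ => |t| * (3 / 4 * t ^ 2 * (4 * η ^ 2) + |t| / 4 * η ^ 2) +
      (2 * |t| * η + η) := by fun_prop
    have := h.tendsto 0
    simp only [ne_eq, OfNat.ofNat_ne_zero, not_false_eq_true, zero_pow, mul_zero, add_zero] at this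
    exact this.mono_left nhdsWithin_le_nhds
  obtain ⟨η, hηδ, hη, hη2⟩ := ((hlim.eventually_lt_const hδ).and
    ((eventually_mem_nhdsWithin).and (eventually_nhdsWithin_of_eventually_nhds
      (eventually_le_nhds (show (0 : ℝ) < 1 / 2 by norm_num))))).exists
  have hη0 : 0 < η := hη
  have hε : 0 < η ^ 2 := by positivity
  have hninv : Tendsto (fun m => 36 / (n m : ℝ)) atTop (𝓝 0) :=
    (tendsto_const_nhds).div_atTop (tendsto_natCast_atTop_atTop.comp hn)
  have hbound : Tendsto (fun m => |t| * (3 / 4 * t ^ 2 * (4 * η ^ 2 + (η ^ 2)⁻¹ *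
      (16 * (256 / c ^ 4 * (centeredMoment (F m) 4 / (n m * centeredMoment (F m) 2 ^ 2))))) +
        |t| / 4 * (η ^ 2 + (η ^ 2)⁻¹ * (2 * (256 / c ^ 4 *
          (centeredMoment (F m) 4 / (n m * centeredMoment (F m) 2 ^ 2)) +
          2 * (256 / c ^ 4 * (cyclicMoment (F m) / centeredMoment (F m) 2 ^ 2)))))) +
      (2 * |t| * η + 2 / η * ((η ^ 2 + (η ^ 2)⁻¹ *
        (16 * (centeredMoment (F m) 4 / (n m * centeredMoment (F m) 2 ^ 2)))) / 2 + 36 / n m)))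
      atTop (𝓝 (|t| * (3 / 4 * t ^ 2 * (4 * η ^ 2 + (η ^ 2)⁻¹ *
      (16 * (256 / c ^ 4 * 0))) +
        |t| / 4 * (η ^ 2 + (η ^ 2)⁻¹ * (2 * (256 / c ^ 4 * 0 + 2 * (256 / c ^ 4 * 0))))) +
      (2 * |t| * η + 2 / η * ((η ^ 2 + (η ^ 2)⁻¹ * (16 * 0)) / 2 + 0)))) := by
    have a1 := (hC2.const_mul (256 / c ^ 4))
    have a2 := (hC3.const_mul (256 / c ^ 4))
    exact ((((((a1.const_mul 16).const_mul _).const_add _).const_mul _).add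
      (((((a1.add (a2.const_mul 2)).const_mul 2).const_mul _).const_add _).const_mul _)).const_mul
      _).add (((((((hC2.const_mul 16).const_mul _).const_add _).div_const 2).add
        hninv).const_mul _).const_add _)
  have hval : |t| * (3 / 4 * t ^ 2 * (4 * η ^ 2 + (η ^ 2)⁻¹ *
      (16 * (256 / c ^ 4 * 0))) +
        |t| / 4 * (η ^ 2 + (η ^ 2)⁻¹ * (2 * (256 / c ^ 4 * 0 + 2 * (256 / c ^ 4 * 0))))) +
      (2 * |t| * η + 2 / η * ((η ^ 2 + (η ^ 2)⁻¹ * (16 * 0)) / 2 + 0)) < δ := by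
    refine lt_of_eq_of_lt ?_ hηδ
    field_simp
    ring
  -- Once c n ≥ 2, a proportion of at least c forces every class size to be at least 2.
  have hncast : Tendsto (fun m => c * (n m : ℝ)) atTop atTop :=
    (tendsto_natCast_atTop_atTop.comp hn).const_mul_atTop hc
  filter_upwards [hbound.eventually_lt_const hval, hn.eventually_ge_atTop 6,
    hncast.eventually_ge_atTop 2] with m hm h6 hc2 y hy
  refine lt_of_le_of_lt (norm_integral_exp_rescaledGCor_sub_le hK (hC1 m) (hpos m) h6 y ?_ hc hy t
    hε hη0 hη2) hm
  intro k
  have h6' : (6 : ℝ) ≤ n m := by exact_mod_cast h6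
  have h1 := hy k
  rw [pHat, le_div_iff₀ (by linarith)] at h1
  exact_mod_cast hc2.trans h1

end Limit

/-! ### Convergence in distribution from characteristic functions. -/

section Weak

/-- Convergence in distribution to a standard normal law from characteristic functions. -/
lemma tendstoInDistribution_gaussian_of_charFun {Ω : ℕ → Type*} [∀ m, MeasurableSpace (Ω m)]
    (P : ∀ m, Measure (Ω m)) [∀ m, IsProbabilityMeasure (P m)] {T : ∀ m, Ω m → ℝ}
    (hT : ∀ m, AEMeasurable (T m) (P m))
    (h : ∀ t : ℝ, Tendsto (fun m => ∫ ω, Complex.exp (Complex.I * (t * T m ω : ℝ)) ∂(P m)) atTop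
      (𝓝 (Complex.exp (-(t ^ 2 : ℝ) / 2)))) :
    TendstoInDistribution T atTop (id : ℝ → ℝ) P (gaussianReal 0 1) where
  forall_aemeasurable := hT
  aemeasurable_limit := aemeasurable_id
  tendsto := by
    refine ProbabilityMeasure.tendsto_of_tendsto_charFun fun t => ?_
    have e1 : charFun ((gaussianReal 0 1).map id) t = Complex.exp (-(t ^ 2 : ℝ) / 2) := by
      rw [Measure.map_id, charFun_gaussianReal]; simp [neg_div]
    have e2 : ∀ m, charFun ((P m).map (T m)) t =
        ∫ ω, Complex.exp (Complex.I * (t * T m ω : ℝ)) ∂(P m) := by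
      intro m
      rw [charFun_apply_real, integral_map (hT m) (by fun_prop)]
      refine integral_congr_ae (ae_of_all _ fun ω => ?_)
      simp only
      congr 1
      push_cast; ring
    simp only [ProbabilityMeasure.coe_mk, e1, e2]
    exact h t

end Weak

/-! ### Law of the labelled sample and concentration of the class proportions. -/

section RandomLabels

variable {Ω E : Type*} [MeasurableSpace Ω] [MeasurableSpace E] {P : Measure Ω}
  [IsProbabilityMeasure P] {n K : ℕ} {F : Measure E} [IsProbabilityMeasure F]
  {X : Fin n → Ω → E} {Y : Fin n → Ω → Fin K}

omit [IsProbabilityMeasure F] in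
lemma map_sample_eq_pi (hX : ∀ i, HasLaw (X i) F P) (hind : iIndepFun X P) :
    P.map (fun ω i => X i ω) = Measure.pi fun _ => F := by
  rw [(iIndepFun_iff_map_fun_eq_pi_map fun i => (hX i).aemeasurable).1 hind]
  congr 1
  ext1 i
  exact (hX i).map_eq

/-- The numerical data and the labels are independent as samples. -/
lemma map_sample_prod_eq (hX : ∀ i, HasLaw (X i) F P) (hY : ∀ i, Measurable (Y i))
    (hXY : ∀ i, IndepFun (X i) (Y i) P) (hind : iIndepFun (fun i ω => (X i ω, Y i ω)) P) :
    P.map (fun ω => ((fun i => X i ω), fun i => Y i ω)) =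
      (Measure.pi fun _ => F).prod (Measure.pi fun i => P.map (Y i)) := by
  have hp : ∀ i, IsProbabilityMeasure (P.map (Y i)) := fun i =>
    Measure.isProbabilityMeasure_map (hY i).aemeasurable
  have hm : ∀ i, AEMeasurable (fun ω => (X i ω, Y i ω)) P := fun i =>
    (hX i).aemeasurable.prodMk (hY i).aemeasurable
  have h1 := (iIndepFun_iff_map_fun_eq_pi_map hm).1 hind
  have h2 : ∀ i, P.map (fun ω => (X i ω, Y i ω)) = F.prod (P.map (Y i)) := fun i => by
    rw [(indepFun_iff_map_prod_eq_prod_map_map (hX i).aemeasurable (hY i).aemeasurable).1 (hXY i),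
      (hX i).map_eq]
  simp_rw [h2] at h1
  have h3 := measurePreserving_arrowProdEquivProdArrow E (Fin K) (Fin n) (fun _ => F)
    (fun i => P.map (Y i))
  rw [← h3.map_eq, ← h1, AEMeasurable.map_map_of_aemeasurable h3.measurable.aemeasurable
    (aemeasurable_pi_lambda _ hm)]
  rfl

/-- The class proportions are rarely far below the class probabilities. -/
lemma measureReal_exists_pHat_lt_le (hY : ∀ i, Measurable (Y i)) (hind : iIndepFun Y P)
    {π : Fin K → ℝ} (hπ : ∀ i k, P.real {ω | Y i ω = k} = π k) {c : ℝ} (hc : 0 < c)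
    (hcπ : ∀ k, 2 * c ≤ π k) (hn : 0 < n) :
    P.real {ω | ∃ k, pHat (fun i => Y i ω) k < c} ≤ K * (1 / (n * c ^ 2)) := by
  have hn0 : (0 : ℝ) < n := by exact_mod_cast hn
  have hone : ∀ k, P.real {ω | pHat (fun i => Y i ω) k < c} ≤ 1 / (n * c ^ 2) := by
    intro k
    set Z : Fin n → Ω → ℝ := fun i ω => if Y i ω = k then 1 else 0 with hZ
    have hg : Measurable fun l : Fin K => if l = k then (1 : ℝ) else 0 := measurable_of_finite _
    have hZm : ∀ i, Measurable (Z i) := fun i => hg.comp (hY i)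
    have hZb : ∀ i, ∀ᵐ ω ∂P, Z i ω ∈ Set.Icc (0 : ℝ) 1 := fun i => ae_of_all _ fun ω => by
      simp only [hZ]; split_ifs <;> simp
    have hZ2 : ∀ i, MemLp (Z i) 2 P := fun i =>
      memLp_of_bounded (hZb i) (hZm i).aestronglyMeasurable 2
    have hZind : iIndepFun Z P := hind.comp (fun _ l => if l = k then (1 : ℝ) else 0) fun _ => hg
    have hEZ : ∀ i, ∫ ω, Z i ω ∂P = π k := by
      intro i
      have hs : MeasurableSet {ω | Y i ω = k} := hY i (measurableSet_singleton k)
      rw [← hπ i k, ← integral_indicator_one hs]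
      refine integral_congr_ae (ae_of_all _ fun ω => ?_)
      simp [hZ, Set.indicator_apply]
    have hvar : variance (∑ i, Z i) P ≤ n := by
      rw [IndepFun.variance_sum (fun i _ => hZ2 i) fun i _ j _ hij => hZind.indepFun hij]
      calc _ ≤ ∑ _i : Fin n, (1 : ℝ) := Finset.sum_le_sum fun i _ => by
            refine (variance_le_sq_of_bounded (hZb i) (hZm i).aemeasurable).trans ?_
            norm_num
        _ = n := by simp
    have hmem : MemLp (∑ i, Z i) 2 P := memLp_finsetSum' _ fun i _ => hZ2 i
    have hmean : P[∑ i, Z i] = n * π k := by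
      simp_rw [Finset.sum_apply]
      rw [integral_finsetSum _ fun i _ => (hZ2 i).integrable one_le_two]
      simp [hEZ]
    have hch := meas_ge_le_variance_div_sq hmem (mul_pos hn0 hc)
    rw [hmean] at hch
    -- As π k ≥ 2c, a proportion below c puts the class count at distance at least n c from its
    -- mean, and Chebyshev's inequality applies.
    have hsub : {ω | pHat (fun i => Y i ω) k < c} ⊆
        {ω | n * c ≤ |(∑ i, Z i) ω - n * π k|} := by
      intro ω hω
      simp only [Set.mem_ofPred_eq, Finset.sum_apply] at hω ⊢
      have e : (classSize (fun i => Y i ω) k : ℝ) = ∑ i, Z i ω := by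
        simp [classSize, classIndices, hZ]
      rw [pHat, e, div_lt_iff₀ hn0] at hω
      rw [abs_sub_comm]
      refine le_trans ?_ (le_abs_self _)
      have := mul_le_mul_of_nonneg_left (hcπ k) hn0.le
      linarith
    calc P.real {ω | pHat (fun i => Y i ω) k < c} ≤
          P.real {ω | n * c ≤ |(∑ i, Z i) ω - n * π k|} := measureReal_mono hsub
      _ ≤ variance (∑ i, Z i) P / (n * c) ^ 2 :=
          ENNReal.toReal_le_of_le_ofReal (div_nonneg (variance_nonneg _ _) (sq_nonneg _)) hch
      _ ≤ n / (n * c) ^ 2 := div_le_div_of_nonneg_right hvar (sq_nonneg _)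
      _ = _ := by field_simp
  have hset : {ω | ∃ k, pHat (fun i => Y i ω) k < c} =
      ⋃ k, {ω | pHat (fun i => Y i ω) k < c} := by ext; simp
  rw [hset]
  refine (measureReal_iUnion_fintype_le _).trans ((Finset.sum_le_sum fun k _ => hone k).trans ?_)
  simp

end RandomLabels

/-! ### Conditioning on random labels. -/

section Conditioning

variable {Ω : Type*} [MeasurableSpace Ω] {P : Measure Ω} [IsProbabilityMeasure P] {n p K : ℕ}
  {F : Measure (Eucl p)} [IsProbabilityMeasure F] {X : Fin n → Ω → Eucl p}
  {Y : Fin n → Ω → Fin K}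

/-- The labellings form a countable discrete space, so measurability for each fixed labelling
suffices. -/
lemma measurable_rescaledGCor_prod :
    Measurable fun q : (Fin n → Eucl p) × (Fin n → Fin K) => rescaledGCor q.1 q.2 :=
  measurable_from_prod_countable_left fun y => measurable_rescaledGCor y

omit [IsProbabilityMeasure P] in
lemma aemeasurable_rescaledGCor (hX : ∀ i, AEMeasurable (X i) P) (hY : ∀ i, Measurable (Y i)) :
    AEMeasurable (fun ω => rescaledGCor (fun i => X i ω) (fun i => Y i ω)) P := by
  have h : AEMeasurable (fun ω => ((fun i => X i ω), fun i => Y i ω)) P :=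
    (aemeasurable_pi_lambda _ hX).prodMk (measurable_pi_lambda _ hY).aemeasurable
  have h2 := (measurable_rescaledGCor_prod (n := n) (p := p) (K := K)).comp_aemeasurable h
  simp only [Function.comp_def] at h2
  exact h2

/-- Conditioning on the labels, the characteristic function of the rescaled Gini correlation is
controlled by its values at labellings whose class proportions are bounded below. -/
lemma norm_integral_exp_rescaledGCor_random_sub_le (hX : ∀ i, HasLaw (X i) F P)
    (hY : ∀ i, Measurable (Y i)) (hXY : ∀ i, IndepFun (X i) (Y i) P)
    (hind : iIndepFun (fun i ω => (X i ω, Y i ω)) P) {π : Fin K → ℝ}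
    (hπ : ∀ i k, P.real {ω | Y i ω = k} = π k) {c : ℝ} (hc : 0 < c) (hcπ : ∀ k, 2 * c ≤ π k)
    (hn : 0 < n) (t : ℝ) {δ : ℝ} (hδ : 0 ≤ δ)
    (h : ∀ y : Fin n → Fin K, (∀ k, c ≤ pHat y k) →
      ‖(∫ x, Complex.exp (Complex.I * (t * rescaledGCor x y : ℝ))
        ∂(Measure.pi fun _ : Fin n => F)) - Complex.exp (-(t ^ 2 : ℝ) / 2)‖ ≤ δ) :
    ‖(∫ ω, Complex.exp (Complex.I *
        (t * rescaledGCor (fun i => X i ω) (fun i => Y i ω) : ℝ)) ∂P) -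
      Complex.exp (-(t ^ 2 : ℝ) / 2)‖ ≤ δ + 2 * (K * (1 / (n * c ^ 2))) := by
  have hp : ∀ i, IsProbabilityMeasure (P.map (Y i)) := fun i =>
    Measure.isProbabilityMeasure_map (hY i).aemeasurable
  set μ := Measure.pi fun _ : Fin n => F with hμ
  set ν := Measure.pi fun i => P.map (Y i) with hν
  have hlaw := map_sample_prod_eq hX hY hXY hind
  rw [← hμ, ← hν] at hlaw
  have hYind : iIndepFun Y P := hind.comp (fun _ => Prod.snd) fun _ => measurable_snd
  have hYlaw : P.map (fun ω i => Y i ω) = ν :=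
    (iIndepFun_iff_map_fun_eq_pi_map fun i => (hY i).aemeasurable).1 hYind
  have hXYm : AEMeasurable (fun ω => ((fun i => X i ω), fun i => Y i ω)) P :=
    (aemeasurable_pi_lambda _ fun i => (hX i).aemeasurable).prodMk
      (measurable_pi_lambda _ hY).aemeasurable
  set f : (Fin n → Eucl p) × (Fin n → Fin K) → ℂ := fun q =>
    Complex.exp (Complex.I * (t * rescaledGCor q.1 q.2 : ℝ)) with hf
  have hfm : Measurable f := by
    have := (measurable_rescaledGCor_prod (n := n) (p := p) (K := K)).const_mul t
    exact Complex.measurable_exp.comp ((Complex.measurable_ofReal.comp this).const_mul _)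
  have hfi : Integrable f (μ.prod ν) := Integrable.of_bound hfm.aestronglyMeasurable 1
    (ae_of_all _ fun q => (norm_exp_I_mul_ofReal _).le)
  have e1 : ∫ ω, Complex.exp (Complex.I *
      (t * rescaledGCor (fun i => X i ω) (fun i => Y i ω) : ℝ)) ∂P =
      ∫ y, ∫ x, f (x, y) ∂μ ∂ν := by
    rw [← integral_prod_symm f hfi, ← hlaw, integral_map hXYm hfm.aestronglyMeasurable]
  set g : ℂ := Complex.exp (-(t ^ 2 : ℝ) / 2) with hg
  have hg1 : ‖g‖ ≤ 1 := by
    have : g = ((Real.exp (-t ^ 2 / 2) : ℝ) : ℂ) := by rw [hg]; push_cast; rfl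
    rw [this, Complex.norm_real, Real.norm_of_nonneg (Real.exp_pos _).le, Real.exp_le_one_iff]
    nlinarith [sq_nonneg t]
  -- Off this set the fixed-label estimate `h` applies. On it two characteristic function values
  -- differ by at most 2, which yields twice the probability of the set.
  set bad : Set (Fin n → Fin K) := {y | ∃ k, pHat y k < c} with hbad
  have hbm : MeasurableSet bad := bad.toFinite.measurableSet
  have hbadle : ν.real bad ≤ K * (1 / (n * c ^ 2)) := by
    rw [← hYlaw, map_measureReal_apply (measurable_pi_lambda _ hY) hbm]
    exact measureReal_exists_pHat_lt_le hY hYind hπ hc hcπ hn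
  have hinner : ∀ y, ‖∫ x, f (x, y) ∂μ‖ ≤ 1 := fun y => by
    refine (norm_integral_le_of_norm_le_const (C := 1)
      (ae_of_all _ fun x => (norm_exp_I_mul_ofReal _).le)).trans ?_
    simp
  have i1 : Integrable (fun y => ∫ x, f (x, y) ∂μ) ν := hfi.integral_prod_right
  have i2 : Integrable (fun y => δ + bad.indicator (fun _ => (2 : ℝ)) y) ν :=
    (integrable_const _).add ((integrable_const _).indicator hbm)
  have e2 : (∫ y, ∫ x, f (x, y) ∂μ ∂ν) - g = ∫ y, ((∫ x, f (x, y) ∂μ) - g) ∂ν := by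
    rw [integral_sub i1 (integrable_const _)]; simp
  rw [e1, e2]
  refine (norm_integral_le_of_norm_le i2 (ae_of_all _ fun y => ?_)).trans ?_
  · by_cases hy : y ∈ bad
    · rw [Set.indicator_of_mem hy]
      refine (norm_sub_le _ _).trans ?_
      linarith [hinner y]
    · rw [Set.indicator_of_notMem hy, add_zero]
      refine h y fun k => ?_
      by_contra hk
      exact hy ⟨k, not_le.1 hk⟩
  · rw [integral_add (integrable_const _) ((integrable_const _).indicator hbm),
      integral_indicator_const _ hbm]
    simp only [integral_const, probReal_univ, smul_eq_mul]
    linarith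

lemma tendsto_add_mul_one_div {n : ℕ → ℕ} (hn : Tendsto n atTop atTop) (δ K : ℝ) {c : ℝ}
    (hc : 0 < c) :
    Tendsto (fun m => δ + 2 * (K * (1 / ((n m : ℝ) * c ^ 2)))) atTop (𝓝 δ) := by
  have h1 : Tendsto (fun m => (n m : ℝ) * c ^ 2) atTop atTop :=
    (tendsto_natCast_atTop_atTop.comp hn).atTop_mul_const (by positivity)
  have h2 : Tendsto (fun m => 1 / ((n m : ℝ) * c ^ 2)) atTop (𝓝 0) :=
    tendsto_const_nhds.div_atTop h1
  simpa using ((h2.const_mul K).const_mul 2).const_add δ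

end Conditioning

end GiniCor

/-! ### The two sampling schemes. -/

open GiniCor in
theorem corollary1 {K : ℕ} (hK : 2 ≤ K)
    -- dimensions and total sample sizes along the asymptotic sequence
    (p n : ℕ → ℕ) (hp : Tendsto p atTop atTop)
    -- the distribution of the numerical variable and its moment conditions
    (F : ∀ m, Measure (GiniCor.Eucl (p m))) [∀ m, IsProbabilityMeasure (F m)]
    (hC1 : ∀ m, Integrable (fun x => ‖x‖ ^ 4) (F m))
    (hpos : ∀ m, 0 < GiniCor.centeredMoment (F m) 2)
    (hC2 : Tendsto (fun m => GiniCor.centeredMoment (F m) 4 /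
      ((n m : ℝ) * GiniCor.centeredMoment (F m) 2 ^ 2)) atTop (𝓝 0))
    (hC3 : Tendsto (fun m => GiniCor.cyclicMoment (F m) /
      GiniCor.centeredMoment (F m) 2 ^ 2) atTop (𝓝 0))
    -- the numerical observations
    {Ω : ℕ → Type*} [∀ m, MeasurableSpace (Ω m)]
    (P : ∀ m, Measure (Ω m)) [∀ m, IsProbabilityMeasure (P m)]
    (X : ∀ m, Fin (n m) → Ω m → GiniCor.Eucl (p m))
    (hX : ∀ m i, HasLaw (X m i) (F m) (P m)) :
    -- sampling from the joint distribution of `(X, Y)`, with `X` and `Y` independent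
    (∀ (π : Fin K → ℝ) (Y : ∀ m, Fin (n m) → Ω m → Fin K),
      (∀ k, 0 < π k) →
      (∀ m i, Measurable (Y m i)) →
      (∀ m i k, (P m).real {ω | Y m i ω = k} = π k) →
      (∀ m i, IndepFun (X m i) (Y m i) (P m)) →
      (∀ m, iIndepFun (fun i ω => (X m i ω, Y m i ω)) (P m)) →
      Tendsto n atTop atTop →
      TendstoInDistribution
        (fun m ω => GiniCor.rescaledGCor (fun i => X m i ω) (fun i => Y m i ω))
        atTop (id : ℝ → ℝ) P (gaussianReal 0 1)) ∧
    -- K independent samples of given sizes from the same distribution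
    (∀ y : ∀ m, Fin (n m) → Fin K,
      (∀ m, iIndepFun (X m) (P m)) →
      (∀ k, Tendsto (fun m => GiniCor.classSize (y m) k) atTop atTop) →
      (∃ c : ℝ, 0 < c ∧ ∀ k, ∀ᶠ m in atTop, c ≤ GiniCor.pHat (y m) k) →
      TendstoInDistribution
        (fun m ω => GiniCor.rescaledGCor (fun i => X m i ω) (y m))
        atTop (id : ℝ → ℝ) P (gaussianReal 0 1)) := by
  constructor
  · intro π Y hπ0 hY hπ hXY hind hn
    refine tendstoInDistribution_gaussian_of_charFun P (fun m => ?_) fun t => ?_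
    · exact aemeasurable_rescaledGCor (fun i => (hX m i).aemeasurable) (hY m)
    -- Half the smallest class probability serves as c; the slack between c and 2c is what
    -- Chebyshev's inequality consumes.
    obtain ⟨c, hc, hcπ⟩ : ∃ c : ℝ, 0 < c ∧ ∀ k, 2 * c ≤ π k := by
      have : Nonempty (Fin K) := ⟨⟨0, by omega⟩⟩
      obtain ⟨k₀, hk₀⟩ := Finite.exists_min π
      exact ⟨π k₀ / 2, half_pos (hπ0 k₀), fun k => by linarith [hk₀ k]⟩
    rw [Metric.tendsto_nhds]
    intro δ hδ
    have hlim := tendsto_add_mul_one_div hn (δ / 2) K hc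
    filter_upwards [eventually_norm_integral_exp_rescaledGCor_sub_lt hK F hC1 hpos hC2 hC3 hn hc t
      (half_pos hδ), hlim.eventually_lt_const (half_lt_self hδ),
      hn.eventually_gt_atTop 0] with m hm hlt hn0
    rw [dist_eq_norm]
    exact (norm_integral_exp_rescaledGCor_random_sub_le (hX m) (hY m) (hXY m) (hind m) (hπ m) hc
      hcπ hn0 t (half_pos hδ).le fun y hy => (hm y hy).le).trans_lt hlt
  · rintro y hind hsize ⟨c, hc, hcy⟩
    have hXm : ∀ m, AEMeasurable (fun ω i => X m i ω) (P m) := fun m =>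
      aemeasurable_pi_lambda _ fun i => (hX m i).aemeasurable
    refine tendstoInDistribution_gaussian_of_charFun P (fun m => ?_) fun t => ?_
    · have h2 := (measurable_rescaledGCor (y m)).comp_aemeasurable (hXm m)
      simp only [Function.comp_def] at h2
      exact h2
    -- The total size dominates the size of any one class, and class 0 exists since K ≥ 2.
    have hn : Tendsto n atTop atTop := by
      refine tendsto_atTop_mono (fun m => ?_) (hsize ⟨0, by omega⟩)
      exact (Finset.card_le_univ _).trans (Fintype.card_fin _).le
    rw [Metric.tendsto_nhds]
    intro δ hδ
    filter_upwards [eventually_norm_integral_exp_rescaledGCor_sub_lt hK F hC1 hpos hC2 hC3 hn hc t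
      hδ, eventually_all.2 hcy] with m hm hmy
    rw [dist_eq_norm]
    have hmeas : Measurable fun x : Fin (n m) → Eucl (p m) =>
        Complex.exp (Complex.I * (t * rescaledGCor x (y m) : ℝ)) :=
      Complex.measurable_exp.comp ((Complex.measurable_ofReal.comp
        ((measurable_rescaledGCor (y m)).const_mul t)).const_mul _)
    have e := integral_map (hXm m) (f := fun x : Fin (n m) → Eucl (p m) =>
      Complex.exp (Complex.I * (t * rescaledGCor x (y m) : ℝ))) hmeas.aestronglyMeasurable
    rw [← e, map_sample_eq_pi (hX m) (hind m)]
    exact hm (y m) hmy
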